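/- Let $X$ be a topological space and $\mathcal P$ a 2-gerbe on $X$, i.e. a 2-stack in 2-groupoids (a fibered 2-category in 2-groupoids $U\mapsto\mathcal P_U$, with inverse image 2-functors $f^*$, natural transformations $(fg)^*\Rightarrow g^*f^*$ and coherent modifications comparing the composites $(fgh)^*\Rightarrow h^*g^*f^*$, whose fibered categories of 1-arrows are stacks and in which 2-descent is effective) that is locally non-empty and locally connected. Write $\mathcal G_x=\mathcal Ar_U(x,x)$ for the group-like monoidal stack on $U$ attached to an object $x$ of $\mathcal P_U$; when $\mathcal P$ is a $\mathcal G$-2-gerbe, the stacks $\mathcal G_{x_i}$ below are the ones which are identified with $\mathcal G_{|U_i}$. Let $(U_i)_{i\in I}$ be an open covering of $X$, and choose * objects $x_i\in\mathcal P_{U_i}$; * 1-arrows $\phi_{ij}:x_j\to x_i$ in $\mathcal P_{U_{ij}}$, with quasi-inverses and 2-arrows $\phi_{ij}\phi_{ij}^{-1}\Rightarrow 1$, $\phi_{ij}^{-1}\phi_{ij}\Rightarrow 1$ satisfying the triangle identities; conjugation $\gamma\mapsto\phi_{ij}\gamma\phi_{ij}^{-1}$ defines a monoidal equivalence $\lambda_{ij}:\mathcal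 G_{x_j}\to\mathcal G_{x_i}$ over $U_{ij}$, with canonical 2-arrows $M_{ij}(\gamma):\lambda_{ij}(\gamma)\,\phi_{ij}\Rightarrow\phi_{ij}\,\gamma$; * objects $g_{ijk}$ of $\mathcal G_{x_i}$ over $U_{ijk}$ (with inverses), and 2-arrows $m_{ijk}:g_{ijk}\,\phi_{ik}\Rightarrow\phi_{ij}\,\phi_{jk}$ in $\mathcal P_{U_{ijk}}$. Let $\widetilde m_{ijk}: i_{g_{ijk}}\lambda_{ik}\Rightarrow\lambda_{ij}\lambda_{jk}$ be the natural transformation obtained from $m_{ijk}$ by conjugation ($i_g$ being conjugation by $g$), and for an object $u$ of $\mathcal G_{x_k}$ let $$\{\widetilde m_{ijk},u\}:\ g_{ijk}\,\lambda_{ik}(u)\Rightarrow i_{g_{ijk}}(\lambda_{ik}(u))\,g_{ijk}\Rightarrow\lambda_{ij}\lambda_{jk}(u)\,g_{ijk}$$ be the composite of the canonical 2-arrow and of $\widetilde m_{ijk}(u)$. Then: 1. For all $i,j,k,l$ there is a unique 2-arrow $\nu_{ijkl}:\lambda_{ij}(g_{jkl})\,g_{ijl}\Rightarrow g_{ijk}\,g_{ikl}$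 in $\mathcal P_{U_{ijkl}}$ for which the cube $C_{ijkl}$, whose six faces are $\nu_{ijkl}$, $m_{ijk}$, $m_{ijl}$, $m_{ikl}$, $m_{jkl}$ and $M_{ij}(g_{jkl})$, commutes; that is, both composites $\lambda_{ij}(g_{jkl})\,g_{ijl}\,\phi_{il}\Rightarrow\phi_{ij}\phi_{jk}\phi_{kl}$ of (whiskered) faces coincide. 2. For all $i,j,k,l,m$, the cube of 2-arrows over $U_{ijklm}$ (and hence over every open $V\subseteq U_{ijklm}$) with left face $\nu_{iklm}$, right face $\lambda_{ij}(\nu_{jklm})$, top face $\nu_{ijlm}$, bottom face $\{\widetilde m_{ijk},g_{klm}\}^{-1}$, front face $\nu_{ijkm}$ and back face $\nu_{ijkl}$ commutes: the two composites $$\lambda_{ij}\lambda_{jk}(g_{klm})\,\lambda_{ij}(g_{jkm})\,g_{ijm}\Longrightarrow g_{ijk}\,g_{ikl}\,g_{ilm}$$ of whiskered faces coincide. Equivalently, with right whiskerings suppressed and left whiskering by an object $g$ denoted ${}^{g}(\ )$, one has in $\mathrm{Ar}(\mathcal G_{x_i})$ over $U_{ijklm}$ the twisted non-abelian 3-cocycle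 equation $$\nu_{ijkl}\;\bigl({}^{\lambda_{ij}(g_{jkl})}\nu_{ijlm}\bigr)\;\lambda_{ij}(\nu_{jklm})={}^{g_{ijk}}\nu_{iklm}\;\{\widetilde m_{ijk},g_{klm}\}^{-1}\;\bigl({}^{\lambda_{ij}\lambda_{jk}(g_{klm})}\nu_{ijkm}\bigr).$$ -/

import Mathlib

open CategoryTheory CategoryTheory.Bicategory TopologicalSpace

universe w v u t s

/-! ## Invertible 1-arrows, conjugation and cubes in a bicategory

Mathlib writes composites in diagrammatic order: `f ≫ g` is "first `f`, then `g`". -/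

section Bicategories

variable {B : Type u} [Bicategory.{w, v} B]

/-- A 2-groupoid: every 1-arrow is invertible up to a 2-arrow, and every 2-arrow is strictly
invertible. -/
structure IsTwoGroupoid (B : Type u) [Bicategory.{w, v} B] : Prop where
  exists_inverse : ∀ {x y : B} (f : x ⟶ y), ∃ f' : y ⟶ x,
    Nonempty (f ≫ f' ≅ 𝟙 x) ∧ Nonempty (f' ≫ f ≅ 𝟙 y)
  isIso : ∀ {x y : B} {f g : x ⟶ y} (η : f ⟶ g), IsIso η

/-- A choice of adjoint equivalence whose underlying 1-arrow is a given 1-arrow of a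
2-groupoid. -/
noncomputable def IsTwoGroupoid.equiv (hB : IsTwoGroupoid B) {x y : B} (f : x ⟶ y) : x ≌ y :=
  Equivalence.mkOfAdjointifyCounit
    (hB.exists_inverse f).choose_spec.1.some.symm (hB.exists_inverse f).choose_spec.2.some

theorem IsTwoGroupoid.equiv_hom (hB : IsTwoGroupoid B) {x y : B} (f : x ⟶ y) :
    (hB.equiv f).hom = f := rfl

/-- A quasi-inverse `inv` of the 1-arrow `f : x ⟶ y`, together with the 2-arrows
`s : f⁻¹ f ⇒ 1_x` and `r : f f⁻¹ ⇒ 1_y`. -/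
structure QuasiInverse {x y : B} (f : x ⟶ y) where
  inv : y ⟶ x
  s : f ≫ inv ≅ 𝟙 x
  r : inv ≫ f ≅ 𝟙 y

namespace QuasiInverse

/-- The quasi-inverse contained in an adjoint equivalence. -/
@[simps] def ofEquivalence {x y : B} (e : x ≌ y) : QuasiInverse e.hom where
  inv := e.inv
  s := e.unit.symm
  r := e.counit

/-- The quasi-inverse `f⁻¹ g⁻¹` of the composite `g f`. -/
@[simps] def comp {x y z : B} {f : x ⟶ y} {g : y ⟶ z} (p : QuasiInverse f)
    (q : QuasiInverse g) : QuasiInverse (f ≫ g) where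
  inv := q.inv ≫ p.inv
  s := Iso.refl ((f ≫ g) ≫ q.inv ≫ p.inv) ≪⊗≫
    whiskerLeftIso f (whiskerRightIso q.s p.inv) ≪⊗≫ p.s
  r := Iso.refl ((q.inv ≫ p.inv) ≫ f ≫ g) ≪⊗≫
    whiskerLeftIso q.inv (whiskerRightIso p.r g) ≪⊗≫ q.r

variable {x y : B} {f : x ⟶ y}

/-- Conjugation of a 1-arrow `γ : x ⟶ x` by `f`, i.e. the composite `f γ f⁻¹`. -/
abbrev conj (q : QuasiInverse f) (γ : x ⟶ x) : y ⟶ y := q.inv ≫ γ ≫ f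

/-- Conjugation of a 2-arrow by `f`. -/
abbrev conj₂ (q : QuasiInverse f) {γ γ' : x ⟶ x} (η : γ ⟶ γ') : q.conj γ ⟶ q.conj γ' :=
  q.inv ◁ η ▷ f

/-- The monoidal constraint of conjugation: `f (γ' γ) f⁻¹ ≅ (f γ' f⁻¹) (f γ f⁻¹)`. -/
def conjComp (q : QuasiInverse f) (γ γ' : x ⟶ x) :
    q.conj (γ ≫ γ') ≅ q.conj γ ≫ q.conj γ' :=
  Iso.refl (q.inv ≫ (γ ≫ γ') ≫ f) ≪⊗≫
    whiskerLeftIso (q.inv ≫ γ) (whiskerRightIso q.s.symm (γ' ≫ f)) ≪⊗≫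
    Iso.refl ((q.inv ≫ γ ≫ f) ≫ q.inv ≫ γ' ≫ f)

/-- The structural 2-arrow `M(γ) : (f γ f⁻¹) f ⇒ f γ`. -/
def conjSquare (q : QuasiInverse f) (γ : x ⟶ x) : f ≫ q.conj γ ≅ γ ≫ f :=
  Iso.refl (f ≫ q.inv ≫ γ ≫ f) ≪⊗≫ whiskerRightIso q.s (γ ≫ f) ≪⊗≫ Iso.refl (γ ≫ f)

/-- Conjugation by a composite `g f` is conjugation by `f` followed by conjugation by `g`. -/
def conjConj {z : B} {g : y ⟶ z} (p : QuasiInverse f) (q : QuasiInverse g) (u : x ⟶ x) :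
    (p.comp q).conj u ≅ q.conj (p.conj u) :=
  Iso.refl ((q.inv ≫ p.inv) ≫ u ≫ f ≫ g) ≪⊗≫ Iso.refl (q.inv ≫ (p.inv ≫ u ≫ f) ≫ g)

/-- The horizontal inverse `f⁻¹ ⇒ g⁻¹` of a 2-arrow `m : f ⇒ g`. -/
def horizontalInv {g : x ⟶ y} (p : QuasiInverse f) (q : QuasiInverse g) (m : f ≅ g) :
    p.inv ≅ q.inv :=
  Iso.refl p.inv ≪⊗≫ whiskerRightIso q.r.symm p.inv ≪⊗≫
    whiskerLeftIso q.inv (whiskerRightIso m.symm p.inv) ≪⊗≫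
    whiskerLeftIso q.inv p.s ≪⊗≫ Iso.refl q.inv

/-- The 2-arrow `f u f⁻¹ ⇒ g u g⁻¹` obtained by conjugating the 1-arrow `u` by a 2-arrow
`m : f ⇒ g`: the horizontal composite of `m⁻¹`, `u` and `m`. -/
def tilde {g : x ⟶ y} (p : QuasiInverse f) (q : QuasiInverse g) (m : f ≅ g) (u : x ⟶ x) :
    p.conj u ≅ q.conj u :=
  whiskerRightIso (p.horizontalInv q m) (u ≫ f) ≪≫ whiskerLeftIso q.inv (whiskerLeftIso u m)

end QuasiInverse

/-- A 2-arrow between 1-arrows `p` and `q` obtained from one between `p ≫ f` and `q ≫ f`, where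
`f` is the 1-arrow of an adjoint equivalence `e`. -/
def cancelRight {a b c : B} (e : b ≌ c) {p q : a ⟶ b} (θ : p ≫ e.hom ≅ q ≫ e.hom) : p ≅ q :=
  (ρ_ p).symm ≪≫ whiskerLeftIso p e.unit ≪≫ (α_ p e.hom e.inv).symm ≪≫
    whiskerRightIso θ e.inv ≪≫ α_ q e.hom e.inv ≪≫ whiskerLeftIso q e.unit.symm ≪≫ ρ_ q

/-- The 2-arrow `cancelRight e θ` is characterized by its whiskering with `f` being `θ`. -/
theorem whiskerRightIso_cancelRight {a b c : B} (e : b ≌ c) {p q : a ⟶ b}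
    (θ : p ≫ e.hom ≅ q ≫ e.hom) : whiskerRightIso (cancelRight e θ) e.hom = θ := by
  have h2 : 𝟙 (𝟙 b ≫ e.hom) ≫ e.unit.hom ▷ e.hom ⊗≫ e.hom ◁ e.counit.hom =
      (λ_ e.hom).hom ≫ (ρ_ e.hom).inv := by
    rw [Category.id_comp]
    exact e.left_triangle_hom
  have h3 : e.unit.inv ▷ e.hom =
      𝟙 _ ⊗≫ e.hom ◁ e.counit.hom ⊗≫ 𝟙 (𝟙 b ≫ e.hom) := by
    have h4 : e.unit.hom ▷ e.hom ≫ (𝟙 _ ⊗≫ e.hom ◁ e.counit.hom ⊗≫ 𝟙 (𝟙 b ≫ e.hom)) = 𝟙 _ := by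
      calc _ = (𝟙 (𝟙 b ≫ e.hom) ≫ e.unit.hom ▷ e.hom ⊗≫ e.hom ◁ e.counit.hom) ⊗≫
            𝟙 (𝟙 b ≫ e.hom) := by bicategory
        _ = _ := by rw [h2]; bicategory
    rw [← cancel_epi (e.unit.hom ▷ e.hom), h4, ← comp_whiskerRight, Iso.hom_inv_id,
      id_whiskerRight]
  ext
  calc
    _ = 𝟙 _ ⊗≫ p ◁ e.unit.hom ▷ e.hom ⊗≫ θ.hom ▷ (e.inv ≫ e.hom) ⊗≫
          q ◁ (e.unit.inv ▷ e.hom) ⊗≫ 𝟙 _ := by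
      simp only [cancelRight, Iso.trans_hom, Iso.symm_hom, whiskerLeftIso_hom,
        whiskerRightIso_hom]
      bicategory
    _ = 𝟙 _ ⊗≫ p ◁ e.unit.hom ▷ e.hom ⊗≫ (θ.hom ▷ (e.inv ≫ e.hom) ≫
          (q ≫ e.hom) ◁ e.counit.hom) ⊗≫ 𝟙 _ := by
      rw [h3]; bicategory
    _ = 𝟙 _ ⊗≫ p ◁ (𝟙 (𝟙 b ≫ e.hom) ≫ e.unit.hom ▷ e.hom ⊗≫ e.hom ◁ e.counit.hom) ⊗≫
          θ.hom ⊗≫ 𝟙 _ := by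
      rw [← whisker_exchange]; bicategory
    _ = _ := by rw [h2]; simp; bicategory

/-- Commutativity of a cube of 2-arrows. The vertices are `v₀₀₀, …, v₁₁₁`; the edges out of the
initial vertex are `a₁, a₂, a₃` (in the three directions), the edge `bᵢⱼ` follows `aᵢ` in
direction `j`, and `c₁, c₂, c₃` are the edges, in the three directions, into the terminal
vertex. The face `Fᵢⱼ` contains the initial vertex, the opposite face is `Gᵢⱼ`.
The two composites are the two ways of passing, through three faces each, from the path
`a₁, b₁₂, c₃` to the path `a₃, b₃₂, c₁`; the symbol `⊗≫` is vertical composition of 2-arrows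
with the necessary associativity 2-arrows inserted. -/
def CubeCommutes {v₀₀₀ v₁₀₀ v₀₁₀ v₀₀₁ v₁₁₀ v₁₀₁ v₀₁₁ v₁₁₁ : B}
    {a₁ : v₀₀₀ ⟶ v₁₀₀} {a₂ : v₀₀₀ ⟶ v₀₁₀} {a₃ : v₀₀₀ ⟶ v₀₀₁}
    {b₁₂ : v₁₀₀ ⟶ v₁₁₀} {b₁₃ : v₁₀₀ ⟶ v₁₀₁} {b₂₁ : v₀₁₀ ⟶ v₁₁₀}
    {b₂₃ : v₀₁₀ ⟶ v₀₁₁} {b₃₁ : v₀₀₁ ⟶ v₁₀₁} {b₃₂ : v₀₀₁ ⟶ v₀₁₁}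
    {c₁ : v₀₁₁ ⟶ v₁₁₁} {c₂ : v₁₀₁ ⟶ v₁₁₁} {c₃ : v₁₁₀ ⟶ v₁₁₁}
    (F₁₂ : a₁ ≫ b₁₂ ⟶ a₂ ≫ b₂₁) (G₁₂ : b₃₁ ≫ c₂ ⟶ b₃₂ ≫ c₁)
    (F₁₃ : a₁ ≫ b₁₃ ⟶ a₃ ≫ b₃₁) (G₁₃ : b₂₁ ≫ c₃ ⟶ b₂₃ ≫ c₁)
    (F₂₃ : a₂ ≫ b₂₃ ⟶ a₃ ≫ b₃₂) (G₂₃ : b₁₂ ≫ c₃ ⟶ b₁₃ ≫ c₂) : Prop :=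
  𝟙 (a₁ ≫ b₁₂ ≫ c₃) ⊗≫ a₁ ◁ G₂₃ ⊗≫ F₁₃ ▷ c₂ ⊗≫ a₃ ◁ G₁₂ ⊗≫ 𝟙 (a₃ ≫ b₃₂ ≫ c₁) =
    𝟙 (a₁ ≫ b₁₂ ≫ c₃) ⊗≫ F₁₂ ▷ c₃ ⊗≫ a₂ ◁ G₁₃ ⊗≫ F₂₃ ▷ c₁ ⊗≫ 𝟙 (a₃ ≫ b₃₂ ≫ c₁)

end Bicategories

/-! ## Fibered 2-categories in 2-groupoids -/

/-- The 2-groupoids, inverse image 2-functors and natural transformations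
`φ_{f,g} : (fg)^* ⟹ g^* f^*` of a fibered 2-category on the space `X`. An inclusion of open sets
`V ⊆ U` is a proof of `V ≤ U`. -/
structure PreFiberedTwoGroupoid (X : Type t) [TopologicalSpace X] where
  Fib : Opens X → Type u
  bicat : ∀ U, Bicategory.{w, v} (Fib U)
  isTwoGroupoid : ∀ U, IsTwoGroupoid (Fib U)
  res : ∀ {U V : Opens X}, V ≤ U → (Fib U ⥤ᵖ Fib V)
  res_refl : ∀ U : Opens X, res (le_refl U) = Pseudofunctor.id (Fib U)
  φ : ∀ {U V W : Opens X} (f : V ≤ U) (g : W ≤ V),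
    Pseudofunctor.StrongTrans (res (g.trans f)) ((res f).comp (res g))

namespace PreFiberedTwoGroupoid

variable {X : Type t} [TopologicalSpace X] (P : PreFiberedTwoGroupoid.{w, v, u} X)

instance (U : Opens X) : Bicategory.{w, v} (P.Fib U) := P.bicat U

variable {U V W T S : Opens X}

/-- The component `(fg)^* x ⟶ g^* f^* x` of `φ_{f,g}`. -/
def c (f : V ≤ U) (g : W ≤ V) (x : P.Fib U) :
    (P.res (g.trans f)).obj x ⟶ (P.res g).obj ((P.res f).obj x) :=
  (P.φ f g).app x

/-- The naturality 2-arrow of `φ_{f,g}` at a 1-arrow `a`. -/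
def cNat (f : V ≤ U) (g : W ≤ V) {x y : P.Fib U} (a : x ⟶ y) :
    (P.res (g.trans f)).map a ≫ P.c f g y ≅ P.c f g x ≫ (P.res g).map ((P.res f).map a) :=
  (P.φ f g).naturality a

/-- The component at `x` of `ψ_{f,g,h} : (fgh)^* ⟹ h^* (fg)^* ⟹ h^* g^* f^*`. -/
abbrev psi (f : V ≤ U) (g : W ≤ V) (h : T ≤ W) (x : P.Fib U) :
    (P.res ((h.trans g).trans f)).obj x ⟶ (P.res h).obj ((P.res g).obj ((P.res f).obj x)) :=
  P.c (g.trans f) h x ≫ (P.res h).map (P.c f g x)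

/-- The component at `x` of `χ_{f,g,h} : (fgh)^* ⟹ (gh)^* f^* ⟹ h^* g^* f^*`. -/
abbrev chi (f : V ≤ U) (g : W ≤ V) (h : T ≤ W) (x : P.Fib U) :
    (P.res ((h.trans g).trans f)).obj x ⟶ (P.res h).obj ((P.res g).obj ((P.res f).obj x)) :=
  P.c f (h.trans g) x ≫ P.c g h ((P.res f).obj x)

/-- The naturality 2-arrow of `ψ_{f,g,h}` at a 1-arrow `a`. -/
def psiNat (f : V ≤ U) (g : W ≤ V) (h : T ≤ W) {x y : P.Fib U} (a : x ⟶ y) :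
    (P.res ((h.trans g).trans f)).map a ≫ P.psi f g h y ≅
      P.psi f g h x ≫ (P.res h).map ((P.res g).map ((P.res f).map a)) :=
  (α_ _ _ _).symm ≪≫ whiskerRightIso (P.cNat (g.trans f) h a) ((P.res h).map (P.c f g y)) ≪≫
    α_ _ _ _ ≪≫
    whiskerLeftIso (P.c (g.trans f) h x)
      (((P.res h).mapComp _ _).symm ≪≫ (P.res h).map₂Iso (P.cNat f g a) ≪≫
        (P.res h).mapComp _ _) ≪≫
    (α_ _ _ _).symm

/-- The naturality 2-arrow of `χ_{f,g,h}` at a 1-arrow `a`. -/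
def chiNat (f : V ≤ U) (g : W ≤ V) (h : T ≤ W) {x y : P.Fib U} (a : x ⟶ y) :
    (P.res ((h.trans g).trans f)).map a ≫ P.chi f g h y ≅
      P.chi f g h x ≫ (P.res h).map ((P.res g).map ((P.res f).map a)) :=
  (α_ _ _ _).symm ≪≫ whiskerRightIso (P.cNat f (h.trans g) a) (P.c g h ((P.res f).obj y)) ≪≫
    α_ _ _ _ ≪≫
    whiskerLeftIso (P.c f (h.trans g) x) (P.cNat g h ((P.res f).map a)) ≪≫
    (α_ _ _ _).symm

/-- The first way of comparing `(fghk)^* ⟹ k^* (fgh)^* ⟹ k^* h^* (fg)^* ⟹ k^* h^* g^* f^*` with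
`(fghk)^* ⟹ (ghk)^* f^* ⟹ (hk)^* g^* f^* ⟹ k^* h^* g^* f^*`, via
`(fghk)^* ⟹ k^* (fgh)^* ⟹ k^* (gh)^* f^* ⟹ k^* h^* g^* f^*`. -/
def compare₁ (α : ∀ {U V W T : Opens X} (f : V ≤ U) (g : W ≤ V) (h : T ≤ W) (x : P.Fib U),
      P.psi f g h x ≅ P.chi f g h x)
    (f : V ≤ U) (g : W ≤ V) (h : T ≤ W) (k : S ≤ T) (x : P.Fib U) :
    P.c ((h.trans g).trans f) k x ≫ (P.res k).map (P.c (g.trans f) h x) ≫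
        (P.res k).map ((P.res h).map (P.c f g x)) ≅
      P.c f ((k.trans h).trans g) x ≫ P.c g (k.trans h) ((P.res f).obj x) ≫
        P.c h k ((P.res g).obj ((P.res f).obj x)) :=
  whiskerLeftIso (P.c ((h.trans g).trans f) k x)
      (((P.res k).mapComp (P.c (g.trans f) h x) ((P.res h).map (P.c f g x))).symm ≪≫
        (P.res k).map₂Iso (α f g h x) ≪≫
        (P.res k).mapComp (P.c f (h.trans g) x) (P.c g h ((P.res f).obj x))) ≪≫
    (α_ _ _ _).symm ≪≫
    whiskerRightIso (α f (h.trans g) k x) ((P.res k).map (P.c g h ((P.res f).obj x))) ≪≫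
    α_ _ _ _ ≪≫
    whiskerLeftIso (P.c f ((k.trans h).trans g) x) (α g h k ((P.res f).obj x))

/-- The second way of comparing these two composites, via
`(fghk)^* ⟹ (hk)^* (fg)^* ⟹ k^* h^* (fg)^* ⟹ k^* h^* g^* f^*` and
`(fghk)^* ⟹ (hk)^* (fg)^* ⟹ (hk)^* g^* f^* ⟹ k^* h^* g^* f^*`. -/
def compare₂ (α : ∀ {U V W T : Opens X} (f : V ≤ U) (g : W ≤ V) (h : T ≤ W) (x : P.Fib U),
      P.psi f g h x ≅ P.chi f g h x)
    (f : V ≤ U) (g : W ≤ V) (h : T ≤ W) (k : S ≤ T) (x : P.Fib U) :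
    P.c ((h.trans g).trans f) k x ≫ (P.res k).map (P.c (g.trans f) h x) ≫
        (P.res k).map ((P.res h).map (P.c f g x)) ≅
      P.c f ((k.trans h).trans g) x ≫ P.c g (k.trans h) ((P.res f).obj x) ≫
        P.c h k ((P.res g).obj ((P.res f).obj x)) :=
  (α_ _ _ _).symm ≪≫
    whiskerRightIso (α (g.trans f) h k x) ((P.res k).map ((P.res h).map (P.c f g x))) ≪≫
    α_ _ _ _ ≪≫
    whiskerLeftIso (P.c (g.trans f) (k.trans h) x) (P.cNat h k (P.c f g x)).symm ≪≫
    (α_ _ _ _).symm ≪≫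
    whiskerRightIso (α f g (k.trans h) x) (P.c h k ((P.res g).obj ((P.res f).obj x))) ≪≫
    α_ _ _ _

end PreFiberedTwoGroupoid

/-- A fibered 2-category in 2-groupoids above the space `X`: in addition to the preceding data,
modifications `α_{f,g,h} : ψ_{f,g,h} ⇛ χ_{f,g,h}` are given, such that for four composable
inclusions `f, g, h, k` the two induced ways of comparing
`(fghk)^* ⟹ k^* (fgh)^* ⟹ k^* h^* (fg)^* ⟹ k^* h^* g^* f^*` with
`(fghk)^* ⟹ (ghk)^* f^* ⟹ (hk)^* g^* f^* ⟹ k^* h^* g^* f^*` coincide. -/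
structure FiberedTwoGroupoid (X : Type t) [TopologicalSpace X] extends
    PreFiberedTwoGroupoid.{w, v, u} X where
  α : ∀ {U V W T : Opens X} (f : V ≤ U) (g : W ≤ V) (h : T ≤ W) (x : Fib U),
    toPreFiberedTwoGroupoid.psi f g h x ≅ toPreFiberedTwoGroupoid.chi f g h x
  α_naturality : ∀ {U V W T : Opens X} (f : V ≤ U) (g : W ≤ V) (h : T ≤ W) {x y : Fib U}
    (a : x ⟶ y),
    (res ((h.trans g).trans f)).map a ◁ (α f g h y).hom ≫
        (toPreFiberedTwoGroupoid.chiNat f g h a).hom =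
      (toPreFiberedTwoGroupoid.psiNat f g h a).hom ≫
        (α f g h x).hom ▷ (res h).map ((res g).map ((res f).map a))
  α_coherence : ∀ {U V W T S : Opens X} (f : V ≤ U) (g : W ≤ V) (h : T ≤ W) (k : S ≤ T)
    (x : Fib U),
    toPreFiberedTwoGroupoid.compare₁ α f g h k x = toPreFiberedTwoGroupoid.compare₂ α f g h k x

namespace FiberedTwoGroupoid

variable {X : Type t} [TopologicalSpace X] (P : FiberedTwoGroupoid.{w, v, u} X)

instance (U : Opens X) : Bicategory.{w, v} (P.Fib U) := P.bicat U

/-! ### Restriction of 1-arrows and 2-arrows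

For objects `x` above `U` and `y` above `U'`, and open sets `W ⊆ V ⊆ U ∩ U'`, a 1-arrow
`x|_V ⟶ y|_V` restricts to a 1-arrow `x|_W ⟶ y|_W`, by means of the comparison 1-arrows
`x|_W ⟶ (x|_V)|_W` and `y|_W ⟶ (y|_V)|_W`. -/

variable {U U' U'' V W T : Opens X}

/-- The comparison 1-arrow `x|_W ⟶ (x|_V)|_W`, as an adjoint equivalence. -/
noncomputable def cE (f : V ≤ U) (g : W ≤ V) (x : P.Fib U) :
    (P.res (g.trans f)).obj x ≌ (P.res g).obj ((P.res f).obj x) :=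
  (P.isTwoGroupoid W).equiv (P.c f g x)

section

variable {hU : V ≤ U} {hU' : V ≤ U'} {hU'' : V ≤ U''} {x : P.Fib U} {y : P.Fib U'}
  {z : P.Fib U''} (h : W ≤ V) (k : T ≤ W)

/-- The restriction to `W` of a 1-arrow `f : x|_V ⟶ y|_V`. -/
noncomputable def res₁ (f : (P.res hU).obj x ⟶ (P.res hU').obj y) :
    (P.res (h.trans hU)).obj x ⟶ (P.res (h.trans hU')).obj y :=
  (P.cE hU h x).hom ≫ (P.res h).map f ≫ (P.cE hU' h y).inv

/-- The restriction to `W` of a 2-arrow between 1-arrows `x|_V ⟶ y|_V`. -/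
noncomputable def res₂ {f g : (P.res hU).obj x ⟶ (P.res hU').obj y} (η : f ⟶ g) :
    P.res₁ h f ⟶ P.res₁ h g :=
  (P.cE hU h x).hom ◁ (P.res h).map₂ η ▷ (P.cE hU' h y).inv

/-- The restriction to `W` of an invertible 2-arrow. -/
@[simps] noncomputable def res₂Iso {f g : (P.res hU).obj x ⟶ (P.res hU').obj y} (η : f ≅ g) :
    P.res₁ h f ≅ P.res₁ h g where
  hom := P.res₂ h η.hom
  inv := P.res₂ h η.inv
  hom_inv_id := by
    simp [res₂, res₁, ← Bicategory.whiskerLeft_comp, ← Bicategory.comp_whiskerRight,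
      ← PrelaxFunctor.map₂_comp]
  inv_hom_id := by
    simp [res₂, res₁, ← Bicategory.whiskerLeft_comp, ← Bicategory.comp_whiskerRight,
      ← PrelaxFunctor.map₂_comp]

/-- The square which relates `f : x|_V ⟶ y|_V` to its restriction to `W`. -/
noncomputable def resSquare (f : (P.res hU).obj x ⟶ (P.res hU').obj y) :
    P.res₁ h f ≫ P.c hU' h y ≅ P.c hU h x ≫ (P.res h).map f :=
  Iso.refl ((P.c hU h x ≫ (P.res h).map f ≫ (P.cE hU' h y).inv) ≫ (P.cE hU' h y).hom) ≪⊗≫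
    whiskerLeftIso (P.c hU h x) (whiskerLeftIso ((P.res h).map f) (P.cE hU' h y).counit) ≪⊗≫
    Iso.refl (P.c hU h x ≫ (P.res h).map f)

/-- Restriction is compatible with identities. -/
noncomputable def resId (hU : V ≤ U) (x : P.Fib U) :
    P.res₁ h (𝟙 ((P.res hU).obj x)) ≅ 𝟙 ((P.res (h.trans hU)).obj x) :=
  cancelRight (P.cE hU h x)
    (P.resSquare h (𝟙 ((P.res hU).obj x)) ≪≫
      whiskerLeftIso (P.c hU h x) ((P.res h).mapId _) ≪≫ ρ_ _ ≪≫ (λ_ _).symm)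

/-- Restriction is compatible with composition. -/
noncomputable def resComp (f : (P.res hU).obj x ⟶ (P.res hU').obj y)
    (g : (P.res hU').obj y ⟶ (P.res hU'').obj z) :
    P.res₁ h (f ≫ g) ≅ P.res₁ h f ≫ P.res₁ h g :=
  cancelRight (P.cE hU'' h z)
    (P.resSquare h (f ≫ g) ≪≫ whiskerLeftIso (P.c hU h x) ((P.res h).mapComp f g) ≪≫
      (α_ _ _ _).symm ≪≫ whiskerRightIso (P.resSquare h f).symm ((P.res h).map g) ≪≫
      α_ _ _ _ ≪≫ whiskerLeftIso (P.res₁ h f) (P.resSquare h g).symm ≪≫ (α_ _ _ _).symm)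

/-- Restriction is transitive: `(f|_W)|_T ≅ f|_T`. It is the 2-arrow induced by the naturality of
`c` and by the modification `α`. -/
noncomputable def resRes (f : (P.res hU).obj x ⟶ (P.res hU').obj y) :
    P.res₁ k (P.res₁ h f) ≅ P.res₁ (k.trans h) f :=
  cancelRight (P.cE (h.trans hU') k y) <| cancelRight
    ((P.isTwoGroupoid T).equiv ((P.res k).map (P.c hU' h y))) <|
    whiskerRightIso (P.resSquare k (P.res₁ h f)) ((P.res k).map (P.c hU' h y)) ≪≫
      α_ _ _ _ ≪≫
      whiskerLeftIso (P.c (h.trans hU) k x) (((P.res k).mapComp _ _).symm ≪≫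
        (P.res k).map₂Iso (P.resSquare h f) ≪≫ (P.res k).mapComp _ _) ≪≫
      (α_ _ _ _).symm ≪≫
      whiskerRightIso (P.α hU h k x) ((P.res k).map ((P.res h).map f)) ≪≫
      α_ _ _ _ ≪≫
      whiskerLeftIso (P.c hU (k.trans h) x) (P.cNat h k f).symm ≪≫
      (α_ _ _ _).symm ≪≫
      whiskerRightIso (P.resSquare (k.trans h) f).symm (P.c h k ((P.res hU').obj y)) ≪≫
      α_ _ _ _ ≪≫
      whiskerLeftIso (P.res₁ (k.trans h) f) (P.α hU' h k y).symm ≪≫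
      (α_ _ _ _).symm

/-- The restriction to `T` of a 2-arrow `f|_W ⇒ g|_W`. -/
noncomputable def res₂' {f g : (P.res hU).obj x ⟶ (P.res hU').obj y}
    (η : P.res₁ h f ⟶ P.res₁ h g) : P.res₁ (k.trans h) f ⟶ P.res₁ (k.trans h) g :=
  (P.resRes h k f).inv ≫ P.res₂ k η ≫ (P.resRes h k g).hom

/-- The restriction of a quasi-inverse. -/
@[simps inv] noncomputable def resQuasiInverse {f : (P.res hU).obj x ⟶ (P.res hU').obj y}
    (q : QuasiInverse f) : QuasiInverse (P.res₁ h f) where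
  inv := P.res₁ h q.inv
  s := (P.resComp h f q.inv).symm ≪≫ P.res₂Iso h q.s ≪≫ P.resId h hU x
  r := (P.resComp h q.inv f).symm ≪≫ P.res₂Iso h q.r ≪≫ P.resId h hU' y

end

/-! ### 2-stacks and 2-gerbes -/

/-- The fibered category `Ar_U(x, y)` of 1-arrows between the restrictions of two objects `x, y`
above `U` is a stack: for any open covering `(V_a)` of an open set `V ⊆ U`, 2-arrows between
1-arrows `x|_V ⟶ y|_V` can be glued in a unique manner, and every descent datum
`(f_a, θ_{ab})` of 1-arrows is effective. -/
structure ArIsStack (U : Opens X) (x y : P.Fib U) : Prop where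
  glue : ∀ {κ : Type t} (V : Opens X) (hV : V ≤ U) (C : κ → Opens X) (hC : ∀ a, C a ≤ V)
    (_ : ⨆ a, C a = V) (f g : (P.res hV).obj x ⟶ (P.res hV).obj y)
    (η : ∀ a, P.res₁ (hC a) f ⟶ P.res₁ (hC a) g),
    (∀ a b, P.res₂' (hC a) (inf_le_left : C a ⊓ C b ≤ C a) (η a) =
      P.res₂' (hC b) (inf_le_right : C a ⊓ C b ≤ C b) (η b)) →
    ∃! ζ : f ⟶ g, ∀ a, P.res₂ (hC a) ζ = η a
  descent : ∀ {κ : Type t} (V : Opens X) (hV : V ≤ U) (C : κ → Opens X) (hC : ∀ a, C a ≤ V)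
    (_ : ⨆ a, C a = V)
    (f : ∀ a, (P.res ((hC a).trans hV)).obj x ⟶ (P.res ((hC a).trans hV)).obj y)
    (θ : ∀ a b, P.res₁ (inf_le_left : C a ⊓ C b ≤ C a) (f a) ⟶
      P.res₁ (inf_le_right : C a ⊓ C b ≤ C b) (f b)),
    (∀ a b c,
      ((P.resRes inf_le_left (inf_le_left : C a ⊓ C b ⊓ C c ≤ C a ⊓ C b) (f a)).inv ≫
        P.res₂ inf_le_left (θ a b) ≫ (P.resRes inf_le_right inf_le_left (f b)).hom) ≫
      ((P.resRes inf_le_left (le_inf (inf_le_left.trans inf_le_right) inf_le_right :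
          C a ⊓ C b ⊓ C c ≤ C b ⊓ C c) (f b)).inv ≫
        P.res₂ _ (θ b c) ≫ (P.resRes inf_le_right _ (f c)).hom) =
      (P.resRes inf_le_left (le_inf (inf_le_left.trans inf_le_left) inf_le_right :
          C a ⊓ C b ⊓ C c ≤ C a ⊓ C c) (f a)).inv ≫
        P.res₂ _ (θ a c) ≫ (P.resRes inf_le_right _ (f c)).hom) →
    ∃ (F : (P.res hV).obj x ⟶ (P.res hV).obj y) (ρ : ∀ a, P.res₁ (hC a) F ⟶ f a), ∀ a b,
      ((P.resRes (hC a) (inf_le_left : C a ⊓ C b ≤ C a) F).inv ≫ P.res₂ inf_le_left (ρ a)) ≫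
        θ a b =
      (P.resRes (hC b) (inf_le_right : C a ⊓ C b ≤ C b) F).inv ≫ P.res₂ inf_le_right (ρ b)

/-- The data `(x_a, φ_{ab}, ψ_{abc})` of a 2-descent datum for a family `(C_a)` of open sets:
objects `x_a` above `C_a`, 1-arrows `φ_{ab} : x_b ⟶ x_a` above `C_{ab}`, and 2-arrows
`ψ_{abc} : φ_{ab} φ_{bc} ⇒ φ_{ac}` above `C_{abc}`. -/
structure DescentDatum {κ : Type t} (C : κ → Opens X) where
  x : ∀ a, P.Fib (C a)
  φ : ∀ a b, (P.res (inf_le_right : C a ⊓ C b ≤ C b)).obj (x b) ⟶ (P.res inf_le_left).obj (x a)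
  ψ : ∀ a b c,
    P.res₁ (le_inf (inf_le_left.trans inf_le_right) inf_le_right :
        C a ⊓ C b ⊓ C c ≤ C b ⊓ C c) (φ b c) ≫ P.res₁ inf_le_left (φ a b) ⟶
      P.res₁ (le_inf (inf_le_left.trans inf_le_left) inf_le_right :
        C a ⊓ C b ⊓ C c ≤ C a ⊓ C c) (φ a c)

namespace DescentDatum

variable {P} {κ : Type t} {C : κ → Opens X} (D : P.DescentDatum C)

/-- The restriction of `φ_{ab}` to an open set `V ⊆ C_{ab}`. -/
noncomputable abbrev φr (a b : κ) (ha : V ≤ C a) (hb : V ≤ C b) :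
    (P.res hb).obj (D.x b) ⟶ (P.res ha).obj (D.x a) :=
  P.res₁ (hU := inf_le_right) (hU' := inf_le_left) (le_inf ha hb) (D.φ a b)

/-- The restriction of `ψ_{abc}` to an open set `V ⊆ C_{abc}`. -/
noncomputable def ψr (a b c : κ) (ha : V ≤ C a) (hb : V ≤ C b) (hc : V ≤ C c) :
    D.φr b c hb hc ≫ D.φr a b ha hb ⟶ D.φr a c ha hc :=
  (P.resRes _ (le_inf (le_inf ha hb) hc) (D.φ b c)).inv ▷ D.φr a b ha hb ≫
    P.res₁ (le_inf (le_inf ha hb) hc) (P.res₁ _ (D.φ b c)) ◁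
      (P.resRes _ (le_inf (le_inf ha hb) hc) (D.φ a b)).inv ≫
    (P.resComp (le_inf (le_inf ha hb) hc) _ _).inv ≫
    P.res₂ (le_inf (le_inf ha hb) hc) (D.ψ a b c) ≫
    (P.resRes _ (le_inf (le_inf ha hb) hc) (D.φ a c)).hom

/-- The tetrahedron of 2-arrows above `V ⊆ C_{abcd}` whose faces are the restrictions of the
2-arrows `ψ` commutes. -/
def Tetrahedron (V : Opens X) (a b c d : κ) (ha : V ≤ C a) (hb : V ≤ C b) (hc : V ≤ C c)
    (hd : V ≤ C d) : Prop :=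
  D.ψr b c d hb hc hd ▷ D.φr a b ha hb ≫ D.ψr a b d ha hb hd =
    (α_ _ _ _).hom ≫ D.φr c d hc hd ◁ D.ψr a b c ha hb hc ≫ D.ψr a c d ha hc hd

section

variable {x : P.Fib U} {hC : ∀ a, C a ≤ U}
  (χ : ∀ a, (P.res (hC a)).obj x ⟶ (P.res (le_refl (C a))).obj (D.x a))

/-- The restriction of a 1-arrow `χ_a : x ⟶ x_a`, given above `C_a`, to an open set
`V ⊆ C_a`. -/
noncomputable abbrev χr (a : κ) (ha : V ≤ C a) :
    (P.res (ha.trans (hC a))).obj x ⟶ (P.res ha).obj (D.x a) :=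
  P.res₁ ha (χ a)

/-- The restriction to an open set `V ⊆ C_{ab}` of a 2-arrow `ζ_{ab} : φ_{ab} χ_b ⇒ χ_a` above
`C_{ab}`. -/
noncomputable def ζr
    (ζ : ∀ a b, D.χr χ b inf_le_right ≫ D.φ a b ⟶ D.χr χ a (inf_le_left : C a ⊓ C b ≤ C a))
    (a b : κ) (ha : V ≤ C a) (hb : V ≤ C b) :
    D.χr χ b hb ≫ D.φr a b ha hb ⟶ D.χr χ a ha :=
  (P.resRes _ (le_inf ha hb) (χ b)).inv ▷ D.φr a b ha hb ≫
    (P.resComp (le_inf ha hb) _ _).inv ≫ P.res₂ (le_inf ha hb) (ζ a b) ≫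
    (P.resRes _ (le_inf ha hb) (χ a)).hom

end

/-- A 2-descent datum on a covering `(C_a)` of `U` is effective: there are an object `x` above
`U`, 1-arrows `χ_a : x|_{C_a} ⟶ x_a`, and 2-arrows `ζ_{ab} : φ_{ab} χ_b ⇒ χ_a` above `C_{ab}`
which are compatible with the 2-arrows `ψ_{abc}`. -/
def Effective (U : Opens X) (hC : ∀ a, C a ≤ U) : Prop :=
  ∃ (x : P.Fib U) (χ : ∀ a, (P.res (hC a)).obj x ⟶ (P.res (le_refl (C a))).obj (D.x a))
    (ζ : ∀ a b, D.χr χ b inf_le_right ≫ D.φ a b ⟶ D.χr χ a (inf_le_left : C a ⊓ C b ≤ C a)),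
    ∀ (a b c : κ) (V : Opens X) (ha : V ≤ C a) (hb : V ≤ C b) (hc : V ≤ C c),
      D.ζr χ ζ b c hb hc ▷ D.φr a b ha hb ≫ D.ζr χ ζ a b ha hb =
        (α_ _ _ _).hom ≫ D.χr χ c hc ◁ D.ψr a b c ha hb hc ≫ D.ζr χ ζ a c ha hc

end DescentDatum

/-- A 2-stack in 2-groupoids above `X`: the fibered categories of 1-arrows are stacks, and
2-descent is effective for objects. -/
structure IsTwoStack : Prop where
  arIsStack : ∀ (U : Opens X) (x y : P.Fib U), P.ArIsStack U x y
  effective : ∀ {κ : Type t} (U : Opens X) (C : κ → Opens X) (hC : ∀ a, C a ≤ U)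
    (_ : ⨆ a, C a = U) (D : P.DescentDatum C),
    (∀ a b c d, D.Tetrahedron (C a ⊓ C b ⊓ C c ⊓ C d) a b c d
      (inf_le_left.trans (inf_le_left.trans inf_le_left))
      (inf_le_left.trans (inf_le_left.trans inf_le_right))
      (inf_le_left.trans inf_le_right) inf_le_right) →
    D.Effective U hC

/-- A 2-gerbe on `X`: a 2-stack in 2-groupoids which is locally non-empty and locally
connected. -/
structure IsTwoGerbe : Prop extends P.IsTwoStack where
  locally_nonempty : ∀ p : X, ∃ U : Opens X, p ∈ U ∧ Nonempty (P.Fib U)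
  locally_connected : ∀ (U : Opens X) (x y : P.Fib U), ∀ p ∈ U, ∃ (V : Opens X) (hV : V ≤ U),
    p ∈ V ∧ Nonempty ((P.res hV).obj x ⟶ (P.res hV).obj y)

/-! ### The cocycle data of a 2-gerbe -/

variable {ι : Type s}

/-- Local objects `x_i` above `U_i`, and paths `φ_{ij} : x_j ⟶ x_i` above `U_{ij}`, together with
quasi-inverses and coherently chosen 2-arrows `φ_{ij} φ_{ij}⁻¹ ⇒ 1`, `φ_{ij}⁻¹ φ_{ij} ⇒ 1`. -/
structure Paths (U : ι → Opens X) where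
  x : ∀ i, P.Fib (U i)
  φ : ∀ i j, (P.res (inf_le_right : U i ⊓ U j ≤ U j)).obj (x j) ≌ (P.res inf_le_left).obj (x i)

namespace Paths

variable {P} {U : ι → Opens X} (D : P.Paths U)

/-- The restriction of `x_i` to an open set `V ⊆ U_i`. -/
abbrev ob (i : ι) (hi : V ≤ U i) : P.Fib V := (P.res hi).obj (D.x i)

/-- The restriction of `φ_{ij}` to an open set `V ⊆ U_{ij}`. -/
noncomputable abbrev phi (i j : ι) (hi : V ≤ U i) (hj : V ≤ U j) : D.ob j hj ⟶ D.ob i hi :=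
  P.res₁ (hU := inf_le_right) (hU' := inf_le_left) (le_inf hi hj) (D.φ i j).hom

/-- The restriction of `φ_{ij}⁻¹`, with its structural 2-arrows, to an open set `V ⊆ U_{ij}`. -/
noncomputable abbrev phiInv (i j : ι) (hi : V ≤ U i) (hj : V ≤ U j) :
    QuasiInverse (D.phi i j hi hj) :=
  P.resQuasiInverse (hU := inf_le_right) (hU' := inf_le_left) (le_inf hi hj)
    (QuasiInverse.ofEquivalence (D.φ i j))

/-- The functor `λ_{ij}` on objects: above `V ⊆ U_{ij}` it is conjugation by `φ_{ij}`, from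
`Ar_V(x_j, x_j)` to `Ar_V(x_i, x_i)`. -/
noncomputable abbrev lam (i j : ι) (hi : V ≤ U i) (hj : V ≤ U j) (γ : D.ob j hj ⟶ D.ob j hj) :
    D.ob i hi ⟶ D.ob i hi :=
  (D.phiInv i j hi hj).conj γ

/-- The compatibility of `λ_{ij}` with restriction from `V` to `W`. -/
noncomputable def lamRes (i j : ι) (hi : V ≤ U i) (hj : V ≤ U j) (h : W ≤ V)
    (γ : D.ob j hj ⟶ D.ob j hj) :
    P.res₁ h (D.lam i j hi hj γ) ≅ D.lam i j (h.trans hi) (h.trans hj) (P.res₁ h γ) :=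
  P.resComp h _ _ ≪≫
    whiskerRightIso (P.resRes (le_inf hi hj) h (D.φ i j).inv) _ ≪≫
    whiskerLeftIso (P.res₁ (h.trans (le_inf hi hj)) (D.φ i j).inv)
      (P.resComp h _ _ ≪≫ whiskerLeftIso (P.res₁ h γ) (P.resRes (le_inf hi hj) h (D.φ i j).hom))

end Paths

/-- In addition to local objects and paths, objects `g_{ijk}` of `Ar(x_i, x_i)` above `U_{ijk}`
(each with a choice of inverse) and 2-arrows `m_{ijk} : g_{ijk} φ_{ik} ⇒ φ_{ij} φ_{jk}`. -/
structure LocalData (U : ι → Opens X) extends P.Paths U where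
  g : ∀ i j k,
    toPaths.ob i ((inf_le_left.trans inf_le_left : U i ⊓ U j ⊓ U k ≤ U i)) ≌
      toPaths.ob i ((inf_le_left.trans inf_le_left : U i ⊓ U j ⊓ U k ≤ U i))
  m : ∀ i j k,
    toPaths.phi i k (inf_le_left.trans inf_le_left) inf_le_right ≫ (g i j k).hom ≅
      toPaths.phi j k (inf_le_left.trans inf_le_right) inf_le_right ≫
        toPaths.phi i j (inf_le_left.trans inf_le_left) (inf_le_left.trans inf_le_right)

namespace LocalData

variable {P} {U : ι → Opens X} (D : P.LocalData U)

section

variable (i j k l : ι) (hi : V ≤ U i) (hj : V ≤ U j) (hk : V ≤ U k) (hl : V ≤ U l)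

/-- The restriction of `g_{ijk}` to an open set `V ⊆ U_{ijk}`. -/
noncomputable abbrev gr : D.ob i hi ⟶ D.ob i hi :=
  P.res₁ (hU := inf_le_left.trans inf_le_left) (hU' := inf_le_left.trans inf_le_left)
    (le_inf (le_inf hi hj) hk) (D.g i j k).hom

/-- The restriction of the inverse of `g_{ijk}` to an open set `V ⊆ U_{ijk}`. -/
noncomputable abbrev gInv : QuasiInverse (D.gr i j k hi hj hk) :=
  P.resQuasiInverse (hU := inf_le_left.trans inf_le_left) (hU' := inf_le_left.trans inf_le_left)
    (le_inf (le_inf hi hj) hk) (QuasiInverse.ofEquivalence (D.g i j k))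

/-- The restriction of `m_{ijk}` to an open set `V ⊆ U_{ijk}`. -/
noncomputable def mr :
    D.phi i k hi hk ≫ D.gr i j k hi hj hk ≅ D.phi j k hj hk ≫ D.phi i j hi hj :=
  whiskerRightIso (P.resRes _ (le_inf (le_inf hi hj) hk) (D.φ i k).hom).symm _ ≪≫
    (P.resComp (le_inf (le_inf hi hj) hk) _ _).symm ≪≫
    P.res₂Iso (le_inf (le_inf hi hj) hk) (D.m i j k) ≪≫
    P.resComp (le_inf (le_inf hi hj) hk) _ _ ≪≫
    whiskerRightIso (P.resRes _ (le_inf (le_inf hi hj) hk) (D.φ j k).hom) _ ≪≫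
    whiskerLeftIso _ (P.resRes _ (le_inf (le_inf hi hj) hk) (D.φ i j).hom)

/-- The type of 2-arrows `λ_{ij}(g_{jkl}) g_{ijl} ⇒ g_{ijk} g_{ikl}` above `V ⊆ U_{ijkl}`. -/
abbrev NuArrow :=
  D.gr i j l hi hj hl ≫ D.lam i j hi hj (D.gr j k l hj hk hl) ⟶
    D.gr i k l hi hk hl ≫ D.gr i j k hi hj hk

/-- The cube `C_{ijkl}` above `V ⊆ U_{ijkl}`, with front face `ν`, commutes. -/
def CubeC (ν : D.NuArrow i j k l hi hj hk hl) : Prop :=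
  CubeCommutes
    (F₁₂ := (D.mr i j l hi hj hl).hom) (G₁₂ := (D.mr i j k hi hj hk).hom)
    (F₁₃ := (D.mr i k l hi hk hl).hom)
    (G₁₃ := ((D.phiInv i j hi hj).conjSquare (D.gr j k l hj hk hl)).hom)
    (F₂₃ := (D.mr j k l hj hk hl).hom) (G₂₃ := ν)

/-- The restriction of a 2-arrow `λ_{ij}(g_{jkl}) g_{ijl} ⇒ g_{ijk} g_{ikl}` from `V` to `W`. -/
noncomputable def nuRes (h : W ≤ V) (ν : D.NuArrow i j k l hi hj hk hl) :
    D.NuArrow i j k l (h.trans hi) (h.trans hj) (h.trans hk) (h.trans hl) :=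
  (whiskerRightIso (P.resRes _ h (D.g i j l).hom).symm _ ≪≫
    whiskerLeftIso _ (whiskerLeftIso _ (whiskerRightIso (P.resRes _ h (D.g j k l).hom).symm _) ≪≫
      (D.lamRes i j hi hj h (D.gr j k l hj hk hl)).symm) ≪≫
    (P.resComp h _ _).symm).hom ≫
  P.res₂ h ν ≫
  (P.resComp h _ _ ≪≫
    whiskerRightIso (P.resRes _ h (D.g i k l).hom) _ ≪≫
    whiskerLeftIso _ (P.resRes _ h (D.g i j k).hom)).hom

/-- The natural transformation `m̃_{ijk} : i_{g_{ijk}} λ_{ik} ⇒ λ_{ij} λ_{jk}` induced by `m_{ijk}`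
by conjugation, evaluated at an object `u` of `Ar(x_k, x_k)` above `V ⊆ U_{ijk}`. Here
`i_{g_{ijk}}` is conjugation by `g_{ijk}`. -/
noncomputable def mTilde (u : D.ob k hk ⟶ D.ob k hk) :
    (D.gInv i j k hi hj hk).conj (D.lam i k hi hk u) ≅
      D.lam i j hi hj (D.lam j k hj hk u) :=
  ((D.phiInv i k hi hk).conjConj (D.gInv i j k hi hj hk) u).symm ≪≫
    ((D.phiInv i k hi hk).comp (D.gInv i j k hi hj hk)).tilde
      ((D.phiInv j k hj hk).comp (D.phiInv i j hi hj)) (D.mr i j k hi hj hk) u ≪≫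
    (D.phiInv j k hj hk).conjConj (D.phiInv i j hi hj) u

/-- The 2-arrow `{m̃_{ijk}, u} : g_{ijk} λ_{ik}(u) ⇒ λ_{ij} λ_{jk}(u) g_{ijk}`, the composite of
`g_{ijk} λ_{ik}(u) ⇒ i_{g_{ijk}}(λ_{ik}(u)) g_{ijk}` and of `m̃_{ijk}(u)`. -/
noncomputable def bracket (u : D.ob k hk ⟶ D.ob k hk) :
    D.lam i k hi hk u ≫ D.gr i j k hi hj hk ≅
      D.gr i j k hi hj hk ≫ D.lam i j hi hj (D.lam j k hj hk u) :=
  ((D.gInv i j k hi hj hk).conjSquare (D.lam i k hi hk u)).symm ≪≫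
    whiskerLeftIso (D.gr i j k hi hj hk) (D.mTilde i j k hi hj hk u)

end

/-- The 2-arrow `λ_{ij}(ν) : λ_{ij}λ_{jk}(g_{klm}) λ_{ij}(g_{jkm}) ⇒
λ_{ij}(g_{jkl}) λ_{ij}(g_{jlm})` deduced, by conjugation by `φ_{ij}`, from a 2-arrow
`ν : λ_{jk}(g_{klm}) g_{jkm} ⇒ g_{jkl} g_{jlm}`. -/
noncomputable def lamNu (i j k l m : ι) (hi : V ≤ U i) (hj : V ≤ U j) (hk : V ≤ U k)
    (hl : V ≤ U l) (hm : V ≤ U m) (ν : D.NuArrow j k l m hj hk hl hm) :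
    D.lam i j hi hj (D.gr j k m hj hk hm) ≫
        D.lam i j hi hj (D.lam j k hj hk (D.gr k l m hk hl hm)) ⟶
      D.lam i j hi hj (D.gr j l m hj hl hm) ≫ D.lam i j hi hj (D.gr j k l hj hk hl) :=
  ((D.phiInv i j hi hj).conjComp _ _).inv ≫ (D.phiInv i j hi hj).conj₂ ν ≫
    ((D.phiInv i j hi hj).conjComp _ _).hom

/-- The type of 2-arrows `λ_{ij}(g_{jkl}) g_{ijl} ⇒ g_{ijk} g_{ikl}` above `U_{ijkl}`. -/
abbrev NuAt (i j k l : ι) :=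
  D.NuArrow (V := U i ⊓ U j ⊓ U k ⊓ U l) i j k l
    (inf_le_left.trans (inf_le_left.trans inf_le_left))
    (inf_le_left.trans (inf_le_left.trans inf_le_right))
    (inf_le_left.trans inf_le_right) inf_le_right

/-- The cube `C_{ijkl}` above `U_{ijkl}`, with front face `ν`, commutes. -/
def CubeCAt (i j k l : ι) (ν : D.NuAt i j k l) : Prop :=
  D.CubeC i j k l (inf_le_left.trans (inf_le_left.trans inf_le_left))
    (inf_le_left.trans (inf_le_left.trans inf_le_right))
    (inf_le_left.trans inf_le_right) inf_le_right ν

section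

variable (ν : ∀ i j k l, D.NuAt i j k l)

/-- The restriction of `ν_{ijkl}` to an open set `V ⊆ U_{ijkl}`. -/
noncomputable def nur (i j k l : ι) (hi : V ≤ U i) (hj : V ≤ U j) (hk : V ≤ U k)
    (hl : V ≤ U l) : D.NuArrow i j k l hi hj hk hl :=
  D.nuRes i j k l _ _ _ _ (le_inf (le_inf (le_inf hi hj) hk) hl) (ν i j k l)

variable (i j k l m : ι) (hi : V ≤ U i) (hj : V ≤ U j) (hk : V ≤ U k) (hl : V ≤ U l)
  (hm : V ≤ U m)

/-- The cube of 2-arrows above `V ⊆ U_{ijklm}` with left face `ν_{iklm}`, right face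
`λ_{ij}(ν_{jklm})`, top face `ν_{ijlm}`, bottom face `{m̃_{ijk}, g_{klm}}⁻¹`, front face
`ν_{ijkm}` and back face `ν_{ijkl}` commutes. -/
def CocycleCube : Prop :=
  CubeCommutes
    (F₁₂ := D.nur ν i j k m hi hj hk hm)
    (G₁₂ := D.nur ν i j k l hi hj hk hl)
    (F₁₃ := D.nur ν i j l m hi hj hl hm)
    (G₁₃ := (D.bracket i j k hi hj hk (D.gr k l m hk hl hm)).inv)
    (F₂₃ := D.nur ν i k l m hi hk hl hm)
    (G₂₃ := D.lamNu i j k l m hi hj hk hl hm (D.nur ν j k l m hj hk hl hm))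

/-- The cocycle equation
`ν_{ijkl} (^{λ_{ij}(g_{jkl})} ν_{ijlm}) λ_{ij}(ν_{jklm}) =
  (^{g_{ijk}} ν_{iklm}) {m̃_{ijk}, g_{klm}}⁻¹ (^{λ_{ij} λ_{jk}(g_{klm})} ν_{ijkm})`
between arrows of the monoidal category `Ar_V(x_i, x_i)`, whose product `b a` is `a ≫ b`. An
object `b` in exponent position denotes the product with `b` on the left, which is `_ ▷ b` here.
The products on the right, usually suppressed from the notation, and the associativity
constraints are written out. -/
def CocycleEquation : Prop :=
  (D.gr i j m hi hj hm ◁ D.lamNu i j k l m hi hj hk hl hm (D.nur ν j k l m hj hk hl hm) ≫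
      (α_ _ _ _).inv) ≫
    (D.nur ν i j l m hi hj hl hm ▷ D.lam i j hi hj (D.gr j k l hj hk hl) ≫ (α_ _ _ _).hom) ≫
    D.gr i l m hi hl hm ◁ D.nur ν i j k l hi hj hk hl =
  ((α_ _ _ _).inv ≫
      D.nur ν i j k m hi hj hk hm ▷ D.lam i j hi hj (D.lam j k hj hk (D.gr k l m hk hl hm)) ≫
      (α_ _ _ _).hom) ≫
    (D.gr i k m hi hk hm ◁ (D.bracket i j k hi hj hk (D.gr k l m hk hl hm)).inv ≫
      (α_ _ _ _).inv) ≫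
    (D.nur ν i k l m hi hk hl hm ▷ D.gr i j k hi hj hk ≫ (α_ _ _ _).hom)

end

end LocalData

end FiberedTwoGroupoid

-- The first claim amounts to solving an equation. In the cube C_ijkl the unknown face occurs
-- whiskered with φ_il. The other faces are invertible, so commutativity prescribes this whiskering,
-- and whiskering with an equivalence is bijective on 2-arrows (`CubeCommutes.existsUnique`).
--
-- For the second claim, the cocycle cube is one of the eight cubes of a hypercube starting at x_m.
-- Five of the others are C_ijkl, C_ijkm, C_ijlm, C_iklm and C_jklm. The sixth, which relates ν_jklm
-- to λ_ij(ν_jklm) through faces M_ij, commutes because conjugation is functorial and monoidal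
-- (`QuasiInverse.conjSquare_cube`). The seventh contains {m̃_ijk, g_klm}⁻¹ and commutes by the
-- construction of m̃ (`QuasiInverse.bracket_cube`). Pasting these seven, and cancelling φ_im and
-- invertible faces m, gives the eighth (`CubeCommutes.hypercube`).
--
-- It remains to bring all cubes above the same open set: ν_ijkl is characterized above U_ijkl, but
-- is used above V. So the restricted ν must fill the cube of restricted faces
-- (`LocalData.CubeC.nuRes`). Restriction of arrows is a pseudofunctor conjugated by the
-- equivalences x|_W ≃ (x|_V)|_W (`restrict`), hence preserves commuting cubes; its source is a
-- `PulledBack`, because these equivalences depend on x and not only on x|_V. The data φ, g, m start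
-- from different open sets, so restricting in one step must be compared with restricting in
-- several. The comparison `resRes` is natural, respects composition, and is coherent for three
-- successive restrictions (`resRes_resRes`); this last fact is where the coherence of the
-- modifications α enters.

universe w₄ v₄ u₄ w₃ v₃ u₃ w₂ v₂ u₂

/-! ### Whiskering with equivalences, and the hypercube -/

section Bicategories
variable {B : Type u} [Bicategory.{w, v} B]

/-- Up to the counit, `e.inv ◁ (e.hom ◁ ζ)` is `ζ` again, so `ζ` can be recovered from its
whiskering. No triangle identity is involved. -/
theorem whiskerLeft_injective_of_equivalence {a b c : B} (e : a ≌ b) {p q : b ⟶ c}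
    {η θ : p ⟶ q} (h : e.hom ◁ η = e.hom ◁ θ) : η = θ := by
  have key : ∀ ζ : p ⟶ q, ζ = 𝟙 _ ⊗≫ e.counit.inv ▷ p ⊗≫ e.inv ◁ (e.hom ◁ ζ) ⊗≫
      e.counit.hom ▷ q ⊗≫ 𝟙 _ := by
    intro ζ
    calc ζ = 𝟙 _ ⊗≫ (e.counit.inv ≫ e.counit.hom) ▷ p ⊗≫ ζ := by
          rw [Iso.inv_hom_id]; bicategory
      _ = 𝟙 _ ⊗≫ e.counit.inv ▷ p ⊗≫ (e.counit.hom ▷ p ≫ 𝟙 b ◁ ζ) ⊗≫ 𝟙 _ := by bicategory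
      _ = _ := by rw [← whisker_exchange]; bicategory
  rw [key η, h, ← key θ]

theorem whiskerRight_injective_of_equivalence {a b c : B} (e : b ≌ c) {p q : a ⟶ b}
    {η θ : p ⟶ q} (h : η ▷ e.hom = θ ▷ e.hom) : η = θ := by
  have key : ∀ ζ : p ⟶ q, ζ = 𝟙 _ ⊗≫ p ◁ e.unit.hom ⊗≫ (ζ ▷ e.hom) ▷ e.inv ⊗≫
      q ◁ e.unit.inv ⊗≫ 𝟙 _ := by
    intro ζ
    calc ζ = 𝟙 _ ⊗≫ p ◁ (e.unit.hom ≫ e.unit.inv) ⊗≫ ζ := by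
          rw [Iso.hom_inv_id]; bicategory
      _ = 𝟙 _ ⊗≫ p ◁ e.unit.hom ⊗≫ (p ◁ e.unit.inv ≫ ζ ▷ 𝟙 b) ⊗≫ 𝟙 _ := by bicategory
      _ = _ := by rw [whisker_exchange]; bicategory
  rw [key η, h, ← key θ]

section Hypercube

variable {xi xj xk xl xm : B}
  {pij : xj ⟶ xi} {pik : xk ⟶ xi} {pil : xl ⟶ xi} {pim : xm ⟶ xi} {pjk : xk ⟶ xj}
  {pjl : xl ⟶ xj} {pjm : xm ⟶ xj} {pkl : xl ⟶ xk} {pkm : xm ⟶ xk} {plm : xm ⟶ xl}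
  {gijk gijl gijm gikl gikm gilm : xi ⟶ xi} {gjkl gjkm gjlm : xj ⟶ xj} {gklm : xk ⟶ xk}
  {aijkl aijkm aijlm bijklm aiklm : xi ⟶ xi} {ajklm : xj ⟶ xj}

/-- Seven of the cubes of a hypercube commute, the seventh one by naturality; hence so does the
eighth one. -/
theorem CubeCommutes.hypercube (hpim : ∃ e : xm ≌ xi, e.hom = pim)
    {mijk : pik ≫ gijk ≅ pjk ≫ pij} {mijl : pil ≫ gijl ≅ pjl ≫ pij}
    {mijm : pim ≫ gijm ≅ pjm ≫ pij} {mikl : pil ≫ gikl ≅ pkl ≫ pik}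
    {mikm : pim ≫ gikm ≅ pkm ≫ pik} {milm : pim ≫ gilm ≅ plm ≫ pil}
    {mjkl : pjl ≫ gjkl ⟶ pkl ≫ pjk} {mjkm : pjm ≫ gjkm ⟶ pkm ≫ pjk}
    {mjlm : pjm ≫ gjlm ⟶ plm ≫ pjl} {mklm : pkm ≫ gklm ⟶ plm ≫ pkl}
    {Mijkl : pij ≫ aijkl ⟶ gjkl ≫ pij} {Mijkm : pij ≫ aijkm ⟶ gjkm ≫ pij}
    {Mijlm : pij ≫ aijlm ⟶ gjlm ≫ pij} {Mjklm : pjk ≫ ajklm ⟶ gklm ≫ pjk}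
    {Miklm : pik ≫ aiklm ⟶ gklm ≫ pik} {Mijklm : pij ≫ bijklm ⟶ ajklm ≫ pij}
    {νijkl : gijl ≫ aijkl ⟶ gikl ≫ gijk} {νijkm : gijm ≫ aijkm ⟶ gikm ≫ gijk}
    {νijlm : gijm ≫ aijlm ⟶ gilm ≫ gijl} {νiklm : gikm ≫ aiklm ⟶ gilm ≫ gikl}
    {νjklm : gjkm ≫ ajklm ⟶ gjlm ≫ gjkl} {lν : aijkm ≫ bijklm ⟶ aijlm ≫ aijkl}
    {br : gijk ≫ bijklm ⟶ aiklm ≫ gijk}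
    (hijkl : CubeCommutes mijl.hom mijk.hom mikl.hom Mijkl mjkl νijkl)
    (hijkm : CubeCommutes mijm.hom mijk.hom mikm.hom Mijkm mjkm νijkm)
    (hijlm : CubeCommutes mijm.hom mijl.hom milm.hom Mijlm mjlm νijlm)
    (hiklm : CubeCommutes mikm.hom mikl.hom milm.hom Miklm mklm νiklm)
    (hjklm : CubeCommutes mjkm mjkl mjlm Mjklm mklm νjklm)
    (hl : CubeCommutes Mijkm Mijkl Mijlm Mijklm νjklm lν)
    (hb : CubeCommutes mijk.hom mijk.hom Miklm Mijklm Mjklm br) :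
    CubeCommutes νijkm νijkl νijlm br νiklm lν := by
  obtain ⟨e, rfl⟩ := hpim
  unfold CubeCommutes at *
  -- After whiskering with φ_im and composing with the invertible pasting `E`, both sides end at the
  -- path φ_lm, φ_kl, φ_jk, φ_ij, and the faces of the seven known cubes can be brought in.
  apply whiskerLeft_injective_of_equivalence e
  let E : e.hom ≫ gilm ≫ gikl ≫ gijk ⟶ plm ≫ pkl ≫ pjk ≫ pij :=
    𝟙 _ ⊗≫ milm.hom ▷ (gikl ≫ gijk) ⊗≫ plm ◁ mikl.hom ▷ gijk ⊗≫
      plm ◁ pkl ◁ mijk.hom ⊗≫ 𝟙 _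
  have hE : IsIso E := by
    simp only [E, bicategoricalComp]; infer_instance
  rw [← cancel_mono E]
  -- Each `cₙ` or `dₙ` is a pasting diagram with a hole `t`. When the hole is one side of a known
  -- cube, `congrArg` exchanges it for the other side.
  let c₁ := fun (t : pil ≫ gijl ≫ aijkl ⟶ pkl ≫ pjk ≫ pij) =>
      (𝟙 _ ⊗≫ e.hom ◁ gijm ◁ lν ⊗≫ e.hom ◁ νijlm ▷ aijkl ⊗≫
    milm.hom ▷ gijl ▷ aijkl ⊗≫ plm ◁ t :
      e.hom ≫ gijm ≫ aijkm ≫ bijklm ⟶ plm ≫ pkl ≫ pjk ≫ pij)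
  let c₂ := fun (t : e.hom ≫ gijm ≫ aijlm ⟶ plm ≫ pjl ≫ pij) =>
      (𝟙 _ ⊗≫ e.hom ◁ gijm ◁ lν ⊗≫ t ▷ aijkl ⊗≫
    plm ◁ pjl ◁ Mijkl ⊗≫ plm ◁ mjkl ▷ pij ⊗≫ 𝟙 _ :
      e.hom ≫ gijm ≫ aijkm ≫ bijklm ⟶ plm ≫ pkl ≫ pjk ≫ pij)
  let c₃ := fun (t : pij ≫ aijkm ≫ bijklm ⟶ gjlm ≫ gjkl ≫ pij) =>
      (𝟙 _ ⊗≫ mijm.hom ▷ (aijkm ≫ bijklm) ⊗≫ pjm ◁ t ⊗≫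
    mjlm ▷ gjkl ▷ pij ⊗≫ plm ◁ mjkl ▷ pij ⊗≫ 𝟙 _ :
      e.hom ≫ gijm ≫ aijkm ≫ bijklm ⟶ plm ≫ pkl ≫ pjk ≫ pij)
  let c₄ := fun (t : pjm ≫ gjkm ≫ ajklm ⟶ plm ≫ pkl ≫ pjk) =>
      (𝟙 _ ⊗≫ mijm.hom ▷ (aijkm ≫ bijklm) ⊗≫ pjm ◁ Mijkm ▷ bijklm ⊗≫
      pjm ◁ gjkm ◁ Mijklm ⊗≫ t ▷ pij ⊗≫ 𝟙 _ :
      e.hom ≫ gijm ≫ aijkm ≫ bijklm ⟶ plm ≫ pkl ≫ pjk ≫ pij)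
  let c₅ := fun (t : pjm ≫ gjkm ≫ pij ≫ bijklm ⟶ pkm ≫ pjk ≫ ajklm ≫ pij) =>
      (𝟙 _ ⊗≫ mijm.hom ▷ (aijkm ≫ bijklm) ⊗≫ pjm ◁ Mijkm ▷ bijklm ⊗≫
      t ⊗≫ pkm ◁ Mjklm ▷ pij ⊗≫ mklm ▷ pjk ▷ pij ⊗≫ 𝟙 _ :
      e.hom ≫ gijm ≫ aijkm ≫ bijklm ⟶ plm ≫ pkl ≫ pjk ≫ pij)
  let d₁ := fun (t : e.hom ≫ gijm ≫ aijkm ⟶ pkm ≫ pjk ≫ pij) => (𝟙 _ ⊗≫ t ▷ bijklm ⊗≫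
      pkm ◁ pjk ◁ Mijklm ⊗≫ pkm ◁ Mjklm ▷ pij ⊗≫ mklm ▷ pjk ▷ pij ⊗≫ 𝟙 _ :
      e.hom ≫ gijm ≫ aijkm ≫ bijklm ⟶ plm ≫ pkl ≫ pjk ≫ pij)
  let d₂ := fun (t : pik ≫ gijk ≫ bijklm ⟶ gklm ≫ pjk ≫ pij) =>
      (𝟙 _ ⊗≫ e.hom ◁ νijkm ▷ bijklm ⊗≫ mikm.hom ▷ gijk ▷ bijklm ⊗≫
      pkm ◁ t ⊗≫ mklm ▷ pjk ▷ pij ⊗≫ 𝟙 _ :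
      e.hom ≫ gijm ≫ aijkm ≫ bijklm ⟶ plm ≫ pkl ≫ pjk ≫ pij)
  let d₃ := fun (t : e.hom ≫ gikm ≫ gijk ≫ bijklm ⟶ pkm ≫ pik ≫ aiklm ≫ gijk) =>
      (𝟙 _ ⊗≫ e.hom ◁ νijkm ▷ bijklm ⊗≫ t ⊗≫ pkm ◁ Miklm ▷ gijk ⊗≫
      pkm ◁ gklm ◁ mijk.hom ⊗≫ mklm ▷ pjk ▷ pij ⊗≫ 𝟙 _ :
      e.hom ≫ gijm ≫ aijkm ≫ bijklm ⟶ plm ≫ pkl ≫ pjk ≫ pij)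
  let d₄ := fun (t : pkm ≫ gklm ≫ pik ≫ gijk ⟶ plm ≫ pkl ≫ pjk ≫ pij) =>
      (𝟙 _ ⊗≫ e.hom ◁ νijkm ▷ bijklm ⊗≫ e.hom ◁ gikm ◁ br ⊗≫
      mikm.hom ▷ aiklm ▷ gijk ⊗≫ pkm ◁ Miklm ▷ gijk ⊗≫
      t ⊗≫ 𝟙 _ :
      e.hom ≫ gijm ≫ aijkm ≫ bijklm ⟶ plm ≫ pkl ≫ pjk ≫ pij)
  let d₅ := fun (t : e.hom ≫ gikm ≫ aiklm ⟶ plm ≫ pkl ≫ pik) =>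
      (𝟙 _ ⊗≫ e.hom ◁ νijkm ▷ bijklm ⊗≫ e.hom ◁ gikm ◁ br ⊗≫ t ▷ gijk ⊗≫
      plm ◁ pkl ◁ mijk.hom ⊗≫ 𝟙 _ :
      e.hom ≫ gijm ≫ aijkm ≫ bijklm ⟶ plm ≫ pkl ≫ pjk ≫ pij)
  calc
    _ = 𝟙 _ ⊗≫ e.hom ◁ gijm ◁ lν ⊗≫ e.hom ◁ νijlm ▷ aijkl ⊗≫
          ((e.hom ≫ gilm) ◁ νijkl ≫ milm.hom ▷ (gikl ≫ gijk)) ⊗≫ plm ◁ mikl.hom ▷ gijk ⊗≫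
          plm ◁ pkl ◁ mijk.hom ⊗≫ 𝟙 _ := by simp only [E]; bicategory
    -- Between two uses of cubes, faces lying on disjoint portions of the path slide past each other
    -- by `whisker_exchange`.
    _ = c₁ _ := by rw [whisker_exchange]; simp only [c₁]; bicategory
    _ = _ := congrArg c₁ hijkl
    _ = c₂ _ := by
        simp only [c₁, c₂]
        bicategory
    _ = _ := congrArg c₂ hijlm
    _ = (𝟙 _ ⊗≫ (e.hom ≫ gijm) ◁ lν ≫ mijm.hom ▷ (aijlm ≫ aijkl)) ⊗≫
          pjm ◁ Mijlm ▷ aijkl ⊗≫ (mjlm ▷ (pij ≫ aijkl) ≫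
          (plm ≫ pjl) ◁ Mijkl) ⊗≫ plm ◁ mjkl ▷ pij ⊗≫ 𝟙 _ := by simp only [c₂]; bicategory
    _ = c₃ _ := by
        rw [whisker_exchange, ← whisker_exchange mjlm]; simp only [c₃]; bicategory
    _ = _ := congrArg c₃ hl
    _ = c₄ _ := by simp only [c₃, c₄]; bicategory
    _ = _ := congrArg c₄ hjklm
    -- Four cubes have now removed ν_ijkl, ν_ijlm, λ_ij(ν_jklm) and ν_jklm, leaving only faces m and
    -- M. The other three cubes are used backwards, to bring in ν_ijkm, the bracket and ν_iklm.
    _ = c₅ (𝟙 _ ⊗≫ ((pjm ≫ gjkm) ◁ Mijklm ≫ mjkm ▷ (ajklm ≫ pij)) ⊗≫ 𝟙 _) := by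
        simp only [c₄, c₅]; bicategory
    _ = c₅ (𝟙 _ ⊗≫ (mjkm ▷ (pij ≫ bijklm) ≫ (pkm ≫ pjk) ◁ Mijklm) ⊗≫ 𝟙 _) := by
        rw [whisker_exchange]
    _ = d₁ _ := by simp only [c₅, d₁]; bicategory
    _ = _ := (congrArg d₁ hijkm).symm
    _ = d₂ _ := by simp only [d₁, d₂]; bicategory
    _ = _ := (congrArg d₂ hb).symm
    _ = d₃ (𝟙 _ ⊗≫ (mikm.hom ▷ (gijk ≫ bijklm) ≫ (pkm ≫ pik) ◁ br) ⊗≫ 𝟙 _) := by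
        simp only [d₂, d₃]; bicategory
    _ = d₃ (𝟙 _ ⊗≫ ((e.hom ≫ gikm) ◁ br ≫ mikm.hom ▷ (aiklm ≫ gijk)) ⊗≫ 𝟙 _) := by
        rw [whisker_exchange]
    _ = d₄ (𝟙 _ ⊗≫ ((pkm ≫ gklm) ◁ mijk.hom ≫ mklm ▷ (pjk ≫ pij)) ⊗≫ 𝟙 _) := by
        simp only [d₃, d₄]; bicategory
    _ = d₄ (𝟙 _ ⊗≫ (mklm ▷ (pik ≫ gijk) ≫ (plm ≫ pkl) ◁ mijk.hom) ⊗≫ 𝟙 _) := by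
        rw [whisker_exchange]
    _ = d₅ _ := by simp only [d₄, d₅]; bicategory
    _ = _ := (congrArg d₅ hiklm).symm
    _ = _ := by simp only [d₅, E]; bicategory

end Hypercube
-- Conjugation by an invertible 1-arrow
namespace QuasiInverse

variable {x y z : B} {f : x ⟶ y}

/-- The first triangle identity for a quasi-inverse. -/
def Triangle (q : QuasiInverse f) : Prop :=
  𝟙 (f ≫ 𝟙 y) ≫ f ◁ q.r.inv ⊗≫ q.s.hom ▷ f ⊗≫ 𝟙 f = (ρ_ f).hom

theorem ofEquivalence_triangle (e : x ≌ y) : (ofEquivalence e).Triangle := by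
  have h := congrArg Iso.inv e.left_triangle
  rw [leftZigzagIso_inv, rightZigzag, Iso.trans_inv, Iso.symm_inv] at h
  change 𝟙 (e.hom ≫ 𝟙 y) ≫ e.hom ◁ e.counit.inv ⊗≫ e.unit.inv ▷ e.hom ⊗≫ 𝟙 e.hom = _
  calc _ = (e.hom ◁ e.counit.inv ⊗≫ e.unit.inv ▷ e.hom) ⊗≫ 𝟙 e.hom := by bicategory
    _ = _ := by rw [h]; bicategory

theorem conjComp_hom (q : QuasiInverse f) (γ γ' : x ⟶ x) :
    (q.conjComp γ γ').hom = 𝟙 (q.inv ≫ (γ ≫ γ') ≫ f) ⊗≫ (q.inv ≫ γ) ◁ q.s.inv ▷ (γ' ≫ f) ⊗≫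
      𝟙 ((q.inv ≫ γ ≫ f) ≫ q.inv ≫ γ' ≫ f) := by
  simp [conjComp, bicategoricalIsoComp, bicategoricalComp]

theorem conjComp_inv (q : QuasiInverse f) (γ γ' : x ⟶ x) :
    (q.conjComp γ γ').inv = 𝟙 ((q.inv ≫ γ ≫ f) ≫ q.inv ≫ γ' ≫ f) ⊗≫
      (q.inv ≫ γ) ◁ q.s.hom ▷ (γ' ≫ f) ⊗≫ 𝟙 (q.inv ≫ (γ ≫ γ') ≫ f) := by
  rw [← cancel_epi (q.conjComp γ γ').hom, Iso.hom_inv_id, conjComp_hom]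
  symm
  calc _ = 𝟙 _ ⊗≫ (q.inv ≫ γ) ◁ (q.s.inv ≫ q.s.hom) ▷ (γ' ≫ f) ⊗≫ 𝟙 _ := by bicategory
    _ = _ := by rw [Iso.inv_hom_id]; bicategory

theorem conjSquare_hom (q : QuasiInverse f) (γ : x ⟶ x) :
    (q.conjSquare γ).hom =
      𝟙 (f ≫ q.inv ≫ γ ≫ f) ⊗≫ q.s.hom ▷ (γ ≫ f) ⊗≫ 𝟙 (γ ≫ f) := by
  simp [conjSquare, bicategoricalIsoComp, bicategoricalComp]

/-- The monoidal constraint of conjugation inserts `s⁻¹` between the two factors, and the squares M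
cancel by means of `s`. Once these meet, only the interchange of `s` with `η` and with the other
copy of `s` is left. -/
theorem conjSquare_cube (q : QuasiInverse f) {γ₁ γ₂ γ₃ γ₄ : x ⟶ x}
    (η : γ₁ ≫ γ₂ ⟶ γ₃ ≫ γ₄) :
    CubeCommutes (q.conjSquare γ₁).hom (q.conjSquare γ₄).hom (q.conjSquare γ₃).hom
      (q.conjSquare γ₂).hom η
      ((q.conjComp γ₁ γ₂).inv ≫ q.conj₂ η ≫ (q.conjComp γ₃ γ₄).hom) := by
  unfold CubeCommutes
  simp only [conjComp_hom, conjComp_inv, conjSquare_hom, conj₂]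
  calc _ = 𝟙 _ ⊗≫ (f ≫ q.inv ≫ γ₁) ◁ q.s.hom ▷ (γ₂ ≫ f) ⊗≫ f ◁ q.inv ◁ η ▷ f ⊗≫
        (((f ≫ q.inv) ≫ γ₃) ◁ q.s.inv ≫ (q.s.hom ▷ γ₃) ▷ (f ≫ q.inv)) ▷ (γ₄ ≫ f) ⊗≫
        γ₃ ◁ q.s.hom ▷ (γ₄ ≫ f) ⊗≫ 𝟙 _ := by bicategory
    _ = 𝟙 _ ⊗≫ (f ≫ q.inv ≫ γ₁) ◁ q.s.hom ▷ (γ₂ ≫ f) ⊗≫ f ◁ q.inv ◁ η ▷ f ⊗≫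
        (q.s.hom ▷ (γ₃ ≫ 𝟙 _ ≫ γ₄ ≫ f)) ⊗≫ γ₃ ◁ (q.s.inv ≫ q.s.hom) ▷ (γ₄ ≫ f) ⊗≫ 𝟙 _ := by
        rw [whisker_exchange]; bicategory
    _ = 𝟙 _ ⊗≫ (f ≫ q.inv ≫ γ₁) ◁ q.s.hom ▷ (γ₂ ≫ f) ⊗≫
        ((f ≫ q.inv) ◁ η ≫ q.s.hom ▷ (γ₃ ≫ γ₄)) ▷ f ⊗≫ 𝟙 _ := by
        rw [Iso.inv_hom_id]; bicategory
    _ = 𝟙 _ ⊗≫ (((f ≫ q.inv) ≫ γ₁) ◁ q.s.hom ≫ (q.s.hom ▷ γ₁) ▷ 𝟙 _) ▷ (γ₂ ≫ f) ⊗≫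
        η ▷ f ⊗≫ 𝟙 _ := by
        rw [whisker_exchange]; bicategory
    _ = _ := by rw [whisker_exchange]; bicategory

theorem horizontalInv_hom {g : x ⟶ y} (p : QuasiInverse f) (q : QuasiInverse g) (m : f ≅ g) :
    (p.horizontalInv q m).hom = 𝟙 p.inv ⊗≫ q.r.inv ▷ p.inv ⊗≫ q.inv ◁ m.inv ▷ p.inv ⊗≫
      q.inv ◁ p.s.hom ⊗≫ 𝟙 q.inv := by
  simp [horizontalInv, bicategoricalIsoComp, bicategoricalComp]

/-- `horizontalInv` is the mate of `m⁻¹`; the zigzag of `q` inside it straightens out. Only the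
target quasi-inverse has to satisfy a triangle identity. -/
theorem whiskerLeft_horizontalInv {g : x ⟶ y} (p : QuasiInverse f) {q : QuasiInverse g}
    (hq : q.Triangle) (m : f ≅ g) :
    g ◁ (p.horizontalInv q m).hom ≫ q.s.hom = m.inv ▷ p.inv ≫ p.s.hom := by
  rw [horizontalInv_hom]
  calc _ = 𝟙 _ ⊗≫ g ◁ q.r.inv ▷ p.inv ⊗≫ (g ≫ q.inv) ◁ m.inv ▷ p.inv ⊗≫
        ((g ≫ q.inv) ◁ p.s.hom ≫ q.s.hom ▷ 𝟙 x) ⊗≫ 𝟙 _ := by bicategory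
    _ = 𝟙 _ ⊗≫ g ◁ q.r.inv ▷ p.inv ⊗≫ ((g ≫ q.inv) ◁ (m.inv ▷ p.inv ≫ p.s.hom) ≫
          q.s.hom ▷ 𝟙 x) ⊗≫ 𝟙 _ := by bicategory
    _ = 𝟙 _ ⊗≫ (𝟙 (g ≫ 𝟙 y) ≫ g ◁ q.r.inv ⊗≫ q.s.hom ▷ g ⊗≫ 𝟙 g) ▷ p.inv ⊗≫
          (m.inv ▷ p.inv ≫ p.s.hom) ⊗≫ 𝟙 _ := by rw [whisker_exchange]; bicategory
    _ = _ := by rw [hq]; bicategory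

theorem tilde_hom {g : x ⟶ y} (p : QuasiInverse f) (q : QuasiInverse g) (m : f ≅ g)
    (u : x ⟶ x) : (p.tilde q m u).hom =
      (p.horizontalInv q m).hom ▷ (u ≫ f) ≫ q.inv ◁ u ◁ m.hom := rfl

/-- The square M is natural in the conjugating 1-arrow: by `whiskerLeft_horizontalInv`, the `m⁻¹`
hidden in `tilde` cancels against `m`. -/
theorem conjSquare_tilde {g : x ⟶ y} (p : QuasiInverse f) {q : QuasiInverse g}
    (hq : q.Triangle) (m : f ≅ g) (u : x ⟶ x) :
    m.hom ▷ p.conj u ≫ g ◁ (p.tilde q m u).hom ≫ (q.conjSquare u).hom =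
      (p.conjSquare u).hom ≫ u ◁ m.hom := by
  rw [tilde_hom, conjSquare_hom, conjSquare_hom]
  calc _ = 𝟙 _ ⊗≫ m.hom ▷ (p.inv ≫ u ≫ f) ⊗≫ g ◁ (p.horizontalInv q m).hom ▷ (u ≫ f) ⊗≫
          ((g ≫ q.inv) ◁ (u ◁ m.hom) ≫ q.s.hom ▷ (u ≫ g)) ⊗≫ 𝟙 _ := by bicategory
    _ = 𝟙 _ ⊗≫ m.hom ▷ (p.inv ≫ u ≫ f) ⊗≫
          (g ◁ (p.horizontalInv q m).hom ≫ q.s.hom) ▷ (u ≫ f) ⊗≫ u ◁ m.hom := by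
        rw [whisker_exchange]; bicategory
    _ = 𝟙 _ ⊗≫ ((m.hom ≫ m.inv) ▷ p.inv ≫ p.s.hom) ▷ (u ≫ f) ⊗≫ u ◁ m.hom := by
        rw [whiskerLeft_horizontalInv p hq]; bicategory
    _ = _ := by rw [Iso.hom_inv_id]; bicategory

theorem comp_r_inv {g : y ⟶ z} (p : QuasiInverse f) (q : QuasiInverse g) :
    (p.comp q).r.inv = q.r.inv ⊗≫ q.inv ◁ p.r.inv ▷ g ⊗≫
      𝟙 ((q.inv ≫ p.inv) ≫ f ≫ g) := by
  have h : (Iso.refl ((q.inv ≫ p.inv) ≫ f ≫ g) ≪⊗≫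
      whiskerLeftIso q.inv (whiskerRightIso p.r g) ≪⊗≫ q.r).inv =
        q.r.inv ⊗≫ q.inv ◁ p.r.inv ▷ g ⊗≫ 𝟙 ((q.inv ≫ p.inv) ≫ f ≫ g) := by
    simp [bicategoricalIsoComp, bicategoricalComp]
  exact h

theorem Triangle.comp {g : y ⟶ z} {p : QuasiInverse f} {q : QuasiInverse g}
    (hp : p.Triangle) (hq : q.Triangle) : (p.comp q).Triangle := by
  -- With the structural 2-arrows of the composite replaced by variables, only the two defining
  -- equations that matter remain.
  suffices H : ∀ (s : (f ≫ g) ≫ q.inv ≫ p.inv ≅ 𝟙 x) (r : (q.inv ≫ p.inv) ≫ f ≫ g ≅ 𝟙 z),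
      s.hom = 𝟙 ((f ≫ g) ≫ q.inv ≫ p.inv) ⊗≫ f ◁ q.s.hom ▷ p.inv ⊗≫ p.s.hom →
      r.inv = q.r.inv ⊗≫ q.inv ◁ p.r.inv ▷ g ⊗≫ 𝟙 ((q.inv ≫ p.inv) ≫ f ≫ g) →
      Triangle ⟨q.inv ≫ p.inv, s, r⟩ from H _ _ rfl (comp_r_inv p q)
  intro s r hs hr
  dsimp only [Triangle]
  rw [hs, hr]
  calc _ = 𝟙 _ ⊗≫ f ◁ g ◁ q.r.inv ⊗≫ f ◁ ((g ≫ q.inv) ◁ p.r.inv ≫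
        q.s.hom ▷ (p.inv ≫ f)) ▷ g ⊗≫ p.s.hom ▷ (f ≫ g) ⊗≫ 𝟙 _ := by
        bicategory
    _ = 𝟙 _ ⊗≫ f ◁ (𝟙 (g ≫ 𝟙 z) ≫ g ◁ q.r.inv ⊗≫ q.s.hom ▷ g ⊗≫ 𝟙 g) ⊗≫
        (𝟙 (f ≫ 𝟙 y) ≫ f ◁ p.r.inv ⊗≫ p.s.hom ▷ f ⊗≫ 𝟙 f) ▷ g ⊗≫ 𝟙 _ := by
        rw [whisker_exchange]; bicategory
    _ = _ := by rw [hp, hq]; bicategory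

theorem conjSquare_comp {g : y ⟶ z} (p : QuasiInverse f) (q : QuasiInverse g) (u : x ⟶ x) :
    ((p.comp q).conjSquare u).hom =
      (α_ f g _).hom ≫ f ◁ g ◁ (p.conjConj q u).hom ≫ f ◁ (q.conjSquare (p.conj u)).hom ≫
        (α_ f (p.conj u) g).inv ≫ (p.conjSquare u).hom ▷ g ≫ (α_ u f g).hom := by
  suffices H : ∀ (s : (f ≫ g) ≫ q.inv ≫ p.inv ≅ 𝟙 x) (r : (q.inv ≫ p.inv) ≫ f ≫ g ≅ 𝟙 z)
      (c : (q.inv ≫ p.inv) ≫ u ≫ f ≫ g ⟶ q.inv ≫ (p.inv ≫ u ≫ f) ≫ g),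
      s.hom = 𝟙 ((f ≫ g) ≫ q.inv ≫ p.inv) ⊗≫ f ◁ q.s.hom ▷ p.inv ⊗≫ p.s.hom →
      c = 𝟙 ((q.inv ≫ p.inv) ≫ u ≫ f ≫ g) ⊗≫ 𝟙 (q.inv ≫ (p.inv ≫ u ≫ f) ≫ g) →
      (conjSquare ⟨q.inv ≫ p.inv, s, r⟩ u).hom =
        (α_ f g _).hom ≫ f ◁ g ◁ c ≫ f ◁ (q.conjSquare (p.conj u)).hom ≫
        (α_ f (p.conj u) g).inv ≫ (p.conjSquare u).hom ▷ g ≫ (α_ u f g).hom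
    from H _ (p.comp q).r _ rfl rfl
  rintro s r c hs rfl
  simp only [conjSquare_hom, hs]
  bicategory

/-- The bracket consists of the square M of `g` and of `tilde` for `m`, viewed as a 2-arrow between
the composites `pik ≫ g` and `pjk ≫ pij`. Splitting the squares of these composites by
`conjSquare_comp` turns `conjSquare_tilde` into the cube, and the square M of `g` cancels against
the one in the bracket. -/
theorem bracket_cube {xi xj xk : B} {pij : xj ⟶ xi} {pjk : xk ⟶ xj} {pik : xk ⟶ xi}
    {g : xi ⟶ xi} (qij : QuasiInverse pij) (qjk : QuasiInverse pjk) (qik : QuasiInverse pik)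
    (qg : QuasiInverse g) (hij : qij.Triangle) (hjk : qjk.Triangle)
    (m : pik ≫ g ≅ pjk ≫ pij) (u : xk ⟶ xk)
    (br : qik.conj u ≫ g ≅ g ≫ qij.conj (qjk.conj u))
    (hbr : br = (qg.conjSquare (qik.conj u)).symm ≪≫ whiskerLeftIso g
      ((qik.conjConj qg u).symm ≪≫ (qik.comp qg).tilde (qjk.comp qij) m u ≪≫
        qjk.conjConj qij u)) :
    CubeCommutes m.hom m.hom (qik.conjSquare u).hom (qij.conjSquare (qjk.conj u)).hom
      (qjk.conjSquare u).hom br.inv := by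
  unfold CubeCommutes
  -- This moves the bracket to the other side as `br.hom`, whose definition can be expanded
  -- directly.
  rw [← cancel_epi (pik ◁ br.hom)]
  symm
  calc _ = 𝟙 _ ⊗≫ pik ◁ (qg.conjSquare (qik.conj u)).inv ⊗≫
          pik ◁ g ◁ (qik.conjConj qg u).inv ⊗≫
          ((pik ≫ g) ◁ (((qik.comp qg).tilde (qjk.comp qij) m u).hom ≫ (qjk.conjConj qij u).hom) ≫
          m.hom ▷ (qij.conj (qjk.conj u))) ⊗≫
          pjk ◁ (qij.conjSquare (qjk.conj u)).hom ⊗≫ (qjk.conjSquare u).hom ▷ pij ⊗≫ 𝟙 _ := by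
        subst hbr; simp only [Iso.trans_hom, Iso.symm_hom, whiskerLeftIso_hom]; bicategory
    _ = 𝟙 _ ⊗≫ pik ◁ (qg.conjSquare (qik.conj u)).inv ⊗≫
          pik ◁ g ◁ (qik.conjConj qg u).inv ⊗≫
          (m.hom ▷ ((qik.comp qg).conj u) ≫
          (pjk ≫ pij) ◁ ((qik.comp qg).tilde (qjk.comp qij) m u).hom ≫
          ((α_ pjk pij _).hom ≫
            pjk ◁ pij ◁ (qjk.conjConj qij u).hom ≫
            pjk ◁ (qij.conjSquare (qjk.conj u)).hom ≫ (α_ pjk (qjk.conj u) pij).inv ≫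
            (qjk.conjSquare u).hom ▷ pij ≫ (α_ u pjk pij).hom)) ⊗≫ 𝟙 _ := by
        rw [whisker_exchange]; bicategory
    _ = 𝟙 _ ⊗≫ pik ◁ (qg.conjSquare (qik.conj u)).inv ⊗≫
          pik ◁ g ◁ (qik.conjConj qg u).inv ⊗≫
          (((α_ pik g _).hom ≫
            pik ◁ g ◁ (qik.conjConj qg u).hom ≫
            pik ◁ (qg.conjSquare (qik.conj u)).hom ≫ (α_ pik (qik.conj u) g).inv ≫
            (qik.conjSquare u).hom ▷ g ≫ (α_ u pik g).hom) ≫ u ◁ m.hom) ⊗≫ 𝟙 _ := by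
        rw [← conjSquare_comp, conjSquare_tilde _ (hjk.comp hij), ← conjSquare_comp]
    _ = 𝟙 _ ⊗≫ pik ◁ ((qg.conjSquare (qik.conj u)).inv ≫
          g ◁ ((qik.conjConj qg u).inv ≫ (qik.conjConj qg u).hom) ≫
            (qg.conjSquare (qik.conj u)).hom) ⊗≫ (qik.conjSquare u).hom ▷ g ⊗≫
            u ◁ m.hom ⊗≫ 𝟙 _ := by bicategory
    _ = 𝟙 _ ⊗≫ pik ◁ (br.hom ≫ br.inv) ⊗≫ (qik.conjSquare u).hom ▷ g ⊗≫
            u ◁ m.hom ⊗≫ 𝟙 _ := by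
        rw [Iso.hom_inv_id, Iso.inv_hom_id, whiskerLeft_id, Category.id_comp, Iso.inv_hom_id]
    _ = _ := by bicategory

end QuasiInverse
-- Filling a cube with one face missing
-- Since `G₁₂` and `F₁₃` are invertible, the equation can be solved for the whiskering `a₁ ◁ G₂₃`,
-- and whiskering with an equivalence is bijective on 2-arrows. For C_ijkl the edge `a₁` is φ_il.
theorem CubeCommutes.existsUnique {v₀₀₀ v₁₀₀ v₀₁₀ v₀₀₁ v₁₁₀ v₁₀₁ v₀₁₁ v₁₁₁ : B}
    {a₁ : v₀₀₀ ⟶ v₁₀₀} {a₂ : v₀₀₀ ⟶ v₀₁₀} {a₃ : v₀₀₀ ⟶ v₀₀₁}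
    {b₁₂ : v₁₀₀ ⟶ v₁₁₀} {b₁₃ : v₁₀₀ ⟶ v₁₀₁} {b₂₁ : v₀₁₀ ⟶ v₁₁₀}
    {b₂₃ : v₀₁₀ ⟶ v₀₁₁} {b₃₁ : v₀₀₁ ⟶ v₁₀₁} {b₃₂ : v₀₀₁ ⟶ v₀₁₁}
    {c₁ : v₀₁₁ ⟶ v₁₁₁} {c₂ : v₁₀₁ ⟶ v₁₁₁} {c₃ : v₁₁₀ ⟶ v₁₁₁}
    (ha : ∃ e : v₀₀₀ ≌ v₁₀₀, e.hom = a₁)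
    (F₁₂ : a₁ ≫ b₁₂ ⟶ a₂ ≫ b₂₁) (G₁₂ : b₃₁ ≫ c₂ ≅ b₃₂ ≫ c₁)
    (F₁₃ : a₁ ≫ b₁₃ ≅ a₃ ≫ b₃₁) (G₁₃ : b₂₁ ≫ c₃ ⟶ b₂₃ ≫ c₁)
    (F₂₃ : a₂ ≫ b₂₃ ⟶ a₃ ≫ b₃₂) :
    ∃! G₂₃ : b₁₂ ≫ c₃ ⟶ b₁₃ ≫ c₂, CubeCommutes F₁₂ G₁₂.hom F₁₃.hom G₁₃ F₂₃ G₂₃ := by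
  obtain ⟨e, rfl⟩ := ha
  have key : ∀ G : b₁₂ ≫ c₃ ⟶ b₁₃ ≫ c₂, CubeCommutes F₁₂ G₁₂.hom F₁₃.hom G₁₃ F₂₃ G ↔
      e.hom ◁ G = 𝟙 (e.hom ≫ b₁₂ ≫ c₃) ⊗≫ F₁₂ ▷ c₃ ⊗≫ a₂ ◁ G₁₃ ⊗≫ F₂₃ ▷ c₁ ⊗≫
        a₃ ◁ G₁₂.inv ⊗≫ F₁₃.inv ▷ c₂ ⊗≫ 𝟙 _ := by
    intro G
    unfold CubeCommutes
    constructor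
    · intro h
      calc _ = 𝟙 _ ⊗≫ e.hom ◁ G ⊗≫ (F₁₃.hom ≫ F₁₃.inv) ▷ c₂ ⊗≫ 𝟙 _ := by
            rw [F₁₃.hom_inv_id]; bicategory
        _ = 𝟙 _ ⊗≫ e.hom ◁ G ⊗≫ F₁₃.hom ▷ c₂ ⊗≫ a₃ ◁ (G₁₂.hom ≫ G₁₂.inv) ⊗≫
              F₁₃.inv ▷ c₂ ⊗≫ 𝟙 _ := by
            rw [G₁₂.hom_inv_id]; bicategory
        _ = (𝟙 (e.hom ≫ b₁₂ ≫ c₃) ⊗≫ e.hom ◁ G ⊗≫ F₁₃.hom ▷ c₂ ⊗≫ a₃ ◁ G₁₂.hom ⊗≫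
              𝟙 (a₃ ≫ b₃₂ ≫ c₁)) ⊗≫ a₃ ◁ G₁₂.inv ⊗≫ F₁₃.inv ▷ c₂ ⊗≫ 𝟙 _ := by bicategory
        _ = _ := by rw [h]; bicategory
    · intro h
      rw [h]
      calc _ = 𝟙 (e.hom ≫ b₁₂ ≫ c₃) ⊗≫ F₁₂ ▷ c₃ ⊗≫ a₂ ◁ G₁₃ ⊗≫ F₂₃ ▷ c₁ ⊗≫
            a₃ ◁ G₁₂.inv ⊗≫ (F₁₃.inv ≫ F₁₃.hom) ▷ c₂ ⊗≫ a₃ ◁ G₁₂.hom ⊗≫ 𝟙 _ := by bicategory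
        _ = 𝟙 (e.hom ≫ b₁₂ ≫ c₃) ⊗≫ F₁₂ ▷ c₃ ⊗≫ a₂ ◁ G₁₃ ⊗≫ F₂₃ ▷ c₁ ⊗≫
            a₃ ◁ (G₁₂.inv ≫ G₁₂.hom) ⊗≫ 𝟙 _ := by rw [Iso.inv_hom_id]; bicategory
        _ = _ := by rw [Iso.inv_hom_id]; bicategory
  simp only [key]
  -- The preimage is `e.inv ◁ η` composed with the counit at both ends. Unlike injectivity, this
  -- requires the triangle identity, used in the forms `h₁` and `h₂`.
  have surj : ∀ η : e.hom ≫ b₁₂ ≫ c₃ ⟶ e.hom ≫ b₁₃ ≫ c₂, ∃ G, e.hom ◁ G = η := by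
    intro η
    refine ⟨𝟙 _ ⊗≫ e.counit.inv ▷ (b₁₂ ≫ c₃) ⊗≫ e.inv ◁ η ⊗≫
      e.counit.hom ▷ (b₁₃ ≫ c₂) ⊗≫ 𝟙 _, ?_⟩
    have h₁ : 𝟙 ((e.hom ≫ e.inv) ≫ e.hom) ⊗≫ e.hom ◁ e.counit.hom ⊗≫ 𝟙 (𝟙 _ ≫ e.hom) =
        e.unit.inv ▷ e.hom := by
      have h := e.left_triangle_hom
      rw [leftZigzag] at h
      rw [← cancel_epi (e.unit.hom ▷ e.hom), ← comp_whiskerRight, Iso.hom_inv_id]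
      calc _ = (e.unit.hom ▷ e.hom ⊗≫ e.hom ◁ e.counit.hom) ⊗≫ 𝟙 _ := by bicategory
        _ = _ := by rw [h]; bicategory
    have h₂ : 𝟙 (𝟙 _ ≫ e.hom) ⊗≫ e.hom ◁ e.counit.inv ⊗≫ 𝟙 ((e.hom ≫ e.inv) ≫ e.hom) =
        e.unit.hom ▷ e.hom := by
      rw [← cancel_mono (e.unit.inv ▷ e.hom), ← comp_whiskerRight, Iso.hom_inv_id, ← h₁]
      calc _ = 𝟙 _ ⊗≫ e.hom ◁ (e.counit.inv ≫ e.counit.hom) ⊗≫ 𝟙 _ := by bicategory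
        _ = _ := by rw [Iso.inv_hom_id]; bicategory
    calc _ = 𝟙 _ ⊗≫ (𝟙 (𝟙 _ ≫ e.hom) ⊗≫ e.hom ◁ e.counit.inv ⊗≫
          𝟙 ((e.hom ≫ e.inv) ≫ e.hom)) ▷ (b₁₂ ≫ c₃) ⊗≫ (e.hom ≫ e.inv) ◁ η ⊗≫
          (𝟙 ((e.hom ≫ e.inv) ≫ e.hom) ⊗≫ e.hom ◁ e.counit.hom ⊗≫ 𝟙 (𝟙 _ ≫ e.hom)) ▷
            (b₁₃ ≫ c₂) ⊗≫ 𝟙 _ := by bicategory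
      _ = 𝟙 _ ⊗≫ e.unit.hom ▷ (e.hom ≫ b₁₂ ≫ c₃) ⊗≫
          ((e.hom ≫ e.inv) ◁ η ≫ e.unit.inv ▷ (e.hom ≫ b₁₃ ≫ c₂)) ⊗≫ 𝟙 _ := by
          rw [h₁, h₂]; bicategory
      _ = 𝟙 _ ⊗≫ (e.unit.hom ≫ e.unit.inv) ▷ (e.hom ≫ b₁₂ ≫ c₃) ⊗≫ η ⊗≫ 𝟙 _ := by
          rw [whisker_exchange]; bicategory
      _ = _ := by rw [Iso.hom_inv_id]; bicategory
  obtain ⟨G, hG⟩ := surj _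
  exact ⟨G, hG, fun G' hG' => whiskerLeft_injective_of_equivalence e (hG'.trans hG.symm)⟩

/-! ### Changing the edges of a cube along isomorphisms -/

/-- Replacement of the four sides of a square by isomorphic ones. -/
def pasteIso {x y y' z : B} {f f' : x ⟶ y} {g g' : y ⟶ z} {h h' : x ⟶ y'} {k k' : y' ⟶ z}
    (a : f ≅ f') (b : g ≅ g') (c : h ≅ h') (d : k ≅ k') (η : f ≫ g ⟶ h ≫ k) :
    f' ≫ g' ⟶ h' ≫ k' :=
  a.inv ▷ g' ≫ f ◁ b.inv ≫ η ≫ c.hom ▷ k ≫ h' ◁ d.hom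

/-- The isomorphism between composites induced by isomorphisms between the factors. -/
@[simps!] def compIso {x y z : B} {f f' : x ⟶ y} {g g' : y ⟶ z} (a : f ≅ f') (b : g ≅ g') :
    f ≫ g ≅ f' ≫ g' :=
  whiskerRightIso a g ≪≫ whiskerLeftIso f' b

theorem pasteIso_eq {x y y' z : B} {f f' : x ⟶ y} {g g' : y ⟶ z} {h h' : x ⟶ y'} {k k' : y' ⟶ z}
    (a : f ≅ f') (b : g ≅ g') (c : h ≅ h') (d : k ≅ k') (η : f ≫ g ⟶ h ≫ k) :
    pasteIso a b c d η = (compIso a b).inv ≫ η ≫ (compIso c d).hom := by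
  simp only [pasteIso, compIso_hom, compIso_inv, Category.assoc, whisker_exchange_assoc]

theorem pasteIso_pasteIso {x y y' z : B} {f f' f'' : x ⟶ y} {g g' g'' : y ⟶ z}
    {h h' h'' : x ⟶ y'} {k k' k'' : y' ⟶ z}
    (a : f ≅ f') (b : g ≅ g') (c : h ≅ h') (d : k ≅ k') (a' : f' ≅ f'') (b' : g' ≅ g'')
    (c' : h' ≅ h'') (d' : k' ≅ k'') (η : f ≫ g ⟶ h ≫ k) :
    pasteIso a' b' c' d' (pasteIso a b c d η) =
      pasteIso (a ≪≫ a') (b ≪≫ b') (c ≪≫ c') (d ≪≫ d') η := by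
  simp only [pasteIso, Iso.trans_inv, Iso.trans_hom]
  calc _ = a'.inv ▷ g'' ≫ (f' ◁ b'.inv ≫ a.inv ▷ g') ≫ f ◁ b.inv ≫ η ≫ c.hom ▷ k ≫
          (h' ◁ d.hom ≫ c'.hom ▷ k') ≫ h'' ◁ d'.hom := by simp only [Category.assoc]
    _ = _ := by
      rw [whisker_exchange, whisker_exchange]
      simp only [Category.assoc, comp_whiskerRight, Bicategory.whiskerLeft_comp]

/-- With explicit associators each side is a product of three whiskered faces, which can be
transported one at a time. For `CocycleCube` this form is the cocycle equation. -/
theorem CubeCommutes.iff {v₀₀₀ v₁₀₀ v₀₁₀ v₀₀₁ v₁₁₀ v₁₀₁ v₀₁₁ v₁₁₁ : B}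
    {a₁ : v₀₀₀ ⟶ v₁₀₀} {a₂ : v₀₀₀ ⟶ v₀₁₀} {a₃ : v₀₀₀ ⟶ v₀₀₁}
    {b₁₂ : v₁₀₀ ⟶ v₁₁₀} {b₁₃ : v₁₀₀ ⟶ v₁₀₁} {b₂₁ : v₀₁₀ ⟶ v₁₁₀}
    {b₂₃ : v₀₁₀ ⟶ v₀₁₁} {b₃₁ : v₀₀₁ ⟶ v₁₀₁} {b₃₂ : v₀₀₁ ⟶ v₀₁₁}
    {c₁ : v₀₁₁ ⟶ v₁₁₁} {c₂ : v₁₀₁ ⟶ v₁₁₁} {c₃ : v₁₁₀ ⟶ v₁₁₁}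
    {F₁₂ : a₁ ≫ b₁₂ ⟶ a₂ ≫ b₂₁} {G₁₂ : b₃₁ ≫ c₂ ⟶ b₃₂ ≫ c₁}
    {F₁₃ : a₁ ≫ b₁₃ ⟶ a₃ ≫ b₃₁} {G₁₃ : b₂₁ ≫ c₃ ⟶ b₂₃ ≫ c₁}
    {F₂₃ : a₂ ≫ b₂₃ ⟶ a₃ ≫ b₃₂} {G₂₃ : b₁₂ ≫ c₃ ⟶ b₁₃ ≫ c₂} :
    CubeCommutes F₁₂ G₁₂ F₁₃ G₁₃ F₂₃ G₂₃ ↔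
      a₁ ◁ G₂₃ ≫ ((α_ _ _ _).inv ≫ F₁₃ ▷ c₂ ≫ (α_ _ _ _).hom) ≫ a₃ ◁ G₁₂ =
        ((α_ _ _ _).inv ≫ F₁₂ ▷ c₃ ≫ (α_ _ _ _).hom) ≫ a₂ ◁ G₁₃ ≫
          ((α_ _ _ _).inv ≫ F₂₃ ▷ c₁ ≫ (α_ _ _ _).hom) := by
  simp [CubeCommutes, bicategoricalComp]

/-- The isomorphisms on a path of three edges are carried across one whiskered face. With its
right-whiskered analogue this lets `CubeCommutes.pasteIso` proceed face by face along each side of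
the cube. -/
theorem compIso_compIso_whiskerLeft_pasteIso {v x y y' z : B} {e e' : v ⟶ x} {f f' : x ⟶ y}
    {g g' : y ⟶ z} {h h' : x ⟶ y'} {k k' : y' ⟶ z}
    (s : e ≅ e') (a : f ≅ f') (b : g ≅ g') (c : h ≅ h') (d : k ≅ k') (η : f ≫ g ⟶ h ≫ k) :
    (compIso s (compIso a b)).hom ≫ e' ◁ pasteIso a b c d η =
      e ◁ η ≫ (compIso s (compIso c d)).hom := by
  rw [pasteIso_eq, compIso_hom s, compIso_hom s, Category.assoc, ← Bicategory.whiskerLeft_comp,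
    Iso.hom_inv_id_assoc, Bicategory.whiskerLeft_comp, whisker_exchange_assoc]

theorem compIso_compIso_hom {x y z v : B} {f f' : x ⟶ y} {g g' : y ⟶ z} {e e' : z ⟶ v}
    (a : f ≅ f') (b : g ≅ g') (s : e ≅ e') :
    (compIso a (compIso b s)).hom =
      (α_ _ _ _).inv ≫ (f ≫ g) ◁ s.hom ≫ (compIso a b).hom ▷ e' ≫ (α_ _ _ _).hom := by
  rw [whisker_exchange_assoc]
  simp

theorem compIso_compIso_pasteIso_whiskerRight {v x y y' z : B} {e e' : z ⟶ v} {f f' : x ⟶ y}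
    {g g' : y ⟶ z} {h h' : x ⟶ y'} {k k' : y' ⟶ z}
    (s : e ≅ e') (a : f ≅ f') (b : g ≅ g') (c : h ≅ h') (d : k ≅ k') (η : f ≫ g ⟶ h ≫ k) :
    (compIso a (compIso b s)).hom ≫ (α_ _ _ _).inv ≫ pasteIso a b c d η ▷ e' ≫ (α_ _ _ _).hom =
      ((α_ _ _ _).inv ≫ η ▷ e ≫ (α_ _ _ _).hom) ≫ (compIso c (compIso d s)).hom := by
  rw [compIso_compIso_hom, compIso_compIso_hom, pasteIso_eq]
  simp only [Category.assoc, Iso.hom_inv_id_assoc, comp_whiskerRight, hom_inv_whiskerRight_assoc]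
  simp only [← whisker_exchange_assoc]

theorem CubeCommutes.pasteIso {v₀₀₀ v₁₀₀ v₀₁₀ v₀₀₁ v₁₁₀ v₁₀₁ v₀₁₁ v₁₁₁ : B}
    {a₁ a₁' : v₀₀₀ ⟶ v₁₀₀} {a₂ a₂' : v₀₀₀ ⟶ v₀₁₀} {a₃ a₃' : v₀₀₀ ⟶ v₀₀₁}
    {b₁₂ b₁₂' : v₁₀₀ ⟶ v₁₁₀} {b₁₃ b₁₃' : v₁₀₀ ⟶ v₁₀₁} {b₂₁ b₂₁' : v₀₁₀ ⟶ v₁₁₀}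
    {b₂₃ b₂₃' : v₀₁₀ ⟶ v₀₁₁} {b₃₁ b₃₁' : v₀₀₁ ⟶ v₁₀₁} {b₃₂ b₃₂' : v₀₀₁ ⟶ v₀₁₁}
    {c₁ c₁' : v₀₁₁ ⟶ v₁₁₁} {c₂ c₂' : v₁₀₁ ⟶ v₁₁₁} {c₃ c₃' : v₁₁₀ ⟶ v₁₁₁}
    {F₁₂ : a₁ ≫ b₁₂ ⟶ a₂ ≫ b₂₁} {G₁₂ : b₃₁ ≫ c₂ ⟶ b₃₂ ≫ c₁}
    {F₁₃ : a₁ ≫ b₁₃ ⟶ a₃ ≫ b₃₁} {G₁₃ : b₂₁ ≫ c₃ ⟶ b₂₃ ≫ c₁}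
    {F₂₃ : a₂ ≫ b₂₃ ⟶ a₃ ≫ b₃₂} {G₂₃ : b₁₂ ≫ c₃ ⟶ b₁₃ ≫ c₂}
    (ea₁ : a₁ ≅ a₁') (ea₂ : a₂ ≅ a₂') (ea₃ : a₃ ≅ a₃') (eb₁₂ : b₁₂ ≅ b₁₂') (eb₁₃ : b₁₃ ≅ b₁₃')
    (eb₂₁ : b₂₁ ≅ b₂₁') (eb₂₃ : b₂₃ ≅ b₂₃') (eb₃₁ : b₃₁ ≅ b₃₁') (eb₃₂ : b₃₂ ≅ b₃₂')
    (ec₁ : c₁ ≅ c₁') (ec₂ : c₂ ≅ c₂') (ec₃ : c₃ ≅ c₃')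
    (h : CubeCommutes F₁₂ G₁₂ F₁₃ G₁₃ F₂₃ G₂₃) :
    CubeCommutes (_root_.pasteIso ea₁ eb₁₂ ea₂ eb₂₁ F₁₂) (_root_.pasteIso eb₃₁ ec₂ eb₃₂ ec₁ G₁₂)
      (_root_.pasteIso ea₁ eb₁₃ ea₃ eb₃₁ F₁₃) (_root_.pasteIso eb₂₁ ec₃ eb₂₃ ec₁ G₁₃)
      (_root_.pasteIso ea₂ eb₂₃ ea₃ eb₃₂ F₂₃) (_root_.pasteIso eb₁₂ ec₃ eb₁₃ ec₂ G₂₃) := by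
  rw [CubeCommutes.iff] at h ⊢
  rw [← cancel_epi (compIso ea₁ (compIso eb₁₂ ec₃)).hom]
  have l₁ := compIso_compIso_whiskerLeft_pasteIso ea₁ eb₁₂ ec₃ eb₁₃ ec₂ G₂₃
  have l₂ := compIso_compIso_pasteIso_whiskerRight ec₂ ea₁ eb₁₃ ea₃ eb₃₁ F₁₃
  have l₃ := compIso_compIso_whiskerLeft_pasteIso ea₃ eb₃₁ ec₂ eb₃₂ ec₁ G₁₂
  have r₁ := compIso_compIso_pasteIso_whiskerRight ec₃ ea₁ eb₁₂ ea₂ eb₂₁ F₁₂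
  have r₂ := compIso_compIso_whiskerLeft_pasteIso ea₂ eb₂₁ ec₃ eb₂₃ ec₁ G₁₃
  have r₃ := compIso_compIso_pasteIso_whiskerRight ec₁ ea₂ eb₂₃ ea₃ eb₃₂ F₂₃
  simp only [Category.assoc] at h l₁ l₂ l₃ r₁ r₂ r₃ ⊢
  rw [reassoc_of% l₁, reassoc_of% l₂, l₃, reassoc_of% r₁, reassoc_of% r₂, r₃, reassoc_of% h]

theorem QuasiInverse.triangle_iff {x y : B} {f : x ⟶ y} {q : QuasiInverse f} :
    q.Triangle ↔ f ◁ q.r.inv ≫ (α_ _ _ _).inv ≫ q.s.hom ▷ f ≫ (λ_ f).hom = (ρ_ f).hom := by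
  simp [Triangle, bicategoricalComp]

theorem QuasiInverse.conjSquare_hom' {x y : B} {f : x ⟶ y} (q : QuasiInverse f) (γ : x ⟶ x) :
    (q.conjSquare γ).hom = (α_ f q.inv (γ ≫ f)).inv ≫ q.s.hom ▷ (γ ≫ f) ≫ (λ_ _).hom := by
  rw [conjSquare_hom]
  simp [bicategoricalComp]

/-! ### Images of cubes and quasi-inverses under a pseudofunctor -/

section Pseudofunctor

variable {C : Type u₂} [Bicategory.{w₂, v₂} C] (F : B ⥤ᵖ C)

/-- The image of a square under a pseudofunctor. -/
def mapSquare {x y y' z : B} {f : x ⟶ y} {g : y ⟶ z} {h : x ⟶ y'} {k : y' ⟶ z}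
    (η : f ≫ g ⟶ h ≫ k) : F.map f ≫ F.map g ⟶ F.map h ≫ F.map k :=
  (F.mapComp f g).inv ≫ F.map₂ η ≫ (F.mapComp h k).hom

theorem mapSquare_pasteIso {x y y' z : B} {f f' : x ⟶ y} {g g' : y ⟶ z} {h h' : x ⟶ y'}
    {k k' : y' ⟶ z} (a : f ≅ f') (b : g ≅ g') (c : h ≅ h') (d : k ≅ k') (η : f ≫ g ⟶ h ≫ k) :
    mapSquare F (pasteIso a b c d η) =
      pasteIso (F.map₂Iso a) (F.map₂Iso b) (F.map₂Iso c) (F.map₂Iso d) (mapSquare F η) := by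
  simp [mapSquare, pasteIso]

theorem mapComp_whiskerLeft_mapSquare {v x y y' z : B} (e : v ⟶ x) {f : x ⟶ y}
    {g : y ⟶ z} {h : x ⟶ y'} {k : y' ⟶ z} (η : f ≫ g ⟶ h ≫ k) :
    (F.mapComp e (f ≫ g)).hom ≫ F.map e ◁ (F.mapComp f g).hom ≫ F.map e ◁ mapSquare F η =
      F.map₂ (e ◁ η) ≫ (F.mapComp e (h ≫ k)).hom ≫ F.map e ◁ (F.mapComp h k).hom := by
  simp [mapSquare]

theorem mapComp_mapSquare_whiskerRight {v x y y' z : B} (e : z ⟶ v) {f : x ⟶ y}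
    {g : y ⟶ z} {h : x ⟶ y'} {k : y' ⟶ z} (η : f ≫ g ⟶ h ≫ k) :
    (F.mapComp f (g ≫ e)).hom ≫ F.map f ◁ (F.mapComp g e).hom ≫
        ((α_ _ _ _).inv ≫ mapSquare F η ▷ F.map e ≫ (α_ _ _ _).hom) =
      F.map₂ ((α_ _ _ _).inv ≫ η ▷ e ≫ (α_ _ _ _).hom) ≫
        (F.mapComp h (k ≫ e)).hom ≫ F.map h ◁ (F.mapComp k e).hom := by
  simp [mapSquare, Pseudofunctor.mapComp_assoc_right_hom_assoc]

/-- The image of a whiskered face is the whiskered image of that face, up to the constraints of `F`;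
these telescope along the three faces on each side. -/
theorem CubeCommutes.map {v₀₀₀ v₁₀₀ v₀₁₀ v₀₀₁ v₁₁₀ v₁₀₁ v₀₁₁ v₁₁₁ : B}
    {a₁ : v₀₀₀ ⟶ v₁₀₀} {a₂ : v₀₀₀ ⟶ v₀₁₀} {a₃ : v₀₀₀ ⟶ v₀₀₁}
    {b₁₂ : v₁₀₀ ⟶ v₁₁₀} {b₁₃ : v₁₀₀ ⟶ v₁₀₁} {b₂₁ : v₀₁₀ ⟶ v₁₁₀}
    {b₂₃ : v₀₁₀ ⟶ v₀₁₁} {b₃₁ : v₀₀₁ ⟶ v₁₀₁} {b₃₂ : v₀₀₁ ⟶ v₀₁₁}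
    {c₁ : v₀₁₁ ⟶ v₁₁₁} {c₂ : v₁₀₁ ⟶ v₁₁₁} {c₃ : v₁₁₀ ⟶ v₁₁₁}
    {F₁₂ : a₁ ≫ b₁₂ ⟶ a₂ ≫ b₂₁} {G₁₂ : b₃₁ ≫ c₂ ⟶ b₃₂ ≫ c₁}
    {F₁₃ : a₁ ≫ b₁₃ ⟶ a₃ ≫ b₃₁} {G₁₃ : b₂₁ ≫ c₃ ⟶ b₂₃ ≫ c₁}
    {F₂₃ : a₂ ≫ b₂₃ ⟶ a₃ ≫ b₃₂} {G₂₃ : b₁₂ ≫ c₃ ⟶ b₁₃ ≫ c₂}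
    (h : CubeCommutes F₁₂ G₁₂ F₁₃ G₁₃ F₂₃ G₂₃) :
    CubeCommutes (mapSquare F F₁₂) (mapSquare F G₁₂) (mapSquare F F₁₃) (mapSquare F G₁₃)
      (mapSquare F F₂₃) (mapSquare F G₂₃) := by
  rw [CubeCommutes.iff] at h ⊢
  rw [← cancel_epi (F.map a₁ ◁ (F.mapComp b₁₂ c₃).hom),
    ← cancel_epi (F.mapComp a₁ (b₁₂ ≫ c₃)).hom]
  have h' := congrArg F.map₂ h
  have l₁ := mapComp_whiskerLeft_mapSquare F a₁ G₂₃
  have l₂ := mapComp_mapSquare_whiskerRight F c₂ F₁₃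
  have l₃ := mapComp_whiskerLeft_mapSquare F a₃ G₁₂
  have r₁ := mapComp_mapSquare_whiskerRight F c₃ F₁₂
  have r₂ := mapComp_whiskerLeft_mapSquare F a₂ G₁₃
  have r₃ := mapComp_mapSquare_whiskerRight F c₁ F₂₃
  simp only [Category.assoc, PrelaxFunctor.map₂_comp] at h' l₁ l₂ l₃ r₁ r₂ r₃ ⊢
  rw [reassoc_of% l₁, reassoc_of% l₂, l₃, reassoc_of% r₁, reassoc_of% r₂, r₃, reassoc_of% h']

theorem _root_.CategoryTheory.Pseudofunctor.map₂_associator_inv {x y z v : B} (f : x ⟶ y)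
    (g : y ⟶ z) (h : z ⟶ v) :
    F.map₂ (α_ f g h).inv = (F.mapComp f (g ≫ h)).hom ≫ F.map f ◁ (F.mapComp g h).hom ≫
      (α_ (F.map f) (F.map g) (F.map h)).inv ≫ (F.mapComp f g).inv ▷ F.map h ≫
        (F.mapComp (f ≫ g) h).inv := by
  simp [F.mapComp_assoc_right_hom_assoc]

/-- The image of a quasi-inverse under a pseudofunctor. -/
@[simps inv] def QuasiInverse.map {x y : B} {f : x ⟶ y} (q : QuasiInverse f) :
    QuasiInverse (F.map f) where
  inv := F.map q.inv
  s := (F.mapComp f q.inv).symm ≪≫ F.map₂Iso q.s ≪≫ F.mapId x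
  r := (F.mapComp q.inv f).symm ≪≫ F.map₂Iso q.r ≪≫ F.mapId y

/-- Conjugation commutes with pseudofunctors. -/
def QuasiInverse.mapConj {x y : B} {f : x ⟶ y} (q : QuasiInverse f) (γ : x ⟶ x) :
    F.map (q.conj γ) ≅ F.map q.inv ≫ F.map γ ≫ F.map f :=
  F.mapComp _ _ ≪≫ whiskerLeftIso (F.map q.inv) (F.mapComp γ f)

theorem QuasiInverse.map_conjSquare {x y : B} {f : x ⟶ y} (q : QuasiInverse f) (γ : x ⟶ x) :
    ((q.map F).conjSquare (F.map γ)).hom = pasteIso (Iso.refl _) (q.mapConj F γ) (Iso.refl _)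
      (Iso.refl _) (mapSquare F (q.conjSquare γ).hom) := by
  rw [conjSquare_hom', conjSquare_hom']
  simp only [pasteIso, mapSquare, mapConj, map, Iso.trans_hom, Iso.trans_inv, Iso.symm_hom,
    PrelaxFunctor.map₂_comp, PrelaxFunctor.map₂Iso_hom, Pseudofunctor.map₂_whisker_right,
    Pseudofunctor.map₂_left_unitor, Pseudofunctor.map₂_associator_inv, Category.assoc,
    Iso.inv_hom_id_assoc, Iso.refl_hom, Iso.refl_inv, whiskerLeftIso_inv,
    Bicategory.whiskerLeft_comp, id_whiskerRight, whiskerLeft_id, Category.id_comp,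
    Category.comp_id, whiskerLeft_inv_hom_assoc]
  -- Naturality in `k` of the 2-arrow cancelling `F f` against `F f⁻¹`; it moves the constraint
  -- `F.mapComp γ f` next to its inverse.
  have nat : ∀ {k k' : F.obj x ⟶ F.obj y} (m : k ⟶ k') (X : F.map f ≫ F.map q.inv ⟶ 𝟙 _),
      (α_ _ _ _).inv ≫ X ▷ k ≫ (λ_ k).hom ≫ m =
        F.map f ◁ F.map q.inv ◁ m ≫ (α_ _ _ _).inv ≫ X ▷ k' ≫ (λ_ k').hom := by
    intro k k' m X
    rw [← leftUnitor_naturality, ← whisker_exchange_assoc]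
    simp
  have := nat (F.mapComp γ f).hom ((F.mapComp f q.inv).inv ≫ F.map₂ q.s.hom ≫ (F.mapId x).hom)
  simp only [comp_whiskerRight, Category.assoc] at this ⊢
  rw [this, ← Bicategory.whiskerLeft_comp_assoc, ← Bicategory.whiskerLeft_comp, Iso.inv_hom_id]
  simp

theorem QuasiInverse.Triangle.map {x y : B} {f : x ⟶ y} {q : QuasiInverse f}
    (hq : q.Triangle) : (q.map F).Triangle := by
  have h := congrArg F.map₂ (triangle_iff.1 hq)
  rw [triangle_iff]
  simp only [QuasiInverse.map, Iso.trans_hom, Iso.trans_inv, Iso.symm_hom, Iso.symm_inv,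
    PrelaxFunctor.map₂_comp, PrelaxFunctor.map₂Iso_hom, Pseudofunctor.map₂_whisker_right,
    Pseudofunctor.map₂_whisker_left, Pseudofunctor.map₂_right_unitor,
    Pseudofunctor.map₂_left_unitor, Pseudofunctor.map₂_associator_inv, Category.assoc,
    Iso.inv_hom_id_assoc, PrelaxFunctor.map₂Iso_inv,
    Bicategory.whiskerLeft_comp, comp_whiskerRight, cancel_epi] at h ⊢
  rw [h, ← Bicategory.whiskerLeft_comp_assoc, Iso.inv_hom_id]
  simp

end Pseudofunctor

/-- The square M involves `s` but not `r`, so the change of quasi-inverse need only be compatible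
with `s`. -/
theorem QuasiInverse.conjSquare_pasteIso {x y : B} {f f' : x ⟶ y} (q : QuasiInverse f)
    (q' : QuasiInverse f') (a : f ≅ f') (b : q.inv ≅ q'.inv)
    (h : (compIso a b).hom ≫ q'.s.hom = q.s.hom) {γ γ' : x ⟶ x} (c : γ ≅ γ') :
    (q'.conjSquare γ').hom =
      pasteIso a (compIso b (compIso c a)) c a (q.conjSquare γ).hom := by
  rw [conjSquare_hom', conjSquare_hom', ← h, pasteIso_eq, Iso.eq_inv_comp, compIso_compIso_hom]
  simp only [Category.assoc, comp_whiskerRight, Iso.hom_inv_id_assoc]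
  rw [← leftUnitor_naturality, whisker_exchange_assoc, whisker_exchange_assoc]

end Bicategories

/-! ### Conjugating a pseudofunctor by equivalences -/

section Bicategories
variable {B : Type u} [Bicategory.{w, v} B] {C : Type u₂} [Bicategory.{w₂, v₂} C]

/-- The bicategory with objects `κ` whose 1-arrows and 2-arrows are those of `B` between the images
of the objects under `o : κ → B`. -/
@[nolint unusedArguments]
def PulledBack {κ : Type t} (_ : κ → B) : Type t := κ

instance {κ : Type t} (o : κ → B) : Bicategory.{w, v} (PulledBack o) where
  Hom i j := o i ⟶ o j
  id i := 𝟙 (o i)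
  comp {i j k} (f : o i ⟶ o j) (g : o j ⟶ o k) := f ≫ g
  homCategory i j := Bicategory.homCategory (o i) (o j)
  whiskerLeft {i j k} (f : o i ⟶ o j) (g h : o j ⟶ o k) (η : g ⟶ h) := f ◁ η
  whiskerRight {i j k} (f g : o i ⟶ o j) (η : f ⟶ g) (h : o j ⟶ o k) := η ▷ h
  associator {i j k l} (f : o i ⟶ o j) (g : o j ⟶ o k) (h : o k ⟶ o l) := α_ f g h
  leftUnitor {i j} (f : o i ⟶ o j) := λ_ f
  rightUnitor {i j} (f : o i ⟶ o j) := ρ_ f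
  whiskerLeft_id := fun {i j _} (f : o i ⟶ o j) g => Bicategory.whiskerLeft_id (B := B) f g
  whiskerLeft_comp := fun {i j _} (f : o i ⟶ o j) _ _ _ η θ =>
    Bicategory.whiskerLeft_comp (B := B) f η θ
  id_whiskerLeft := fun η => Bicategory.id_whiskerLeft (B := B) η
  comp_whiskerLeft := fun f g _ _ η => Bicategory.comp_whiskerLeft (B := B) f g η
  id_whiskerRight := fun f g => Bicategory.id_whiskerRight (B := B) f g
  comp_whiskerRight := fun η θ i => Bicategory.comp_whiskerRight (B := B) η θ i
  whiskerRight_id := fun η => Bicategory.whiskerRight_id (B := B) η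
  whiskerRight_comp := fun η g h => Bicategory.whiskerRight_comp (B := B) η g h
  whisker_assoc := fun f _ _ η h => Bicategory.whisker_assoc (B := B) f η h
  whisker_exchange := fun η θ => Bicategory.whisker_exchange (B := B) η θ
  pentagon := fun f g h p => Bicategory.pentagon (B := B) f g h p
  triangle := fun f g => Bicategory.triangle (B := B) f g

theorem cancelRight_hom_whiskerRight {a b c : B} (e : b ≌ c) {p q : a ⟶ b}
    (θ : p ≫ e.hom ≅ q ≫ e.hom) : (cancelRight e θ).hom ▷ e.hom = θ.hom :=
  congrArg Iso.hom (whiskerRightIso_cancelRight e θ)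

namespace Conjugate

variable (F : B ⥤ᵖ C)

section

variable {x y z : B} {x' y' z' : C} (e : x' ≌ F.obj x) (e' : y' ≌ F.obj y) (e'' : z' ≌ F.obj z)

/-- The image of a 1-arrow under a pseudofunctor, conjugated by given equivalences. -/
def map₁ (f : x ⟶ y) : x' ⟶ y' := e.hom ≫ F.map f ≫ e'.inv

/-- The image of a 2-arrow under a pseudofunctor, conjugated by given equivalences. -/
def map₂ {f g : x ⟶ y} (η : f ⟶ g) : map₁ F e e' f ⟶ map₁ F e e' g :=
  e.hom ◁ F.map₂ η ▷ e'.inv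

/-- The square which relates `F.map f` to its conjugate. -/
def square (f : x ⟶ y) : map₁ F e e' f ≫ e'.hom ≅ e.hom ≫ F.map f :=
  Iso.refl ((e.hom ≫ F.map f ≫ e'.inv) ≫ e'.hom) ≪⊗≫
    whiskerLeftIso e.hom (whiskerLeftIso (F.map f) e'.counit) ≪⊗≫
    Iso.refl (e.hom ≫ F.map f)

theorem square_hom (f : x ⟶ y) : (square F e e' f).hom =
    𝟙 ((e.hom ≫ F.map f ≫ e'.inv) ≫ e'.hom) ⊗≫ e.hom ◁ F.map f ◁ e'.counit.hom ⊗≫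
      𝟙 (e.hom ≫ F.map f) := rfl

theorem map₂_square {f g : x ⟶ y} (η : f ⟶ g) :
    map₂ F e e' η ▷ e'.hom ≫ (square F e e' g).hom =
      (square F e e' f).hom ≫ e.hom ◁ F.map₂ η := by
  rw [square_hom, square_hom]
  dsimp only [map₁, map₂]
  calc _ = 𝟙 _ ⊗≫ e.hom ◁ (F.map₂ η ▷ (e'.inv ≫ e'.hom) ≫ F.map g ◁ e'.counit.hom) ⊗≫ 𝟙 _ := by
        bicategory
    _ = _ := by rw [← whisker_exchange]; bicategory

/-- Compatibility with identities. -/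
def mapId : map₁ F e e (𝟙 x) ≅ 𝟙 x' :=
  cancelRight e (square F e e (𝟙 x) ≪≫
    whiskerLeftIso e.hom (F.mapId x) ≪≫ ρ_ _ ≪≫ (λ_ _).symm)

theorem mapId_whiskerRight : (mapId F e).hom ▷ e.hom =
    (square F e e (𝟙 x)).hom ≫ e.hom ◁ (F.mapId x).hom ≫ (ρ_ _).hom ≫ (λ_ _).inv :=
  cancelRight_hom_whiskerRight _ _

/-- Compatibility with composition. -/
def mapComp (f : x ⟶ y) (g : y ⟶ z) :
    map₁ F e e'' (f ≫ g) ≅ map₁ F e e' f ≫ map₁ F e' e'' g :=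
  cancelRight e''
    (square F e e'' (f ≫ g) ≪≫ whiskerLeftIso e.hom (F.mapComp f g) ≪≫
      (α_ _ _ _).symm ≪≫ whiskerRightIso (square F e e' f).symm (F.map g) ≪≫
      α_ _ _ _ ≪≫ whiskerLeftIso (map₁ F e e' f) (square F e' e'' g).symm ≪≫ (α_ _ _ _).symm)

/-- `mapComp` is defined by cancelling `e''`, and this equation characterizes it. The axioms that
follow are checked after whiskering with an equivalence, where the squares reduce them to the
corresponding axioms of `F`. -/
theorem mapComp_whiskerRight (f : x ⟶ y) (g : y ⟶ z) :
    (mapComp F e e' e'' f g).hom ▷ e''.hom ≫ (α_ _ _ _).hom ≫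
      map₁ F e e' f ◁ (square F e' e'' g).hom ≫ (α_ _ _ _).inv ≫
      (square F e e' f).hom ▷ F.map g ≫ (α_ _ _ _).hom =
    (square F e e'' (f ≫ g)).hom ≫ e.hom ◁ (F.mapComp f g).hom := by
  rw [mapComp, cancelRight_hom_whiskerRight]
  simp only [Iso.trans_hom, Iso.symm_hom, whiskerLeftIso_hom, whiskerRightIso_hom, Category.assoc,
    Iso.inv_hom_id_assoc, whiskerLeft_inv_hom_assoc, Iso.hom_inv_id_assoc,
    inv_hom_whiskerRight_assoc, Iso.inv_hom_id, Category.comp_id]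

/-- The composite of the squares of two 1-arrows. -/
abbrev squareComp (f : x ⟶ y) (g : y ⟶ z) :
    (map₁ F e e' f ≫ map₁ F e' e'' g) ≫ e''.hom ≅ e.hom ≫ F.map f ≫ F.map g :=
  α_ _ _ _ ≪≫ whiskerLeftIso (map₁ F e e' f) (square F e' e'' g) ≪≫ (α_ _ _ _).symm ≪≫
      whiskerRightIso (square F e e' f) (F.map g) ≪≫ α_ _ _ _

theorem mapComp_squareComp (f : x ⟶ y) (g : y ⟶ z) :
    (mapComp F e e' e'' f g).hom ▷ e''.hom ≫ (squareComp F e e' e'' f g).hom =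
    (square F e e'' (f ≫ g)).hom ≫ e.hom ◁ (F.mapComp f g).hom :=
  mapComp_whiskerRight F e e' e'' f g

theorem map₂_whiskerLeft (f : x ⟶ y) {g h : y ⟶ z} (η : g ⟶ h) :
    map₂ F e e'' (f ◁ η) ≫ (mapComp F e e' e'' f h).hom =
      (mapComp F e e' e'' f g).hom ≫ map₁ F e e' f ◁ map₂ F e' e'' η := by
  apply whiskerRight_injective_of_equivalence e''
  rw [← cancel_mono (squareComp F e e' e'' f h).hom, comp_whiskerRight, Category.assoc,
    mapComp_squareComp, comp_whiskerRight, Category.assoc, reassoc_of% map₂_square]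
  calc _ = (square F e e'' (f ≫ g)).hom ≫ e.hom ◁ (F.mapComp f g).hom ≫
        e.hom ◁ F.map f ◁ F.map₂ η := by simp
    _ = (mapComp F e e' e'' f g).hom ▷ e''.hom ≫ (α_ _ _ _).hom ≫
      map₁ F e e' f ◁ (square F e' e'' g).hom ≫ (α_ _ _ _).inv ≫
      ((square F e e' f).hom ▷ F.map g ≫ (e.hom ≫ F.map f) ◁ F.map₂ η) ≫ (α_ _ _ _).hom := by
      rw [← reassoc_of% mapComp_whiskerRight F e e' e'']; simp
    _ = (mapComp F e e' e'' f g).hom ▷ e''.hom ≫ (α_ _ _ _).hom ≫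
      map₁ F e e' f ◁ ((square F e' e'' g).hom ≫ e'.hom ◁ F.map₂ η) ≫ (α_ _ _ _).inv ≫
      (square F e e' f).hom ▷ F.map h ≫ (α_ _ _ _).hom := by
      rw [← whisker_exchange]; simp only [Bicategory.whiskerLeft_comp]; simp
    _ = _ := by rw [← map₂_square]; simp

theorem map₂_whiskerRight {f g : x ⟶ y} (η : f ⟶ g) (h : y ⟶ z) :
    map₂ F e e'' (η ▷ h) ≫ (mapComp F e e' e'' g h).hom =
      (mapComp F e e' e'' f h).hom ≫ map₂ F e e' η ▷ map₁ F e' e'' h := by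
  apply whiskerRight_injective_of_equivalence e''
  rw [← cancel_mono (squareComp F e e' e'' g h).hom, comp_whiskerRight, Category.assoc,
    mapComp_squareComp, comp_whiskerRight, Category.assoc, reassoc_of% map₂_square]
  calc _ = (square F e e'' (f ≫ h)).hom ≫ e.hom ◁ (F.mapComp f h).hom ≫
        e.hom ◁ F.map₂ η ▷ F.map h := by simp
    _ = (mapComp F e e' e'' f h).hom ▷ e''.hom ≫ (α_ _ _ _).hom ≫
      map₁ F e e' f ◁ (square F e' e'' h).hom ≫ (α_ _ _ _).inv ≫
      ((square F e e' f).hom ≫ e.hom ◁ F.map₂ η) ▷ F.map h ≫ (α_ _ _ _).hom := by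
      rw [← reassoc_of% mapComp_whiskerRight F e e' e'']; simp
    _ = (mapComp F e e' e'' f h).hom ▷ e''.hom ≫ (α_ _ _ _).hom ≫
      (map₁ F e e' f ◁ (square F e' e'' h).hom ≫ map₂ F e e' η ▷ (e'.hom ≫ F.map h)) ≫
      (α_ _ _ _).inv ≫ (square F e e' g).hom ▷ F.map h ≫ (α_ _ _ _).hom := by
      rw [← map₂_square]; simp
    _ = _ := by rw [whisker_exchange]; simp

theorem map₂_leftUnitor (f : x ⟶ y) :
    map₂ F e e' (λ_ f).hom = (mapComp F e e e' (𝟙 x) f).hom ≫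
      (mapId F e).hom ▷ map₁ F e e' f ≫ (λ_ _).hom := by
  apply whiskerRight_injective_of_equivalence e'
  rw [← cancel_mono (square F e e' f).hom, map₂_square, comp_whiskerRight, Category.assoc]
  symm
  calc _ = (mapComp F e e e' (𝟙 x) f).hom ▷ e'.hom ≫ (α_ _ _ _).hom ≫
        ((mapId F e).hom ▷ (map₁ F e e' f ≫ e'.hom) ≫ 𝟙 x' ◁ (square F e e' f).hom) ≫
        (λ_ _).hom := by simp
    _ = (mapComp F e e e' (𝟙 x) f).hom ▷ e'.hom ≫ (α_ _ _ _).hom ≫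
        map₁ F e e (𝟙 x) ◁ (square F e e' f).hom ≫ (α_ _ _ _).inv ≫
        ((mapId F e).hom ▷ e.hom) ▷ F.map f ≫ (α_ _ _ _).hom ≫ (λ_ _).hom := by
        rw [← whisker_exchange]; simp
    _ = ((mapComp F e e e' (𝟙 x) f).hom ▷ e'.hom ≫ (squareComp F e e e' (𝟙 x) f).hom) ≫
        e.hom ◁ ((F.mapId x).hom ▷ F.map f ≫ (λ_ _).hom) := by
        rw [mapId_whiskerRight]; simp
    _ = _ := by rw [mapComp_squareComp]; simp

theorem map₂_rightUnitor (f : x ⟶ y) :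
    map₂ F e e' (ρ_ f).hom = (mapComp F e e' e' f (𝟙 y)).hom ≫
      map₁ F e e' f ◁ (mapId F e').hom ≫ (ρ_ _).hom := by
  apply whiskerRight_injective_of_equivalence e'
  rw [← cancel_mono (square F e e' f).hom, map₂_square, comp_whiskerRight, Category.assoc]
  symm
  calc _ = (mapComp F e e' e' f (𝟙 y)).hom ▷ e'.hom ≫ (α_ _ _ _).hom ≫
        map₁ F e e' f ◁ ((mapId F e').hom ▷ e'.hom ≫ (λ_ _).hom) ≫ (square F e e' f).hom := by
        simp
    _ = (mapComp F e e' e' f (𝟙 y)).hom ▷ e'.hom ≫ (α_ _ _ _).hom ≫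
        map₁ F e e' f ◁ (square F e' e' (𝟙 y)).hom ≫ (α_ _ _ _).inv ≫
        ((map₁ F e e' f ≫ e'.hom) ◁ (F.mapId y).hom ≫ (square F e e' f).hom ▷ 𝟙 _) ≫
          (ρ_ _).hom := by
        rw [mapId_whiskerRight]; simp
    _ = ((mapComp F e e' e' f (𝟙 y)).hom ▷ e'.hom ≫ (squareComp F e e' e' f (𝟙 y)).hom) ≫
        e.hom ◁ (F.map f ◁ (F.mapId y).hom ≫ (ρ_ _).hom) := by
        rw [whisker_exchange]; simp
    _ = _ := by rw [mapComp_squareComp]; simp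

end

theorem map₂_associator {x y z v : B} {x' y' z' v' : C} (e : x' ≌ F.obj x) (e' : y' ≌ F.obj y)
    (e'' : z' ≌ F.obj z) (e₃ : v' ≌ F.obj v) (f : x ⟶ y) (g : y ⟶ z) (h : z ⟶ v) :
    map₂ F e e₃ (α_ f g h).hom ≫ (mapComp F e e' e₃ f (g ≫ h)).hom ≫
        map₁ F e e' f ◁ (mapComp F e' e'' e₃ g h).hom =
      (mapComp F e e'' e₃ (f ≫ g) h).hom ≫ (mapComp F e e' e'' f g).hom ▷ map₁ F e'' e₃ h ≫
        (α_ _ _ _).hom := by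
  apply whiskerRight_injective_of_equivalence e₃
  -- The pasting `Q` of the squares of `f`, `g`, `h` is invertible and ends at `F f`, `F g`, `F h`
  -- preceded by `e.hom`, where associativity for `F` applies.
  let Q := (α_ (map₁ F e e' f) (map₁ F e' e'' g ≫ map₁ F e'' e₃ h) e₃.hom).hom ≫
    map₁ F e e' f ◁ (squareComp F e' e'' e₃ g h).hom ≫ (α_ _ _ _).inv ≫
      (square F e e' f).hom ▷ (F.map g ≫ F.map h) ≫ (α_ _ _ _).hom
  have hQ : IsIso Q := by simp only [Q]; infer_instance
  rw [← cancel_mono Q]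
  have l₁ : (map₁ F e e' f ◁ (mapComp F e' e'' e₃ g h).hom) ▷ e₃.hom ≫ Q =
      (squareComp F e e' e₃ f (g ≫ h)).hom ≫ e.hom ◁ F.map f ◁ (F.mapComp g h).hom := by
    calc _ = (α_ _ _ _).hom ≫ map₁ F e e' f ◁ ((mapComp F e' e'' e₃ g h).hom ▷ e₃.hom ≫
          (squareComp F e' e'' e₃ g h).hom) ≫ (α_ _ _ _).inv ≫
          (square F e e' f).hom ▷ (F.map g ≫ F.map h) ≫ (α_ _ _ _).hom := by
          simp [Q]
      _ = (α_ _ _ _).hom ≫ map₁ F e e' f ◁ (square F e' e₃ (g ≫ h)).hom ≫ (α_ _ _ _).inv ≫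
          ((map₁ F e e' f ≫ e'.hom) ◁ (F.mapComp g h).hom ≫
          (square F e e' f).hom ▷ (F.map g ≫ F.map h)) ≫ (α_ _ _ _).hom := by
          rw [mapComp_squareComp]; simp
      _ = _ := by rw [whisker_exchange]; simp
  have r₁ : ((mapComp F e e' e'' f g).hom ▷ map₁ F e'' e₃ h) ▷ e₃.hom ≫ (α_ _ _ _).hom ▷ e₃.hom ≫
      Q = (squareComp F e e'' e₃ (f ≫ g) h).hom ≫ e.hom ◁ (F.mapComp f g).hom ▷ F.map h ≫
        e.hom ◁ (α_ _ _ _).hom := by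
    calc _ = (α_ _ _ _).hom ≫ ((mapComp F e e' e'' f g).hom ▷ (map₁ F e'' e₃ h ≫ e₃.hom) ≫
          (map₁ F e e' f ≫ map₁ F e' e'' g) ◁ (square F e'' e₃ h).hom) ≫ (α_ _ _ _).inv ≫
          (squareComp F e e' e'' f g).hom ▷ F.map h ≫ (α_ _ _ _).hom ≫
          e.hom ◁ (α_ _ _ _).hom := by
          simp [Q]
      _ = (α_ _ _ _).hom ≫ map₁ F e e'' (f ≫ g) ◁ (square F e'' e₃ h).hom ≫ (α_ _ _ _).inv ≫
          ((mapComp F e e' e'' f g).hom ▷ e''.hom ≫ (squareComp F e e' e'' f g).hom) ▷ F.map h ≫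
          (α_ _ _ _).hom ≫ e.hom ◁ (α_ _ _ _).hom := by
          rw [← whisker_exchange]; simp
      _ = _ := by rw [mapComp_squareComp]; simp
  simp only [comp_whiskerRight, Category.assoc]
  rw [l₁, r₁, reassoc_of% mapComp_squareComp, reassoc_of% mapComp_squareComp,
    reassoc_of% map₂_square]
  simp

end Conjugate

/-- A pseudofunctor conjugated by a family of equivalences. -/
def Conjugate (F : B ⥤ᵖ C) {κ : Type t} {o : κ → B} {o' : κ → C}
    (e : ∀ i, o' i ≌ F.obj (o i)) : PulledBack o ⥤ᵖ C where
  obj := o'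
  map {i j} (f : o i ⟶ o j) := Conjugate.map₁ F (e i) (e j) f
  map₂ {i j} (f g : o i ⟶ o j) (η : f ⟶ g) := Conjugate.map₂ F (e i) (e j) η
  map₂_id {i j} (f : o i ⟶ o j) := by
    change (e i).hom ◁ F.map₂ (𝟙 f) ▷ (e j).inv = 𝟙 ((e i).hom ≫ F.map f ≫ (e j).inv)
    simp
  map₂_comp {i j} (f g h : o i ⟶ o j) (η : f ⟶ g) (θ : g ⟶ h) := by
    change (e i).hom ◁ F.map₂ (η ≫ θ) ▷ (e j).inv =
      (e i).hom ◁ F.map₂ η ▷ (e j).inv ≫ (e i).hom ◁ F.map₂ θ ▷ (e j).inv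
    simp
  mapId i := Conjugate.mapId F (e i)
  mapComp {i j k} (f : o i ⟶ o j) (g : o j ⟶ o k) := Conjugate.mapComp F (e i) (e j) (e k) f g
  map₂_whisker_left {i j k} (f : o i ⟶ o j) (g h : o j ⟶ o k) (η : g ⟶ h) := by
    have := Conjugate.map₂_whiskerLeft F (e i) (e j) (e k) f η
    rw [← Iso.eq_comp_inv, Category.assoc] at this
    exact this
  map₂_whisker_right {i j k} (f g : o i ⟶ o j) (η : f ⟶ g) (h : o j ⟶ o k) := by
    have := Conjugate.map₂_whiskerRight F (e i) (e j) (e k) η h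
    rw [← Iso.eq_comp_inv, Category.assoc] at this
    exact this
  map₂_associator {i j k l} (f : o i ⟶ o j) (g : o j ⟶ o k) (h : o k ⟶ o l) := by
    have := Conjugate.map₂_associator F (e i) (e j) (e k) (e l) f g h
    rw [← whiskerLeftIso_hom, ← Iso.trans_hom, ← Iso.eq_comp_inv] at this
    refine Eq.trans this ?_
    simp only [Iso.trans_inv, whiskerLeftIso_inv, Category.assoc]
    rfl
  map₂_left_unitor {i j} (f : o i ⟶ o j) := Conjugate.map₂_leftUnitor F (e i) (e j) f
  map₂_right_unitor {i j} (f : o i ⟶ o j) := Conjugate.map₂_rightUnitor F (e i) (e j) f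

/-! ### The calculus of squares -/

/-- Vertical composition of squares. -/
def vertComp {a b a' b' a'' b'' : B} {f : a ⟶ b} {u : a ⟶ a'} {v : b ⟶ b'} {g : a' ⟶ b'}
    {u' : a' ⟶ a''} {v' : b' ⟶ b''} {h : a'' ⟶ b''} (σ : f ≫ v ⟶ u ≫ g)
    (τ : g ≫ v' ⟶ u' ≫ h) : f ≫ v ≫ v' ⟶ (u ≫ u') ≫ h :=
  (α_ _ _ _).inv ≫ σ ▷ v' ≫ (α_ _ _ _).hom ≫ u ◁ τ ≫ (α_ _ _ _).inv

/-- Horizontal composition of squares. -/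
def horizComp {a b c a' b' c' : B} {f : a ⟶ b} {f' : b ⟶ c} {u : a ⟶ a'} {v : b ⟶ b'}
    {w : c ⟶ c'} {g : a' ⟶ b'} {g' : b' ⟶ c'} (σ : f ≫ v ⟶ u ≫ g) (τ : f' ≫ w ⟶ v ≫ g') :
    (f ≫ f') ≫ w ⟶ u ≫ g ≫ g' :=
  (α_ _ _ _).hom ≫ f ◁ τ ≫ (α_ _ _ _).inv ≫ σ ▷ g' ≫ (α_ _ _ _).hom

/-- The identity square of a vertical 1-arrow. -/
def idSquare {a b : B} (u : a ⟶ b) : 𝟙 a ≫ u ⟶ u ≫ 𝟙 b := (λ_ u).hom ≫ (ρ_ u).inv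

section

variable {a b c a' b' c' a'' b'' c'' : B}

/-- The two pastings differ only in the order of `σ` and `τ'`, which are independent of each other.
-/
theorem vertComp_horizComp {f : a ⟶ b} {f' : b ⟶ c} {u : a ⟶ a'} {v : b ⟶ b'}
    {w : c ⟶ c'} {g : a' ⟶ b'} {g' : b' ⟶ c'} {u' : a' ⟶ a''} {v' : b' ⟶ b''} {w' : c' ⟶ c''}
    {h : a'' ⟶ b''} {h' : b'' ⟶ c''} (σ : f ≫ v ⟶ u ≫ g) (σ' : f' ≫ w ⟶ v ≫ g')
    (τ : g ≫ v' ⟶ u' ≫ h) (τ' : g' ≫ w' ⟶ v' ≫ h') :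
    vertComp (horizComp σ σ') (horizComp τ τ') = horizComp (vertComp σ τ) (vertComp σ' τ') := by
  simp only [vertComp, horizComp]
  calc _ = 𝟙 _ ⊗≫ f ◁ σ' ▷ w' ⊗≫ (σ ▷ (g' ≫ w') ≫ (u ≫ g) ◁ τ') ⊗≫ u ◁ τ ▷ h' ⊗≫ 𝟙 _ := by
        bicategory
    _ = _ := by rw [← whisker_exchange]; bicategory

theorem vertComp_idSquare (u : a ⟶ a') (u' : a' ⟶ a'') :
    vertComp (idSquare u) (idSquare u') = idSquare (u ≫ u') := by
  simp only [vertComp, idSquare]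
  bicategory

variable {f f₀ : a ⟶ b} {u : a ⟶ a'} {v : b ⟶ b'} {g g₀ : a' ⟶ b'} {u' : a' ⟶ a''}
  {v' : b' ⟶ b''} {h h₀ : a'' ⟶ b''}

theorem whiskerRight_vertComp (θ : f ⟶ f₀) (σ : f₀ ≫ v ⟶ u ≫ g) (τ : g ≫ v' ⟶ u' ≫ h) :
    vertComp (θ ▷ v ≫ σ) τ = θ ▷ (v ≫ v') ≫ vertComp σ τ := by
  simp [vertComp]

theorem vertComp_whiskerLeft (σ : f ≫ v ⟶ u ≫ g) (τ : g ≫ v' ⟶ u' ≫ h) (θ : h ⟶ h₀) :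
    vertComp σ (τ ≫ u' ◁ θ) = vertComp σ τ ≫ (u ≫ u') ◁ θ := by
  simp [vertComp]

theorem vertComp_exchange (σ : f ≫ v ⟶ u ≫ g) (θ : g ⟶ g₀) (τ : g₀ ≫ v' ⟶ u' ≫ h) :
    vertComp (σ ≫ u ◁ θ) τ = vertComp σ (θ ▷ v' ≫ τ) := by
  simp [vertComp]

theorem vertComp_assoc {a₃ b₃ : B} {u₃ : a'' ⟶ a₃} {v₃ : b'' ⟶ b₃} {k : a₃ ⟶ b₃}
    (σ : f ≫ v ⟶ u ≫ g) (τ : g ≫ v' ⟶ u' ≫ h) (υ : h ≫ v₃ ⟶ u₃ ≫ k) :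
    vertComp σ (vertComp τ υ) = f ◁ (α_ _ _ _).inv ≫ vertComp (vertComp σ τ) υ ≫
      (α_ _ _ _).hom ▷ k := by
  simp [vertComp]

theorem vertComp_left {v₀ : b ⟶ b'} {u₀ : a ⟶ a'} (κ : v₀ ⟶ v) (σ : f ≫ v ⟶ u ≫ g) (μ : u ⟶ u₀)
    (τ : g ≫ v' ⟶ u' ≫ h) :
    vertComp (f ◁ κ ≫ σ ≫ μ ▷ g) τ = f ◁ κ ▷ v' ≫ vertComp σ τ ≫ μ ▷ u' ▷ h := by
  simp only [vertComp]
  calc _ = 𝟙 _ ⊗≫ f ◁ κ ▷ v' ⊗≫ σ ▷ v' ⊗≫ (μ ▷ (g ≫ v') ≫ u₀ ◁ τ) ⊗≫ 𝟙 _ := by bicategory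
    _ = _ := by rw [← whisker_exchange]; bicategory

theorem vertComp_right {v₀ : b' ⟶ b''} {u₀ : a' ⟶ a''} (κ : v₀ ⟶ v') (σ : f ≫ v ⟶ u ≫ g)
    (μ : u' ⟶ u₀) (τ : g ≫ v' ⟶ u' ≫ h) :
    vertComp σ (g ◁ κ ≫ τ ≫ μ ▷ h) = f ◁ v ◁ κ ≫ vertComp σ τ ≫ (u ◁ μ) ▷ h := by
  simp only [vertComp]
  calc _ = 𝟙 _ ⊗≫ (σ ▷ v₀ ≫ (u ≫ g) ◁ κ) ⊗≫ u ◁ (τ ≫ μ ▷ h) ⊗≫ 𝟙 _ := by bicategory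
    _ = _ := by rw [← whisker_exchange]; bicategory

end

section Pseudofunctor

variable {C : Type u₂} [Bicategory.{w₂, v₂} C] (F : B ⥤ᵖ C) {a b c a' b' c' a'' b'' : B}

theorem mapSquare_whiskerRight {f f₀ : a ⟶ b} {u : a ⟶ a'} {v : b ⟶ b'} {g : a' ⟶ b'}
    (θ : f ⟶ f₀) (σ : f₀ ≫ v ⟶ u ≫ g) :
    mapSquare F (θ ▷ v ≫ σ) = F.map₂ θ ▷ F.map v ≫ mapSquare F σ := by
  simp [mapSquare]

theorem mapSquare_whiskerLeft {f : a ⟶ b} {u : a ⟶ a'} {v : b ⟶ b'} {g g₀ : a' ⟶ b'}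
    (σ : f ≫ v ⟶ u ≫ g) (θ : g ⟶ g₀) :
    mapSquare F (σ ≫ u ◁ θ) = mapSquare F σ ≫ F.map u ◁ F.map₂ θ := by
  simp [mapSquare]

theorem mapSquare_vertical {f : a ⟶ b} {u u₀ : a ⟶ a'} {v v₀ : b ⟶ b'} {g : a' ⟶ b'}
    (κ : v₀ ⟶ v) (σ : f ≫ v ⟶ u ≫ g) (μ : u ⟶ u₀) :
    mapSquare F (f ◁ κ ≫ σ ≫ μ ▷ g) =
      F.map f ◁ F.map₂ κ ≫ mapSquare F σ ≫ F.map₂ μ ▷ F.map g := by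
  simp [mapSquare]

theorem mapSquare_idSquare (u : a ⟶ a') :
    (F.mapId a).hom ▷ F.map u ≫ idSquare (F.map u) =
      mapSquare F (idSquare u) ≫ F.map u ◁ (F.mapId a').hom := by
  have : F.map₂ (ρ_ u).inv ≫ (F.mapComp u (𝟙 a')).hom ≫ F.map u ◁ (F.mapId a').hom =
      (ρ_ (F.map u)).inv := by
    rw [← cancel_mono (ρ_ (F.map u)).hom, Category.assoc, Category.assoc,
      ← F.map₂_right_unitor, ← F.map₂_comp]
    simp
  simp [mapSquare, idSquare, this]

theorem mapSquare_horizComp {f : a ⟶ b} {f' : b ⟶ c} {u : a ⟶ a'} {v : b ⟶ b'}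
    {w : c ⟶ c'} {g : a' ⟶ b'} {g' : b' ⟶ c'} (σ : f ≫ v ⟶ u ≫ g) (τ : f' ≫ w ⟶ v ≫ g') :
    (F.mapComp f f').hom ▷ F.map w ≫ horizComp (mapSquare F σ) (mapSquare F τ) =
      mapSquare F (horizComp σ τ) ≫ F.map u ◁ (F.mapComp g g').hom := by
  simp [mapSquare, horizComp, F.map₂_associator_inv]

theorem mapSquare_vertComp {f : a ⟶ b} {u : a ⟶ a'} {v : b ⟶ b'} {g : a' ⟶ b'}
    {u' : a' ⟶ a''} {v' : b' ⟶ b''} {h : a'' ⟶ b''} (σ : f ≫ v ⟶ u ≫ g)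
    (τ : g ≫ v' ⟶ u' ≫ h) :
    F.map f ◁ (F.mapComp v v').hom ≫ vertComp (mapSquare F σ) (mapSquare F τ) =
      mapSquare F (vertComp σ τ) ≫ (F.mapComp u u').hom ▷ F.map h := by
  simp [mapSquare, vertComp, F.map₂_associator_inv]

end Pseudofunctor
-- Comparison 2-arrows determined by squares
section Comparison

variable {x y z X Y Z : B} {E : x ⟶ X} {E' : y ⟶ Y} {E'' : z ⟶ Z}

theorem horizComp_whiskerRight {f f₀ : x ⟶ y} {g g₀ : y ⟶ z} {h : X ⟶ Y} {k : Y ⟶ Z}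
    (a : f ≅ f₀) (b : g ≅ g₀) (σ : f₀ ≫ E' ⟶ E ≫ h) (τ : g₀ ≫ E'' ⟶ E' ≫ k) :
    horizComp (a.hom ▷ E' ≫ σ) (b.hom ▷ E'' ≫ τ) =
      (compIso a b).hom ▷ E'' ≫ horizComp σ τ := by
  simp only [horizComp, compIso_hom]
  calc _ = 𝟙 _ ⊗≫ f ◁ b.hom ▷ E'' ⊗≫ (f ◁ τ ≫ a.hom ▷ (E' ≫ k)) ⊗≫ σ ▷ k ⊗≫ 𝟙 _ := by bicategory
    _ = 𝟙 _ ⊗≫ (f ◁ b.hom ≫ a.hom ▷ g₀) ▷ E'' ⊗≫ f₀ ◁ τ ⊗≫ σ ▷ k ⊗≫ 𝟙 _ := by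
      rw [whisker_exchange]; bicategory
    _ = _ := by rw [whisker_exchange]; bicategory

theorem horizComp_vertical {E₀ : x ⟶ X} {E₀' : y ⟶ Y} {E₀'' : z ⟶ Z} {f : x ⟶ y} {g : y ⟶ z}
    {h : X ⟶ Y} {k : Y ⟶ Z} (a : E₀ ≅ E) (b : E₀' ≅ E') (c : E₀'' ≅ E'')
    (σ : f ≫ E' ⟶ E ≫ h) (τ : g ≫ E'' ⟶ E' ≫ k) :
    horizComp (f ◁ b.hom ≫ σ ≫ a.inv ▷ h) (g ◁ c.hom ≫ τ ≫ b.inv ▷ k) =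
      (f ≫ g) ◁ c.hom ≫ horizComp σ τ ≫ a.inv ▷ (h ≫ k) := by
  simp only [horizComp]
  calc _ = 𝟙 _ ⊗≫ f ◁ g ◁ c.hom ⊗≫ f ◁ τ ⊗≫ f ◁ (b.inv ≫ b.hom) ▷ k ⊗≫ σ ▷ k ⊗≫
        a.inv ▷ h ▷ k ⊗≫ 𝟙 _ := by bicategory
    _ = _ := by rw [Iso.inv_hom_id]; bicategory

theorem idSquare_vertical {E₀ : x ⟶ X} (a : E₀ ≅ E) :
    𝟙 x ◁ a.hom ≫ idSquare E ≫ a.inv ▷ 𝟙 X = idSquare E₀ := by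
  simp [idSquare]

/-- The squares `σ` and `σ'` present `f` and `f'` as the same `h` seen through equivalences, and the
comparison `i` is determined after whiskering. Structure 2-arrows that both families of squares
carry to the same `ζ` are therefore respected by the comparison. The next two lemmas apply this
principle to composition and identities. -/
theorem comparison_naturality (hE : ∃ e : y ≌ Y, e.hom = E') {f f' g g' : x ⟶ y} {h k : X ⟶ Y}
    {σ : f ≫ E' ⟶ E ≫ h} {τ : g ≫ E' ⟶ E ≫ k} {σ' : f' ≫ E' ⟶ E ≫ h} {τ' : g' ≫ E' ⟶ E ≫ k}
    [IsIso τ'] {ρ : f ⟶ g} {ρ' : f' ⟶ g'} {ζ : h ⟶ k} {i : f ⟶ f'} {j : g ⟶ g'}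
    (hρ : ρ ▷ E' ≫ τ = σ ≫ E ◁ ζ) (hρ' : ρ' ▷ E' ≫ τ' = σ' ≫ E ◁ ζ)
    (hi : i ▷ E' ≫ σ' = σ) (hj : j ▷ E' ≫ τ' = τ) : ρ ≫ j = i ≫ ρ' := by
  obtain ⟨e, rfl⟩ := hE
  apply whiskerRight_injective_of_equivalence e
  rw [← cancel_mono τ', comp_whiskerRight, comp_whiskerRight, Category.assoc, Category.assoc,
    hj, hρ, hρ', reassoc_of% hi]

theorem comparison_comp (hE : ∃ e : z ≌ Z, e.hom = E'') {f f' : x ⟶ y} {g g' : y ⟶ z}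
    {l l' : x ⟶ z} {h : X ⟶ Y} {k : Y ⟶ Z} {m : X ⟶ Z}
    {σ : f ≫ E' ⟶ E ≫ h} {τ : g ≫ E'' ⟶ E' ≫ k} {υ : l ≫ E'' ⟶ E ≫ m}
    {σ' : f' ≫ E' ⟶ E ≫ h} {τ' : g' ≫ E'' ⟶ E' ≫ k} {υ' : l' ≫ E'' ⟶ E ≫ m}
    [IsIso (horizComp σ' τ')]
    {ρ : l ⟶ f ≫ g} {ρ' : l' ⟶ f' ≫ g'} {ζ : m ⟶ h ≫ k} {i : f ≅ f'} {j : g ≅ g'} {n : l ⟶ l'}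
    (hρ : ρ ▷ E'' ≫ horizComp σ τ = υ ≫ E ◁ ζ) (hρ' : ρ' ▷ E'' ≫ horizComp σ' τ' = υ' ≫ E ◁ ζ)
    (hi : i.hom ▷ E' ≫ σ' = σ) (hj : j.hom ▷ E'' ≫ τ' = τ) (hn : n ▷ E'' ≫ υ' = υ) :
    ρ ≫ (compIso i j).hom = n ≫ ρ' := by
  obtain ⟨e, rfl⟩ := hE
  apply whiskerRight_injective_of_equivalence e
  rw [← cancel_mono (horizComp σ' τ'), comp_whiskerRight, comp_whiskerRight, Category.assoc,
    Category.assoc, ← horizComp_whiskerRight, hi, hj, hρ, hρ', reassoc_of% hn]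

theorem comparison_id (hE : ∃ e : x ≌ X, e.hom = E) {f f' : x ⟶ x} {h : X ⟶ X}
    {σ : f ≫ E ⟶ E ≫ h} {σ' : f' ≫ E ⟶ E ≫ h} {ρ : f ⟶ 𝟙 x} {ρ' : f' ⟶ 𝟙 x} {ζ : h ⟶ 𝟙 X}
    {i : f ⟶ f'} (hρ : ρ ▷ E ≫ idSquare E = σ ≫ E ◁ ζ)
    (hρ' : ρ' ▷ E ≫ idSquare E = σ' ≫ E ◁ ζ) (hi : i ▷ E ≫ σ' = σ) : ρ = i ≫ ρ' := by
  obtain ⟨e, rfl⟩ := hE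
  apply whiskerRight_injective_of_equivalence e
  have : IsIso (idSquare e.hom) := by simp only [idSquare]; infer_instance
  rw [← cancel_mono (idSquare e.hom), comp_whiskerRight, Category.assoc, hρ, hρ',
    reassoc_of% hi]

end Comparison

instance {a b a' b' a'' b'' : B} {f : a ⟶ b} {u : a ⟶ a'} {v : b ⟶ b'} {g : a' ⟶ b'}
    {u' : a' ⟶ a''} {v' : b' ⟶ b''} {h : a'' ⟶ b''} (σ : f ≫ v ⟶ u ≫ g)
    (τ : g ≫ v' ⟶ u' ≫ h) [IsIso σ] [IsIso τ] : IsIso (vertComp σ τ) := by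
  unfold vertComp; infer_instance

instance {a b c a' b' c' : B} {f : a ⟶ b} {f' : b ⟶ c} {u : a ⟶ a'} {v : b ⟶ b'}
    {w : c ⟶ c'} {g : a' ⟶ b'} {g' : b' ⟶ c'} (σ : f ≫ v ⟶ u ≫ g) (τ : f' ≫ w ⟶ v ≫ g')
    [IsIso σ] [IsIso τ] : IsIso (horizComp σ τ) := by
  unfold horizComp; infer_instance

/-! ### Iterated conjugates and strong transformations -/

namespace Conjugate

variable {C : Type u₂} [Bicategory.{w₂, v₂} C] {D : Type u₃} [Bicategory.{w₃, v₃} D]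

theorem mapComp_horizComp (F : B ⥤ᵖ C) {x y z : B} {x' y' z' : C} (e : x' ≌ F.obj x)
    (e' : y' ≌ F.obj y) (e'' : z' ≌ F.obj z) (f : x ⟶ y) (g : y ⟶ z) :
    (mapComp F e e' e'' f g).hom ▷ e''.hom ≫
        horizComp (square F e e' f).hom (square F e' e'' g).hom =
      (square F e e'' (f ≫ g)).hom ≫ e.hom ◁ (F.mapComp f g).hom :=
  mapComp_whiskerRight F e e' e'' f g

theorem mapId_idSquare (F : B ⥤ᵖ C) {x : B} {x' : C} (e : x' ≌ F.obj x) :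
    (mapId F e).hom ▷ e.hom ≫ idSquare e.hom =
      (square F e e (𝟙 x)).hom ≫ e.hom ◁ (F.mapId x).hom := by
  rw [mapId_whiskerRight]
  simp [idSquare]

variable {F : B ⥤ᵖ C} {G : C ⥤ᵖ D} {H : B ⥤ᵖ D} (φ : Pseudofunctor.StrongTrans H (F.comp G))

/-- The components of a strong transformation `H ⟹ G F`. -/
abbrev app (x : B) : H.obj x ⟶ G.obj (F.obj x) := φ.app x

/-- The naturality 2-arrows of a strong transformation `H ⟹ G F`. -/
abbrev nat {x y : B} (f : x ⟶ y) : H.map f ≫ app φ y ≅ app φ x ≫ G.map (F.map f) :=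
  φ.naturality f

theorem nat_naturality {x y : B} {f g : x ⟶ y} (η : f ⟶ g) :
    H.map₂ η ▷ app φ y ≫ (nat φ g).hom = (nat φ f).hom ≫ app φ x ◁ G.map₂ (F.map₂ η) :=
  φ.naturality_naturality η

theorem nat_comp {x y z : B} (f : x ⟶ y) (g : y ⟶ z) :
    (H.mapComp f g).hom ▷ app φ z ≫ horizComp (nat φ f).hom (nat φ g).hom =
      (nat φ (f ≫ g)).hom ≫
        app φ x ◁ (G.map₂ (F.mapComp f g).hom ≫ (G.mapComp (F.map f) (F.map g)).hom) :=
  (φ.naturality_comp f g).symm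

theorem nat_id (x : B) :
    (H.mapId x).hom ▷ app φ x ≫ idSquare (app φ x) =
      (nat φ (𝟙 x)).hom ≫ app φ x ◁ (G.map₂ (F.mapId x).hom ≫ (G.mapId (F.obj x)).hom) :=
  (φ.naturality_id x).symm

/-- The square which relates `G (F f)` to its iterated conjugate. -/
def square₂ (F : B ⥤ᵖ C) (G : C ⥤ᵖ D) {x y : B} {x' y' : C} {x'' y'' : D} (e : x' ≌ F.obj x)
    (e' : y' ≌ F.obj y) (d : x'' ≌ G.obj x') (d' : y'' ≌ G.obj y') (f : x ⟶ y) :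
    map₁ G d d' (map₁ F e e' f) ≫ d'.hom ≫ G.map e'.hom ⟶
      (d.hom ≫ G.map e.hom) ≫ G.map (F.map f) :=
  vertComp (square G d d' (map₁ F e e' f)).hom (mapSquare G (square F e e' f).hom)

/-- The square which relates `G (F f)` to the conjugate of `H f`. -/
def squareTrans {x y : B} {x' y' : C} {x'' y'' : D} {e : x' ≌ F.obj x}
    {e' : y' ≌ F.obj y} {d : x'' ≌ G.obj x'} {d' : y'' ≌ G.obj y'} {k : x'' ≌ H.obj x}
    {k' : y'' ≌ H.obj y} (a : d.hom ≫ G.map e.hom ≅ k.hom ≫ app φ x)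
    (a' : d'.hom ≫ G.map e'.hom ≅ k'.hom ≫ app φ y) (f : x ⟶ y) :
    map₁ H k k' f ≫ d'.hom ≫ G.map e'.hom ⟶ (d.hom ≫ G.map e.hom) ≫ G.map (F.map f) :=
  map₁ H k k' f ◁ a'.hom ≫ vertComp (square H k k' f).hom (nat φ f).hom ≫
    a.inv ▷ G.map (F.map f)

variable {x y z : B} {x' y' z' : C} {x'' y'' z'' : D} {e : x' ≌ F.obj x}
    {e' : y' ≌ F.obj y} {e'' : z' ≌ F.obj z} {d : x'' ≌ G.obj x'} {d' : y'' ≌ G.obj y'}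
    {d'' : z'' ≌ G.obj z'} {k : x'' ≌ H.obj x} {k' : y'' ≌ H.obj y} {k'' : z'' ≌ H.obj z}
    (a : d.hom ≫ G.map e.hom ≅ k.hom ≫ app φ x)
    (a' : d'.hom ≫ G.map e'.hom ≅ k'.hom ≫ app φ y)
    (a'' : d''.hom ≫ G.map e''.hom ≅ k''.hom ≫ app φ z)

instance (f : x ⟶ y) : IsIso (squareTrans φ a a' f) := by
  unfold squareTrans; infer_instance

/-- The lemmas on `square₂` and `squareTrans` show that both squares carry 2-arrows, composition and
identities to the corresponding structure of the composite `G F`. These are the hypotheses of the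
`comparison` lemmas. -/
theorem square₂_naturality {f g : x ⟶ y} (η : f ⟶ g) :
    map₂ G d d' (map₂ F e e' η) ▷ (d'.hom ≫ G.map e'.hom) ≫ square₂ F G e e' d d' g =
      square₂ F G e e' d d' f ≫ (d.hom ≫ G.map e.hom) ◁ G.map₂ (F.map₂ η) := by
  rw [square₂, square₂, ← whiskerRight_vertComp, ← vertComp_whiskerLeft, map₂_square,
    vertComp_exchange, ← mapSquare_whiskerRight, map₂_square, mapSquare_whiskerLeft]

theorem square₂_comp (f : x ⟶ y) (g : y ⟶ z) :
    (map₂ G d d'' (mapComp F e e' e'' f g).hom ≫ (mapComp G d d' d'' _ _).hom) ▷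
        (d''.hom ≫ G.map e''.hom) ≫
        horizComp (square₂ F G e e' d d' f) (square₂ F G e' e'' d' d'' g) =
      square₂ F G e e'' d d'' (f ≫ g) ≫ (d.hom ≫ G.map e.hom) ◁
        (G.map₂ (F.mapComp f g).hom ≫ (G.mapComp (F.map f) (F.map g)).hom) := by
  simp only [square₂]
  rw [← vertComp_horizComp, ← whiskerRight_vertComp, ← vertComp_whiskerLeft, comp_whiskerRight,
    Category.assoc, mapComp_horizComp, reassoc_of% map₂_square, ← Bicategory.whiskerLeft_comp,
    vertComp_exchange, comp_whiskerRight, Category.assoc, mapSquare_horizComp,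
    Bicategory.whiskerLeft_comp, ← Category.assoc, ← Category.assoc, ← mapSquare_whiskerRight,
    mapComp_horizComp, mapSquare_whiskerLeft]

theorem square₂_id :
    (map₂ G d d (mapId F e).hom ≫ (mapId G d).hom) ▷ (d.hom ≫ G.map e.hom) ≫
        idSquare (d.hom ≫ G.map e.hom) =
      square₂ F G e e d d (𝟙 x) ≫ (d.hom ≫ G.map e.hom) ◁
        (G.map₂ (F.mapId x).hom ≫ (G.mapId (F.obj x)).hom) := by
  simp only [square₂]
  rw [← vertComp_idSquare, ← whiskerRight_vertComp, ← vertComp_whiskerLeft, comp_whiskerRight,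
    Category.assoc, mapId_idSquare, reassoc_of% map₂_square, ← Bicategory.whiskerLeft_comp,
    vertComp_exchange, comp_whiskerRight, Category.assoc, mapSquare_idSquare,
    Bicategory.whiskerLeft_comp, ← Category.assoc, ← Category.assoc, ← mapSquare_whiskerRight,
    mapId_idSquare, mapSquare_whiskerLeft]

theorem squareTrans_naturality {f g : x ⟶ y} (η : f ⟶ g) :
    map₂ H k k' η ▷ (d'.hom ≫ G.map e'.hom) ≫ squareTrans φ a a' g =
      squareTrans φ a a' f ≫ (d.hom ≫ G.map e.hom) ◁ G.map₂ (F.map₂ η) := by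
  -- The isomorphisms `a` and `a'` only alter the vertical sides, so the statement is settled before
  -- they are inserted.
  have h : map₂ H k k' η ▷ (k'.hom ≫ app φ y) ≫ vertComp (square H k k' g).hom (nat φ g).hom =
      vertComp (square H k k' f).hom (nat φ f).hom ≫
        (k.hom ≫ app φ x) ◁ G.map₂ (F.map₂ η) := by
    rw [← whiskerRight_vertComp, ← vertComp_whiskerLeft, map₂_square, vertComp_exchange,
      nat_naturality]
  simp only [squareTrans, Category.assoc]
  rw [← whisker_exchange_assoc, reassoc_of% h, whisker_exchange]

theorem squareTrans_comp (f : x ⟶ y) (g : y ⟶ z) :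
    (mapComp H k k' k'' f g).hom ▷ (d''.hom ≫ G.map e''.hom) ≫
        horizComp (squareTrans φ a a' f) (squareTrans φ a' a'' g) =
      squareTrans φ a a'' (f ≫ g) ≫ (d.hom ≫ G.map e.hom) ◁
        (G.map₂ (F.mapComp f g).hom ≫ (G.mapComp (F.map f) (F.map g)).hom) := by
  have h : (mapComp H k k' k'' f g).hom ▷ (k''.hom ≫ app φ z) ≫
      horizComp (vertComp (square H k k' f).hom (nat φ f).hom)
        (vertComp (square H k' k'' g).hom (nat φ g).hom) =
      vertComp (square H k k'' (f ≫ g)).hom (nat φ (f ≫ g)).hom ≫ (k.hom ≫ app φ x) ◁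
        (G.map₂ (F.mapComp f g).hom ≫ (G.mapComp (F.map f) (F.map g)).hom) := by
    rw [← vertComp_horizComp, ← whiskerRight_vertComp, ← vertComp_whiskerLeft,
      mapComp_horizComp, vertComp_exchange, nat_comp]
  simp only [squareTrans, Category.assoc, horizComp_vertical]
  rw [← whisker_exchange_assoc, reassoc_of% h, whisker_exchange]

theorem squareTrans_id :
    (mapId H k).hom ▷ (d.hom ≫ G.map e.hom) ≫ idSquare (d.hom ≫ G.map e.hom) =
      squareTrans φ a a (𝟙 x) ≫ (d.hom ≫ G.map e.hom) ◁
        (G.map₂ (F.mapId x).hom ≫ (G.mapId (F.obj x)).hom) := by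
  have h : (mapId H k).hom ▷ (k.hom ≫ app φ x) ≫ idSquare (k.hom ≫ app φ x) =
      vertComp (square H k k (𝟙 x)).hom (nat φ (𝟙 x)).hom ≫ (k.hom ≫ app φ x) ◁
        (G.map₂ (F.mapId x).hom ≫ (G.mapId (F.obj x)).hom) := by
    rw [← vertComp_idSquare, ← whiskerRight_vertComp, ← vertComp_whiskerLeft,
      mapId_idSquare, vertComp_exchange, nat_id]
  simp only [squareTrans, Category.assoc, ← idSquare_vertical a]
  rw [← whisker_exchange_assoc, reassoc_of% h, whisker_exchange]

/-- The comparison of the two squares of a 1-arrow, as a 2-arrow which is characterized by its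
whiskerings. -/
theorem comparison_squareTrans {f : x ⟶ y}
    {i : map₁ G d d' (map₁ F e e' f) ≅ map₁ H k k' f}
    (h : (i.hom ▷ d'.hom) ▷ G.map e'.hom =
      (whiskerRightIso (square G d d' (map₁ F e e' f)) (G.map e'.hom) ≪≫
      α_ _ _ _ ≪≫
      whiskerLeftIso d.hom ((G.mapComp _ _).symm ≪≫
        G.map₂Iso (square F e e' f) ≪≫ G.mapComp _ _) ≪≫
      (α_ _ _ _).symm ≪≫
      whiskerRightIso a (G.map (F.map f)) ≪≫
      α_ _ _ _ ≪≫
      whiskerLeftIso k.hom (nat φ f).symm ≪≫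
      (α_ _ _ _).symm ≪≫
      whiskerRightIso (square H k k' f).symm (app φ y) ≪≫
      α_ _ _ _ ≪≫
      whiskerLeftIso (map₁ H k k' f) a'.symm ≪≫
      (α_ _ _ _).symm).hom) :
    i.hom ▷ (d'.hom ≫ G.map e'.hom) ≫ squareTrans φ a a' f = square₂ F G e e' d d' f := by
  rw [whiskerRight_comp, h]
  simp [squareTrans, square₂, vertComp, mapSquare]

end Conjugate
-- Squares whose vertical sides vary
/-- The square `σ` is obtained from the square `σ'`, with the same last side, by changing its
other sides along the 2-arrows `θ`, `κ` and `κ'`. -/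
def SquareFactors {a b a' b' : B} {f f' : a ⟶ b} {u u' : a ⟶ a'} {v v' : b ⟶ b'} {g : a' ⟶ b'}
    (θ : f ⟶ f') (κ : u ≅ u') (κ' : v ≅ v') (σ : f ≫ v ⟶ u ≫ g) (σ' : f' ≫ v' ⟶ u' ≫ g) : Prop :=
  θ ▷ v ≫ f' ◁ κ'.hom ≫ σ' ≫ κ.inv ▷ g = σ

namespace SquareFactors

section

variable {a b a' b' a'' b'' : B} {f f' f'' : a ⟶ b} {u u' u'' : a ⟶ a'} {v v' v'' : b ⟶ b'}
  {g g' : a' ⟶ b'}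
  {θ : f ⟶ f'} {κ : u ≅ u'} {κ' : v ≅ v'} {σ : f ≫ v ⟶ u ≫ g} {σ' : f' ≫ v' ⟶ u' ≫ g}

theorem trans (h : SquareFactors θ κ κ' σ σ') {θ' : f' ⟶ f''} {μ : u' ≅ u''} {μ' : v' ≅ v''}
    {σ'' : f'' ≫ v'' ⟶ u'' ≫ g} (h' : SquareFactors θ' μ μ' σ' σ'') :
    SquareFactors (θ ≫ θ') (κ ≪≫ μ) (κ' ≪≫ μ') σ σ'' := by
  unfold SquareFactors at *
  rw [← h, ← h']
  simp [whisker_exchange_assoc]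

theorem vertComp_right {r : a'' ⟶ a} {s : b'' ⟶ b} {l l' : a'' ⟶ b''} {φ : l ⟶ l'}
    {τ : l ≫ s ⟶ r ≫ f} {τ' : l' ≫ s ⟶ r ≫ f'} (hφ : φ ▷ s ≫ τ' = τ ≫ r ◁ θ)
    (h : SquareFactors θ κ κ' σ σ') :
    SquareFactors φ (whiskerLeftIso r κ) (whiskerLeftIso s κ') (vertComp τ σ)
      (vertComp τ' σ') := by
  unfold SquareFactors at *
  rw [← h, ← vertComp_exchange, ← hφ, whiskerRight_vertComp]
  rw [_root_.vertComp_right]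
  rfl

theorem vertComp_left (h : SquareFactors θ κ κ' σ σ') {r : a' ⟶ a''} {s : b' ⟶ b''}
    {l : a'' ⟶ b''} (τ : g ≫ s ⟶ r ≫ l) :
    SquareFactors θ (whiskerRightIso κ r) (whiskerRightIso κ' s) (vertComp σ τ)
      (vertComp σ' τ) := by
  unfold SquareFactors at *
  rw [← h, whiskerRight_vertComp, _root_.vertComp_left]
  rfl

theorem vertComp_assoc {a₃ b₃ : B} {r : a' ⟶ a''} {s : b' ⟶ b''} {l : a'' ⟶ b''} {r' : a'' ⟶ a₃}
    {s' : b'' ⟶ b₃} {k : a₃ ⟶ b₃} (σ : f ≫ v ⟶ u ≫ g) (τ : g ≫ s ⟶ r ≫ l)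
    (υ : l ≫ s' ⟶ r' ≫ k) :
    SquareFactors (𝟙 _) (α_ _ _ _).symm (α_ _ _ _).symm (vertComp σ (vertComp τ υ))
      (vertComp (vertComp σ τ) υ) := by
  simp [SquareFactors, _root_.vertComp_assoc]

theorem vertComp_assoc' {a₃ b₃ : B} {r : a' ⟶ a''} {s : b' ⟶ b''} {l : a'' ⟶ b''} {r' : a'' ⟶ a₃}
    {s' : b'' ⟶ b₃} {k : a₃ ⟶ b₃} (σ : f ≫ v ⟶ u ≫ g) (τ : g ≫ s ⟶ r ≫ l)
    (υ : l ≫ s' ⟶ r' ≫ k) :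
    SquareFactors (𝟙 _) (α_ _ _ _) (α_ _ _ _) (vertComp (vertComp σ τ) υ)
      (vertComp σ (vertComp τ υ)) := by
  simp [SquareFactors, _root_.vertComp_assoc, ← Bicategory.whiskerLeft_comp_assoc,
    ← comp_whiskerRight]

theorem of_eq {σ' : f ≫ v' ⟶ u' ≫ g} (h : f ◁ κ'.hom ≫ σ' = σ ≫ κ.hom ▷ g) :
    SquareFactors (𝟙 f) κ κ' σ σ' := by
  simp [SquareFactors, reassoc_of% h]

/-- Given the changes of the vertical sides, `θ ▷ v` is forced because `σ'` is invertible, and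
whiskering with an equivalence is faithful. -/
theorem unique (h : SquareFactors θ κ κ' σ σ') {θ' : f ⟶ f'} (h' : SquareFactors θ' κ κ' σ σ')
    (_ : IsIso σ') (hv : ∃ e : b ≌ b', e.hom = v) : θ = θ' := by
  obtain ⟨e, rfl⟩ := hv
  apply whiskerRight_injective_of_equivalence e
  rw [← cancel_mono (f' ◁ κ'.hom ≫ σ' ≫ κ.inv ▷ g)]
  exact Eq.trans h (Eq.symm h')

variable {C : Type u₂} [Bicategory.{w₂, v₂} C]

theorem mapSquare (F : B ⥤ᵖ C) (h : SquareFactors θ κ κ' σ σ') :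
    SquareFactors (F.map₂ θ) (F.map₂Iso κ) (F.map₂Iso κ') (_root_.mapSquare F σ)
      (_root_.mapSquare F σ') := by
  unfold SquareFactors at *
  rw [← h, mapSquare_whiskerRight, mapSquare_vertical]
  rfl

theorem mapSquare_vertComp (F : B ⥤ᵖ C) {u' : a' ⟶ a''} {v' : b' ⟶ b''} {h : a'' ⟶ b''}
    (σ : f ≫ v ⟶ u ≫ g) (τ : g ≫ v' ⟶ u' ≫ h) :
    SquareFactors (𝟙 _) (F.mapComp u u').symm (F.mapComp v v').symm
      (vertComp (_root_.mapSquare F σ) (_root_.mapSquare F τ))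
      (_root_.mapSquare F (vertComp σ τ)) := by
  unfold SquareFactors
  dsimp
  rw [← _root_.mapSquare_vertComp]
  simp

theorem mapSquare_vertComp' (F : B ⥤ᵖ C) {u' : a' ⟶ a''} {v' : b' ⟶ b''} {h : a'' ⟶ b''}
    (σ : f ≫ v ⟶ u ≫ g) (τ : g ≫ v' ⟶ u' ≫ h) :
    SquareFactors (𝟙 _) (F.mapComp u u') (F.mapComp v v')
      (_root_.mapSquare F (vertComp σ τ))
      (vertComp (_root_.mapSquare F σ) (_root_.mapSquare F τ)) := by
  unfold SquareFactors
  rw [reassoc_of% _root_.mapSquare_vertComp]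
  simp

end

end SquareFactors

namespace Conjugate

variable {C : Type u₂} [Bicategory.{w₂, v₂} C] {D : Type u₃} [Bicategory.{w₃, v₃} D]
  {E : Type u₄} [Bicategory.{w₄, v₄} E]

section

variable {F : B ⥤ᵖ C} {G : C ⥤ᵖ D} {H : B ⥤ᵖ D} (φ : Pseudofunctor.StrongTrans H (F.comp G))

/-- Naturality of `φ` at the 2-arrow `σ`, combined with its compatibility with the composites at the
source and target of `σ`. -/
theorem nat_mapSquare {a b a' b' : B} {f : a ⟶ b} {u : a ⟶ a'} {v : b ⟶ b'} {g : a' ⟶ b'}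
    (σ : f ≫ v ⟶ u ≫ g) :
    SquareFactors (𝟙 _) (nat φ u).symm (nat φ v).symm
      (vertComp (nat φ f).hom (mapSquare G (mapSquare F σ)))
      (vertComp (mapSquare H σ) (nat φ g).hom) := by
  have h := nat_naturality φ σ
  have h₁ := nat_comp φ f v
  have h₂ := nat_comp φ u g
  rw [← cancel_epi ((H.mapComp f v).inv ▷ _), inv_hom_whiskerRight_assoc] at h₁
  have h₃ : H.map f ◁ (nat φ v).hom ≫ vertComp (nat φ f).hom (mapSquare G (mapSquare F σ)) =
      (α_ _ _ _).inv ≫ horizComp (nat φ f).hom (nat φ v).hom ≫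
        app φ a ◁ mapSquare G (mapSquare F σ) ≫ (α_ _ _ _).inv := by
    simp [vertComp, horizComp]
  have h₄ : G.map₂ (F.mapComp f v).hom ≫ (G.mapComp _ _).hom ≫ mapSquare G (mapSquare F σ) =
      G.map₂ (F.map₂ σ) ≫ G.map₂ (F.mapComp u g).hom ≫ (G.mapComp _ _).hom := by
    simp only [mapSquare, PrelaxFunctor.map₂_comp, Category.assoc, Iso.hom_inv_id_assoc]
    rw [← Category.assoc, ← PrelaxFunctor.map₂_comp, Iso.hom_inv_id]
    simp
  unfold SquareFactors
  rw [← cancel_epi (H.map f ◁ (nat φ v).hom), h₃, h₁]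
  simp only [Category.assoc, ← Bicategory.whiskerLeft_comp_assoc]
  rw [h₄, Bicategory.whiskerLeft_comp, Category.assoc, ← reassoc_of% h, ← reassoc_of% h₂]
  simp [mapSquare, vertComp, horizComp]

end

section

variable {F : B ⥤ᵖ C} {G : C ⥤ᵖ D} {H : B ⥤ᵖ D} {K : D ⥤ᵖ E} {J : C ⥤ᵖ E} {L : B ⥤ᵖ E}
  (φ : Pseudofunctor.StrongTrans H (F.comp G)) (ψ : Pseudofunctor.StrongTrans J (G.comp K))
  (φ₁ : Pseudofunctor.StrongTrans L (H.comp K)) (φ₂ : Pseudofunctor.StrongTrans L (F.comp J))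
  {x y : B} {x₁ y₁ : C} {x₂ y₂ : D} {x₃ y₃ : E}
  {e : x₁ ≌ F.obj x} {e' : y₁ ≌ F.obj y} {d : x₂ ≌ G.obj x₁} {d' : y₂ ≌ G.obj y₁}
  {c : x₃ ≌ K.obj x₂} {c' : y₃ ≌ K.obj y₂}
  {k : x₂ ≌ H.obj x} {k' : y₂ ≌ H.obj y} {j : x₃ ≌ J.obj x₁} {j' : y₃ ≌ J.obj y₁}
  {l : x₃ ≌ L.obj x} {l' : y₃ ≌ L.obj y}
  {a : d.hom ≫ G.map e.hom ≅ k.hom ≫ app φ x} {a' : d'.hom ≫ G.map e'.hom ≅ k'.hom ≫ app φ y}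
  {b : c.hom ≫ K.map d.hom ≅ j.hom ≫ app ψ x₁} {b' : c'.hom ≫ K.map d'.hom ≅ j'.hom ≫ app ψ y₁}
  {a₁ : c.hom ≫ K.map k.hom ≅ l.hom ≫ app φ₁ x} {a₁' : c'.hom ≫ K.map k'.hom ≅ l'.hom ≫ app φ₁ y}
  {a₂ : j.hom ≫ J.map e.hom ≅ l.hom ≫ app φ₂ x} {a₂' : j'.hom ≫ J.map e'.hom ≅ l'.hom ≫ app φ₂ y}
  {m : app φ₁ x ≫ K.map (app φ x) ≅ app φ₂ x ≫ app ψ (F.obj x)}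
  {m' : app φ₁ y ≫ K.map (app φ y) ≅ app φ₂ y ≫ app ψ (F.obj y)}

/-- A chain of moves on a pasting of three squares: `i` is used under `K`, then `i₁`, then `m`. The
isomorphisms accumulated on the vertical sides have the shape of `compare₁`. -/
theorem squareFactors_left {f : x ⟶ y}
    {i : map₁ G d d' (map₁ F e e' f) ⟶ map₁ H k k' f}
    {i₁ : map₁ K c c' (map₁ H k k' f) ⟶ map₁ L l l' f}
    (hi : SquareFactors i a a' (square₂ F G e e' d d' f)
      (vertComp (square H k k' f).hom (nat φ f).hom))
    (hi₁ : SquareFactors i₁ a₁ a₁' (square₂ H K k k' c c' f)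
      (vertComp (square L l l' f).hom (nat φ₁ f).hom))
    (hm : SquareFactors (𝟙 _) m m' (vertComp (nat φ₁ f).hom (mapSquare K (nat φ f).hom))
      (vertComp (nat φ₂ f).hom (nat ψ (F.map f)).hom)) :
    SquareFactors (map₂ K c c' i ≫ i₁)
      (whiskerLeftIso c.hom ((K.mapComp _ _).symm ≪≫ K.map₂Iso a ≪≫ K.mapComp _ _) ≪≫
        (α_ _ _ _).symm ≪≫ whiskerRightIso a₁ _ ≪≫ α_ _ _ _ ≪≫ whiskerLeftIso l.hom m)
      (whiskerLeftIso c'.hom ((K.mapComp _ _).symm ≪≫ K.map₂Iso a' ≪≫ K.mapComp _ _) ≪≫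
        (α_ _ _ _).symm ≪≫ whiskerRightIso a₁' _ ≪≫ α_ _ _ _ ≪≫ whiskerLeftIso l'.hom m')
      (vertComp (square K c c' (map₁ G d d' (map₁ F e e' f))).hom
        (vertComp (mapSquare K (square G d d' (map₁ F e e' f)).hom)
          (mapSquare K (mapSquare G (square F e e' f).hom))))
      (vertComp (square L l l' f).hom (vertComp (nat φ₂ f).hom (nat ψ (F.map f)).hom)) := by
  have h₁ := (SquareFactors.mapSquare_vertComp K _ _).trans
    ((hi.mapSquare K).trans (SquareFactors.mapSquare_vertComp' K _ _))
  have h₂ := h₁.vertComp_right (τ := (square K c c' (map₁ G d d' (map₁ F e e' f))).hom)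
    (φ := map₂ K c c' i) (by simpa using map₂_square K c c' i)
  have h₃ := h₂.trans ((SquareFactors.vertComp_assoc _ _ _).trans
    ((hi₁.vertComp_left (mapSquare K (nat φ f).hom)).trans
    ((SquareFactors.vertComp_assoc' _ _ _).trans
      (hm.vertComp_right (φ := 𝟙 _) (τ := (square L l l' f).hom)
        (τ' := (square L l l' f).hom) (by simp)))))
  simpa using h₃

/-- The same pasting is treated in the other order, using the naturality of `ψ` at a square. The
accumulated isomorphisms now have the shape of `compare₂`. -/
theorem squareFactors_right {f : x ⟶ y}
    {i : map₁ K c c' (map₁ G d d' (map₁ F e e' f)) ⟶ map₁ J j j' (map₁ F e e' f)}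
    {i₂ : map₁ J j j' (map₁ F e e' f) ⟶ map₁ L l l' f}
    (hi : SquareFactors i b b' (square₂ G K d d' c c' (map₁ F e e' f))
      (vertComp (square J j j' (map₁ F e e' f)).hom (nat ψ (map₁ F e e' f)).hom))
    (hi₂ : SquareFactors i₂ a₂ a₂' (square₂ F J e e' j j' f)
      (vertComp (square L l l' f).hom (nat φ₂ f).hom)) :
    SquareFactors (i ≫ i₂)
      ((α_ _ _ _).symm ≪≫ whiskerRightIso b _ ≪≫ α_ _ _ _ ≪≫
        whiskerLeftIso j.hom (nat ψ e.hom).symm ≪≫ (α_ _ _ _).symm ≪≫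
        whiskerRightIso a₂ _ ≪≫ α_ _ _ _)
      ((α_ _ _ _).symm ≪≫ whiskerRightIso b' _ ≪≫ α_ _ _ _ ≪≫
        whiskerLeftIso j'.hom (nat ψ e'.hom).symm ≪≫ (α_ _ _ _).symm ≪≫
        whiskerRightIso a₂' _ ≪≫ α_ _ _ _)
      (vertComp (square K c c' (map₁ G d d' (map₁ F e e' f))).hom
        (vertComp (mapSquare K (square G d d' (map₁ F e e' f)).hom)
          (mapSquare K (mapSquare G (square F e e' f).hom))))
      (vertComp (square L l l' f).hom (vertComp (nat φ₂ f).hom (nat ψ (F.map f)).hom)) := by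
  have h₁ := (SquareFactors.vertComp_assoc (square K c c' (map₁ G d d' (map₁ F e e' f))).hom
    (mapSquare K (square G d d' (map₁ F e e' f)).hom)
    (mapSquare K (mapSquare G (square F e e' f).hom))).trans
    ((hi.vertComp_left _).trans ((SquareFactors.vertComp_assoc' _ _ _).trans
    (((nat_mapSquare ψ (square F e e' f).hom).vertComp_right (φ := 𝟙 _)
      (τ := (square J j j' (map₁ F e e' f)).hom) (by simp)).trans
    ((SquareFactors.vertComp_assoc _ _ _).trans ((hi₂.vertComp_left _).trans
      (SquareFactors.vertComp_assoc' _ _ _))))))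
  simpa using h₁

end

end Conjugate
end Bicategories

/-! ### Coherence of transitivity of restriction -/

namespace FiberedTwoGroupoid

variable {X : Type t} [TopologicalSpace X] (P : FiberedTwoGroupoid.{w, v, u} X)
  {U U' U'' V W T S : Opens X}
  {hU : V ≤ U} {hU' : V ≤ U'} {hU'' : V ≤ U''} {x : P.Fib U} {y : P.Fib U'}
  {z : P.Fib U''} (h : W ≤ V) (k : T ≤ W) (l : S ≤ T)

theorem exists_equivalence {a b : P.Fib V} (f : a ⟶ b) : ∃ e : a ≌ b, e.hom = f :=
  ⟨(P.isTwoGroupoid V).equiv f, rfl⟩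

instance {a b : P.Fib V} {f g : a ⟶ b} (η : f ⟶ g) : IsIso η :=
  (P.isTwoGroupoid V).isIso η

/-- The two nested `cancelRight` in `resRes` are undone in turn, which puts it in the form required
by the `comparison` lemmas. -/
theorem resRes_squareTrans (f : (P.res hU).obj x ⟶ (P.res hU').obj y) :
    (P.resRes h k f).hom ▷
        ((P.cE (h.trans hU') k y).hom ≫ (P.res k).map (P.cE hU' h y).hom) ≫
      Conjugate.squareTrans (P.φ h k) (d := P.cE (h.trans hU) k x) (d' := P.cE (h.trans hU') k y)
        (e := P.cE hU h x) (e' := P.cE hU' h y) (k := P.cE hU (k.trans h) x)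
        (k' := P.cE hU' (k.trans h) y) (P.α hU h k x) (P.α hU' h k y) f =
      Conjugate.square₂ (P.res h) (P.res k) (P.cE hU h x) (P.cE hU' h y)
        (P.cE (h.trans hU) k x) (P.cE (h.trans hU') k y) f := by
  apply Conjugate.comparison_squareTrans
  have h₁ := cancelRight_hom_whiskerRight (P.cE (h.trans hU') k y)
    (p := P.res₁ k (P.res₁ h f)) (q := P.res₁ (k.trans h) f)
  have h₂ := cancelRight_hom_whiskerRight
    ((P.isTwoGroupoid T).equiv ((P.res k).map (P.c hU' h y)))
    (p := P.res₁ k (P.res₁ h f) ≫ (P.cE (h.trans hU') k y).hom)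
    (q := P.res₁ (k.trans h) f ≫ (P.cE (h.trans hU') k y).hom)
  refine (congrArg (· ▷ (P.res k).map (P.cE hU' h y).hom) (h₁ _)).trans ?_
  exact h₂ _

theorem resRes_naturality {f g : (P.res hU).obj x ⟶ (P.res hU').obj y} (η : f ⟶ g) :
    P.res₂ k (P.res₂ h η) ≫ (P.resRes h k g).hom =
      (P.resRes h k f).hom ≫ P.res₂ (k.trans h) η :=
  comparison_naturality (P.exists_equivalence _) (Conjugate.square₂_naturality η)
    (Conjugate.squareTrans_naturality (P.φ h k) (P.α hU h k x) (P.α hU' h k y) η)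
    (P.resRes_squareTrans h k f) (P.resRes_squareTrans h k g)

theorem resRes_comp (f : (P.res hU).obj x ⟶ (P.res hU').obj y)
    (g : (P.res hU').obj y ⟶ (P.res hU'').obj z) :
    (P.res₂ k (P.resComp h f g).hom ≫ (P.resComp k _ _).hom) ≫
        (compIso (P.resRes h k f) (P.resRes h k g)).hom =
      (P.resRes h k (f ≫ g)).hom ≫ (P.resComp (k.trans h) f g).hom :=
  comparison_comp (P.exists_equivalence _) (Conjugate.square₂_comp f g)
    (Conjugate.squareTrans_comp (P.φ h k) (P.α hU h k x) (P.α hU' h k y) (P.α hU'' h k z) f g)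
    (P.resRes_squareTrans h k f) (P.resRes_squareTrans h k g) (P.resRes_squareTrans h k (f ≫ g))

theorem resRes_id (hU : V ≤ U) (x : P.Fib U) :
    P.res₂ k (P.resId h hU x).hom ≫ (P.resId k (h.trans hU) x).hom =
      (P.resRes h k (𝟙 ((P.res hU).obj x))).hom ≫ (P.resId (k.trans h) hU x).hom :=
  comparison_id (P.exists_equivalence _) Conjugate.square₂_id
    (Conjugate.squareTrans_id (P.φ h k) (P.α hU h k x)) (P.resRes_squareTrans h k _)

/-- This is the modification axiom for α: `psiNat` and `chiNat` unfold to these vertical composites.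
-/
theorem α_vertComp (f : (P.res hU).obj x ⟶ (P.res hU').obj y) :
    SquareFactors (𝟙 _) (P.α h k l ((P.res hU).obj x)) (P.α h k l ((P.res hU').obj y))
      (vertComp (Conjugate.nat (P.φ (k.trans h) l) f).hom
        (mapSquare (P.res l) (Conjugate.nat (P.φ h k) f).hom))
      (vertComp (Conjugate.nat (P.φ h (l.trans k)) f).hom
        (Conjugate.nat (P.φ k l) ((P.res h).map f)).hom) := by
  have e := P.α_naturality h k l f
  exact SquareFactors.of_eq e

/-- Both sides relate the same two pastings of squares, with vertical sides changed by `compare₁`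
and `compare₂` respectively. The coherence of α identifies these changes, and `SquareFactors.unique`
concludes. -/
theorem resRes_resRes (f : (P.res hU).obj x ⟶ (P.res hU').obj y) :
    P.res₂ l (P.resRes h k f).hom ≫ (P.resRes (k.trans h) l f).hom =
      (P.resRes k l (P.res₁ h f)).hom ≫ (P.resRes h (l.trans k) f).hom := by
  have h₁ := Conjugate.squareFactors_left (P.φ h k) (P.φ k l) (P.φ (k.trans h) l)
    (P.φ h (l.trans k)) (P.resRes_squareTrans h k f) (P.resRes_squareTrans (k.trans h) l f)
    (P.α_vertComp h k l f)
  have h₂ := Conjugate.squareFactors_right (P.φ k l)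
    (P.φ h (l.trans k)) (P.resRes_squareTrans k l (P.res₁ h f))
    (P.resRes_squareTrans h (l.trans k) f)
  have h₁' : SquareFactors (P.res₂ l (P.resRes h k f).hom ≫ (P.resRes (k.trans h) l f).hom)
    (P.compare₁ P.α hU h k l x) (P.compare₁ P.α hU' h k l y) _ _ := h₁
  have h₂' : SquareFactors ((P.resRes k l (P.res₁ h f)).hom ≫ (P.resRes h (l.trans k) f).hom)
    (P.compare₂ P.α hU h k l x) (P.compare₂ P.α hU' h k l y) _ _ := h₂
  rw [P.α_coherence, P.α_coherence] at h₁'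
  exact h₁'.unique h₂' ((P.isTwoGroupoid _).isIso _) (P.exists_equivalence _)

end FiberedTwoGroupoid

/-! ### Restriction as a pseudofunctor -/

namespace FiberedTwoGroupoid

variable {X : Type t} [TopologicalSpace X] (P : FiberedTwoGroupoid.{w, v, u} X)

section

variable {V W T : Opens X} (h : W ≤ V) (k : T ≤ W)

/-- The restriction to `V` of an object above a larger open set. -/
def restrictObj (V : Opens X) (i : Σ U : {U : Opens X // V ≤ U}, P.Fib U.1) : P.Fib V :=
  (P.res i.1.2).obj i.2

/-- Restriction of 1-arrows from `V` to `W`, as a pseudofunctor. -/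
noncomputable def restrict : PulledBack (P.restrictObj V) ⥤ᵖ P.Fib W :=
  Conjugate (P.res h) (o' := fun i => (P.res (h.trans i.1.2)).obj i.2)
    (fun i => P.cE i.1.2 h i.2)

variable {U₁ U₂ U₃ U₄ : Opens X} {h₁ : V ≤ U₁} {h₂ : V ≤ U₂} {h₃ : V ≤ U₃} {h₄ : V ≤ U₄}
  {x₁ : P.Fib U₁} {x₂ : P.Fib U₂} {x₃ : P.Fib U₃} {x₄ : P.Fib U₄}

/-- The object of the source of `restrict` given by an object above `U ⊇ V`. -/
abbrev restrictIndex {U : Opens X} (hU : V ≤ U) (x : P.Fib U) : PulledBack (P.restrictObj V) :=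
  (⟨⟨U, hU⟩, x⟩ : Σ U : {U : Opens X // V ≤ U}, P.Fib U.1)

/-- The restriction of a square of 2-arrows. -/
noncomputable def resFace {f : (P.res h₁).obj x₁ ⟶ (P.res h₂).obj x₂}
    {g : (P.res h₂).obj x₂ ⟶ (P.res h₄).obj x₄} {f' : (P.res h₁).obj x₁ ⟶ (P.res h₃).obj x₃}
    {g' : (P.res h₃).obj x₃ ⟶ (P.res h₄).obj x₄} (η : f ≫ g ⟶ f' ≫ g') :
    P.res₁ h f ≫ P.res₁ h g ⟶ P.res₁ h f' ≫ P.res₁ h g' :=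
  (P.resComp h f g).inv ≫ P.res₂ h η ≫ (P.resComp h f' g').hom

theorem resFace_pasteIso {f f₀ : (P.res h₁).obj x₁ ⟶ (P.res h₂).obj x₂}
    {g g₀ : (P.res h₂).obj x₂ ⟶ (P.res h₄).obj x₄}
    {f' f₀' : (P.res h₁).obj x₁ ⟶ (P.res h₃).obj x₃}
    {g' g₀' : (P.res h₃).obj x₃ ⟶ (P.res h₄).obj x₄} (a : f ≅ f₀) (b : g ≅ g₀) (c : f' ≅ f₀')
    (d : g' ≅ g₀') (η : f ≫ g ⟶ f' ≫ g') :
    P.resFace h (pasteIso a b c d η) =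
      pasteIso (P.res₂Iso h a) (P.res₂Iso h b) (P.res₂Iso h c) (P.res₂Iso h d) (P.resFace h η) :=
  mapSquare_pasteIso (P.restrict h) (x := P.restrictIndex h₁ x₁) (y := P.restrictIndex h₂ x₂)
    (y' := P.restrictIndex h₃ x₃) (z := P.restrictIndex h₄ x₄) a b c d η

theorem res₂_comp {f g k : (P.res h₁).obj x₁ ⟶ (P.res h₂).obj x₂} (η : f ⟶ g) (θ : g ⟶ k) :
    P.res₂ h (η ≫ θ) = P.res₂ h η ≫ P.res₂ h θ := by
  simp [res₂, res₁]

theorem res₂_id (f : (P.res h₁).obj x₁ ⟶ (P.res h₂).obj x₂) :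
    P.res₂ h (𝟙 f) = 𝟙 _ := by
  simp [res₂, res₁]

theorem resRes_comp' (f : (P.res h₁).obj x₁ ⟶ (P.res h₂).obj x₂)
    (g : (P.res h₂).obj x₂ ⟶ (P.res h₃).obj x₃) :
    (P.resComp k _ _).hom ≫ (compIso (P.resRes h k f) (P.resRes h k g)).hom =
      P.res₂ k (P.resComp h f g).inv ≫ (P.resRes h k (f ≫ g)).hom ≫
        (P.resComp (k.trans h) f g).hom := by
  rw [← P.resRes_comp, Category.assoc, ← Category.assoc, ← res₂_comp, Iso.inv_hom_id, res₂_id,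
    Category.id_comp]

/-- This combines the naturality of `resRes` at `η` with its compatibility with the two composites
bounding the square. -/
theorem resFace_resFace {f : (P.res h₁).obj x₁ ⟶ (P.res h₂).obj x₂}
    {g : (P.res h₂).obj x₂ ⟶ (P.res h₄).obj x₄} {f' : (P.res h₁).obj x₁ ⟶ (P.res h₃).obj x₃}
    {g' : (P.res h₃).obj x₃ ⟶ (P.res h₄).obj x₄} (η : f ≫ g ⟶ f' ≫ g') :
    pasteIso (P.resRes h k f) (P.resRes h k g) (P.resRes h k f') (P.resRes h k g')
      (P.resFace k (P.resFace h η)) = P.resFace (k.trans h) η := by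
  rw [pasteIso_eq, Iso.inv_comp_eq, resFace, ← cancel_epi (P.resComp k _ _).hom]
  simp only [Category.assoc, Iso.hom_inv_id_assoc]
  rw [resRes_comp', ← Category.assoc (P.resComp k _ _).hom, resRes_comp', resFace, resFace]
  simp only [res₂_comp, Category.assoc, Iso.hom_inv_id_assoc]
  rw [← reassoc_of% P.resRes_naturality, ← Category.assoc (P.res₂ k (P.resComp h f' g').hom),
    ← res₂_comp, Iso.hom_inv_id, res₂_id, Category.id_comp]

theorem triangle_resQuasiInverse {f : (P.res h₁).obj x₁ ⟶ (P.res h₂).obj x₂}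
    {q : QuasiInverse f} (hq : q.Triangle) : (P.resQuasiInverse h q).Triangle :=
  QuasiInverse.Triangle.map (P.restrict h) (x := P.restrictIndex h₁ x₁)
    (y := P.restrictIndex h₂ x₂) (f := f) (q := ⟨q.inv, q.s, q.r⟩) hq

/-- Restriction commutes with conjugation. -/
noncomputable def resConj {f : (P.res h₁).obj x₁ ⟶ (P.res h₂).obj x₂} (q : QuasiInverse f)
    (γ : (P.res h₁).obj x₁ ⟶ (P.res h₁).obj x₁) :
    P.res₁ h (q.conj γ) ≅ (P.resQuasiInverse h q).conj (P.res₁ h γ) :=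
  P.resComp h _ _ ≪≫ whiskerLeftIso (P.res₁ h q.inv) (P.resComp h γ f)

theorem conjSquare_resQuasiInverse {f : (P.res h₁).obj x₁ ⟶ (P.res h₂).obj x₂}
    (q : QuasiInverse f) (γ : (P.res h₁).obj x₁ ⟶ (P.res h₁).obj x₁) :
    ((P.resQuasiInverse h q).conjSquare (P.res₁ h γ)).hom =
      pasteIso (Iso.refl _) (P.resConj h q γ) (Iso.refl _) (Iso.refl _)
        (P.resFace h (q.conjSquare γ).hom) :=
  QuasiInverse.map_conjSquare (P.restrict h) (x := P.restrictIndex h₁ x₁)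
    (y := P.restrictIndex h₂ x₂) (f := f) ⟨q.inv, q.s, q.r⟩ γ

theorem resRes_comp_id {f : (P.res h₁).obj x₁ ⟶ (P.res h₂).obj x₂}
    {g : (P.res h₂).obj x₂ ⟶ (P.res h₁).obj x₁} (s : f ≫ g ⟶ 𝟙 ((P.res h₁).obj x₁)) :
    (compIso (P.resRes h k f) (P.resRes h k g)).hom ≫ (P.resComp (k.trans h) f g).inv ≫
        P.res₂ (k.trans h) s ≫ (P.resId (k.trans h) h₁ x₁).hom =
      (P.resComp k _ _).inv ≫
        P.res₂ k ((P.resComp h f g).inv ≫ P.res₂ h s ≫ (P.resId h h₁ x₁).hom) ≫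
        (P.resId k (h.trans h₁) x₁).hom := by
  rw [← cancel_epi (P.resComp k _ _).hom, ← Category.assoc, resRes_comp']
  simp only [Category.assoc, Iso.hom_inv_id_assoc, res₂_comp]
  rw [resRes_id, reassoc_of% P.resRes_naturality]

/-- M commutes with the second restriction, and the two quasi-inverses then in play are compatible
with `s` by `resRes_comp_id`. The isomorphism `c` is left free because g_jkl restricted in stages is
only isomorphic to its direct restriction. -/
theorem conjSquare_resRes {f : (P.res h₁).obj x₁ ⟶ (P.res h₂).obj x₂}
    (q : QuasiInverse f) {γ : (P.res (h.trans h₁)).obj x₁ ⟶ (P.res (h.trans h₁)).obj x₁}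
    {γ' : (P.res ((k.trans h).trans h₁)).obj x₁ ⟶ (P.res ((k.trans h).trans h₁)).obj x₁}
    (c : P.res₁ k γ ≅ γ') :
    ((P.resQuasiInverse (k.trans h) q).conjSquare γ').hom =
      pasteIso (P.resRes h k f)
        (P.resConj k (P.resQuasiInverse h q) γ ≪≫
          compIso (P.resRes h k q.inv) (compIso c (P.resRes h k f)))
        c (P.resRes h k f)
        (P.resFace k ((P.resQuasiInverse h q).conjSquare γ).hom) := by
  rw [QuasiInverse.conjSquare_pasteIso (P.resQuasiInverse k (P.resQuasiInverse h q))
    (P.resQuasiInverse (k.trans h) q) (P.resRes h k f) (P.resRes h k q.inv)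
    (by
      have := P.resRes_comp_id h k q.s.hom
      simp only [resQuasiInverse, Iso.trans_hom, Iso.symm_hom, res₂Iso_hom]
      exact this) c, conjSquare_resQuasiInverse, pasteIso_pasteIso]
  congr 1 <;> ext <;> simp

end
end FiberedTwoGroupoid

/-! ### Restriction of the cubes, and the cocycle condition -/

namespace FiberedTwoGroupoid

variable {X : Type t} [TopologicalSpace X] {P : FiberedTwoGroupoid.{w, v, u} X}

section

variable (P) {V W : Opens X} (h : W ≤ V)

/-- The vertices are indexed by objects above larger open sets, because the restriction of an arrow
depends on how its endpoints are so presented. -/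
theorem cubeCommutes_resFace {i₀₀₀ i₁₀₀ i₀₁₀ i₀₀₁ i₁₁₀ i₁₀₁ i₀₁₁ i₁₁₁ :
      Σ U : {U : Opens X // V ≤ U}, P.Fib U.1}
    {a₁ : P.restrictObj V i₀₀₀ ⟶ P.restrictObj V i₁₀₀}
    {a₂ : P.restrictObj V i₀₀₀ ⟶ P.restrictObj V i₀₁₀}
    {a₃ : P.restrictObj V i₀₀₀ ⟶ P.restrictObj V i₀₀₁}
    {b₁₂ : P.restrictObj V i₁₀₀ ⟶ P.restrictObj V i₁₁₀}
    {b₁₃ : P.restrictObj V i₁₀₀ ⟶ P.restrictObj V i₁₀₁}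
    {b₂₁ : P.restrictObj V i₀₁₀ ⟶ P.restrictObj V i₁₁₀}
    {b₂₃ : P.restrictObj V i₀₁₀ ⟶ P.restrictObj V i₀₁₁}
    {b₃₁ : P.restrictObj V i₀₀₁ ⟶ P.restrictObj V i₁₀₁}
    {b₃₂ : P.restrictObj V i₀₀₁ ⟶ P.restrictObj V i₀₁₁}
    {c₁ : P.restrictObj V i₀₁₁ ⟶ P.restrictObj V i₁₁₁}
    {c₂ : P.restrictObj V i₁₀₁ ⟶ P.restrictObj V i₁₁₁}
    {c₃ : P.restrictObj V i₁₁₀ ⟶ P.restrictObj V i₁₁₁}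
    {F₁₂ : a₁ ≫ b₁₂ ⟶ a₂ ≫ b₂₁} {G₁₂ : b₃₁ ≫ c₂ ⟶ b₃₂ ≫ c₁}
    {F₁₃ : a₁ ≫ b₁₃ ⟶ a₃ ≫ b₃₁} {G₁₃ : b₂₁ ≫ c₃ ⟶ b₂₃ ≫ c₁}
    {F₂₃ : a₂ ≫ b₂₃ ⟶ a₃ ≫ b₃₂} {G₂₃ : b₁₂ ≫ c₃ ⟶ b₁₃ ≫ c₂}
    (hc : CubeCommutes F₁₂ G₁₂ F₁₃ G₁₃ F₂₃ G₂₃) :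
    CubeCommutes (P.resFace h F₁₂) (P.resFace h G₁₂) (P.resFace h F₁₃) (P.resFace h G₁₃)
      (P.resFace h F₂₃) (P.resFace h G₂₃) :=
  CubeCommutes.map (P.restrict h) (v₀₀₀ := i₀₀₀) (v₁₀₀ := i₁₀₀) (v₀₁₀ := i₀₁₀) (v₀₀₁ := i₀₀₁)
    (v₁₁₀ := i₁₁₀) (v₁₀₁ := i₁₀₁) (v₀₁₁ := i₀₁₁) (v₁₁₁ := i₁₁₁) (F₁₂ := F₁₂) (G₁₂ := G₁₂)
    (F₁₃ := F₁₃) (G₁₃ := G₁₃) (F₂₃ := F₂₃) (G₂₃ := G₂₃) hc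

end

theorem pasteIso_congr {B : Type u} [Bicategory.{w, v} B] {x y y' z : B} {f f' : x ⟶ y}
    {g g' : y ⟶ z} {h h' : x ⟶ y'} {k k' : y' ⟶ z} {a a' : f ≅ f'} {b b' : g ≅ g'}
    {c c' : h ≅ h'} {d d' : k ≅ k'} (ha : a = a') (hb : b = b') (hc : c = c') (hd : d = d')
    (η : f ≫ g ⟶ h ≫ k) : pasteIso a b c d η = pasteIso a' b' c' d' η := by
  rw [ha, hb, hc, hd]

theorem trans_compIso_compIso {B : Type u} [Bicategory.{w, v} B] {x y y' z : B} {p : x ⟶ z}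
    {a a' : x ⟶ y} {b : y ⟶ z} {c c' : y ⟶ y'} {d d' : y' ⟶ z} (α : p ≅ a ≫ b) (β : b ≅ c ≫ d)
    (r : a ≅ a') (s : c ≅ c') (t : d ≅ d') :
    (α ≪≫ whiskerLeftIso a β) ≪≫ compIso r (compIso s t) =
      (α ≪≫ whiskerRightIso r b ≪≫ whiskerLeftIso a' (β ≪≫ whiskerLeftIso c t)) ≪≫
        whiskerLeftIso a' (whiskerRightIso s d') := by
  ext
  have e := congrArg (a' ◁ ·) (whisker_exchange s.hom t.hom)
  simp only [Bicategory.whiskerLeft_comp] at e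
  simp only [Iso.trans_hom, whiskerLeftIso_hom, whiskerRightIso_hom, compIso_hom, Category.assoc,
    Bicategory.whiskerLeft_comp]
  rw [whisker_exchange_assoc, e]

theorem resRes_resRes_iso (P : FiberedTwoGroupoid.{w, v, u} X) {U U' V W T S : Opens X}
    {hU : V ≤ U} {hU' : V ≤ U'} {x : P.Fib U} {y : P.Fib U'} (h : W ≤ V) (k : T ≤ W) (l : S ≤ T)
    (f : (P.res hU).obj x ⟶ (P.res hU').obj y) :
    P.res₂Iso l (P.resRes h k f) ≪≫ P.resRes (k.trans h) l f =
      P.resRes k l (P.res₁ h f) ≪≫ P.resRes h (l.trans k) f :=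
  Iso.ext (P.resRes_resRes h k l f)

theorem res₂Iso_refl_trans (P : FiberedTwoGroupoid.{w, v, u} X) {U U' V W : Opens X}
    {hU : V ≤ U} {hU' : V ≤ U'} {x : P.Fib U} {y : P.Fib U'} (h : W ≤ V)
    {f : (P.res hU).obj x ⟶ (P.res hU').obj y}
    {g : (P.res (h.trans hU)).obj x ⟶ (P.res (h.trans hU')).obj y} (a : P.res₁ h f ≅ g) :
    P.res₂Iso h (Iso.refl f) ≪≫ a = a ≪≫ Iso.refl g := by
  ext
  simp [res₂_id]

variable {ι : Type s} {U : ι → Opens X}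

namespace Paths

variable (D : P.Paths U) {V W : Opens X} (i j : ι) (hi : V ≤ U i) (hj : V ≤ U j) (h : W ≤ V)

theorem lamRes_hom (γ : D.ob j hj ⟶ D.ob j hj) {γ' : D.ob j (h.trans hj) ⟶ D.ob j (h.trans hj)}
    (c : P.res₁ h γ ≅ γ') :
    (P.resConj h (D.phiInv i j hi hj) γ ≪≫
      compIso (P.resRes (le_inf hi hj) h (D.φ i j).inv)
        (compIso c (P.resRes (le_inf hi hj) h (D.φ i j).hom)) :
      P.res₁ h (D.lam i j hi hj γ) ≅ D.lam i j (h.trans hi) (h.trans hj) γ') =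
    D.lamRes i j hi hj h γ ≪≫
      whiskerLeftIso (D.phiInv i j (h.trans hi) (h.trans hj)).inv (whiskerRightIso c _) := by
  exact trans_compIso_compIso _ _ _ _ _

end Paths

namespace LocalData

variable (D : P.LocalData U) {V W : Opens X} (i j k l m : ι) (hi : V ≤ U i) (hj : V ≤ U j)
  (hk : V ≤ U k) (hl : V ≤ U l) (hm : V ≤ U m) (h : W ≤ V)

theorem mr_hom : (D.mr i j k hi hj hk).hom =
    pasteIso (P.resRes _ (le_inf (le_inf hi hj) hk) (D.φ i k).hom) (Iso.refl _)
      (P.resRes _ (le_inf (le_inf hi hj) hk) (D.φ j k).hom)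
      (P.resRes _ (le_inf (le_inf hi hj) hk) (D.φ i j).hom)
      (P.resFace (le_inf (le_inf hi hj) hk) (D.m i j k).hom) := by
  simp [mr, pasteIso, resFace]

/-- The edge φ_ik comes from U_ik and the face m_ijk from U_ijk, so restricting further to V and W
involves U_ik ⊇ U_ijk ⊇ V ⊇ W. The two ways of comparing the restrictions agree by `resRes_resRes`;
the same holds for φ_jk and φ_ij. The edge g_ijk already lives above U_ijk and needs no such
comparison. -/
theorem resFace_mr :
    pasteIso (P.resRes (le_inf hi hk) h (D.φ i k).hom)
      (P.resRes (le_inf (le_inf hi hj) hk) h (D.g i j k).hom)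
      (P.resRes (le_inf hj hk) h (D.φ j k).hom) (P.resRes (le_inf hi hj) h (D.φ i j).hom)
      (P.resFace h (D.mr i j k hi hj hk).hom) =
    (D.mr i j k (h.trans hi) (h.trans hj) (h.trans hk)).hom := by
  have e := P.resFace_resFace (le_inf (le_inf hi hj) hk) h (D.m i j k).hom
  rw [mr_hom, mr_hom, resFace_pasteIso, pasteIso_pasteIso, ← e, pasteIso_pasteIso]
  have e₁ := P.resRes_resRes_iso (hU := inf_le_right) (hU' := inf_le_left)
    (le_inf (inf_le_left.trans inf_le_left) inf_le_right : U i ⊓ U j ⊓ U k ≤ U i ⊓ U k)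
    (le_inf (le_inf hi hj) hk) h (D.φ i k).hom
  have e₂ := P.resRes_resRes_iso (hU := inf_le_right) (hU' := inf_le_left)
    (le_inf (inf_le_left.trans inf_le_right) inf_le_right : U i ⊓ U j ⊓ U k ≤ U j ⊓ U k)
    (le_inf (le_inf hi hj) hk) h (D.φ j k).hom
  have e₃ := P.resRes_resRes_iso (hU := inf_le_right) (hU' := inf_le_left)
    (le_inf (inf_le_left.trans inf_le_left) (inf_le_left.trans inf_le_right) :
      U i ⊓ U j ⊓ U k ≤ U i ⊓ U j)
    (le_inf (le_inf hi hj) hk) h (D.φ i j).hom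
  exact pasteIso_congr e₁ (P.res₂Iso_refl_trans h
    (P.resRes (le_inf (le_inf hi hj) hk) h (D.g i j k).hom)) e₂ e₃ _

theorem resFace_conjSquare :
    pasteIso (P.resRes (le_inf hi hj) h (D.φ i j).hom)
      (D.lamRes i j hi hj h (D.gr j k l hj hk hl) ≪≫
        whiskerLeftIso (D.phiInv i j (h.trans hi) (h.trans hj)).inv
          (whiskerRightIso (P.resRes (le_inf (le_inf hj hk) hl) h (D.g j k l).hom) _))
      (P.resRes (le_inf (le_inf hj hk) hl) h (D.g j k l).hom)
      (P.resRes (le_inf hi hj) h (D.φ i j).hom)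
      (P.resFace h ((D.phiInv i j hi hj).conjSquare (D.gr j k l hj hk hl)).hom) =
    ((D.phiInv i j (h.trans hi) (h.trans hj)).conjSquare
      (D.gr j k l (h.trans hj) (h.trans hk) (h.trans hl))).hom := by
  rw [← D.lamRes_hom i j hi hj h (D.gr j k l hj hk hl)
    (P.resRes (le_inf (le_inf hj hk) hl) h (D.g j k l).hom)]
  exact (P.conjSquare_resRes (le_inf hi hj) h (QuasiInverse.ofEquivalence (D.φ i j))
    (P.resRes (le_inf (le_inf hj hk) hl) h (D.g j k l).hom)).symm

theorem nuRes_eq (ν : D.NuArrow i j k l hi hj hk hl) :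
    pasteIso (P.resRes (le_inf (le_inf hi hj) hl) h (D.g i j l).hom)
      (D.lamRes i j hi hj h (D.gr j k l hj hk hl) ≪≫
        whiskerLeftIso (D.phiInv i j (h.trans hi) (h.trans hj)).inv
          (whiskerRightIso (P.resRes (le_inf (le_inf hj hk) hl) h (D.g j k l).hom) _))
      (P.resRes (le_inf (le_inf hi hk) hl) h (D.g i k l).hom)
      (P.resRes (le_inf (le_inf hi hj) hk) h (D.g i j k).hom)
      (P.resFace h ν) = D.nuRes i j k l hi hj hk hl h ν := by
  simp [nuRes, pasteIso, resFace]

/-- Each face above W is the restricted face with its edges changed by isomorphisms, and an edge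
receives the same isomorphism in both faces that contain it. Hence preservation of cubes by
restriction and `CubeCommutes.pasteIso` suffice. -/
theorem CubeC.nuRes {ν : D.NuArrow i j k l hi hj hk hl} (hν : D.CubeC i j k l hi hj hk hl ν) :
    D.CubeC i j k l (h.trans hi) (h.trans hj) (h.trans hk) (h.trans hl)
      (D.nuRes i j k l hi hj hk hl h ν) := by
  unfold CubeC
  rw [← D.nuRes_eq i j k l hi hj hk hl h, ← D.resFace_mr i j l hi hj hl h,
    ← D.resFace_mr i j k hi hj hk h, ← D.resFace_mr i k l hi hk hl h,
    ← D.resFace_mr j k l hj hk hl h, ← D.resFace_conjSquare i j k l hi hj hk hl h]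
  exact CubeCommutes.pasteIso _ _ _ _ _ _ _ _ _ _ _ _ (P.cubeCommutes_resFace h
    (i₀₀₀ := ⟨⟨U l, hl⟩, D.x l⟩) (i₁₀₀ := ⟨⟨U i, hi⟩, D.x i⟩) (i₀₁₀ := ⟨⟨U j, hj⟩, D.x j⟩)
    (i₀₀₁ := ⟨⟨U k, hk⟩, D.x k⟩) (i₁₁₀ := ⟨⟨U i, hi⟩, D.x i⟩) (i₁₀₁ := ⟨⟨U i, hi⟩, D.x i⟩)
    (i₀₁₁ := ⟨⟨U j, hj⟩, D.x j⟩) (i₁₁₁ := ⟨⟨U i, hi⟩, D.x i⟩) hν)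

theorem phiInv_triangle : (D.phiInv i j hi hj).Triangle :=
  P.triangle_resQuasiInverse _ (QuasiInverse.ofEquivalence_triangle _)

theorem existsUnique_cubeC :
    ∃! ν : D.NuArrow i j k l hi hj hk hl, D.CubeC i j k l hi hj hk hl ν :=
  CubeCommutes.existsUnique (P.exists_equivalence _) _ _ _ _ _

theorem cocycleCube (ν : ∀ i j k l, D.NuAt i j k l)
    (hν : ∀ i j k l, D.CubeCAt i j k l (ν i j k l)) :
    D.CocycleCube ν i j k l m hi hj hk hl hm := by
  have H : ∀ (i j k l : ι) (hi : V ≤ U i) (hj : V ≤ U j) (hk : V ≤ U k) (hl : V ≤ U l),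
      D.CubeC i j k l hi hj hk hl (D.nur ν i j k l hi hj hk hl) :=
    fun i j k l hi hj hk hl => CubeC.nuRes D i j k l _ _ _ _ _ (hν i j k l)
  -- Five cubes are restrictions of the defining cubes of ν; the remaining two come from λ_ij
  -- applied to ν_jklm and from the bracket at g_klm.
  exact CubeCommutes.hypercube (P.exists_equivalence _) (H i j k l hi hj hk hl)
    (H i j k m hi hj hk hm) (H i j l m hi hj hl hm) (H i k l m hi hk hl hm)
    (H j k l m hj hk hl hm) (QuasiInverse.conjSquare_cube _ _)
    (QuasiInverse.bracket_cube _ _ _ (D.gInv i j k hi hj hk) (D.phiInv_triangle i j hi hj)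
      (D.phiInv_triangle j k hj hk) _ _ _ rfl)

theorem cocycleEquation_of_cocycleCube {ν : ∀ i j k l, D.NuAt i j k l}
    (hν : D.CocycleCube ν i j k l m hi hj hk hl hm) :
    D.CocycleEquation ν i j k l m hi hj hk hl hm := by
  have := CubeCommutes.iff.1 hν
  unfold CocycleEquation
  simp only [Category.assoc] at this ⊢
  exact this

end LocalData

end FiberedTwoGroupoid

theorem proposition6p5 {X : Type t} [TopologicalSpace X]
    (P : FiberedTwoGroupoid.{w, v, u} X) (hP : P.IsTwoGerbe)
    {ι : Type s} (U : ι → Opens X) (hU : ⨆ i, U i = ⊤) (D : P.LocalData U) :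
    (∀ i j k l, ∃! ν : D.NuAt i j k l, D.CubeCAt i j k l ν) ∧
    ∀ ν : ∀ i j k l, D.NuAt i j k l, (∀ i j k l, D.CubeCAt i j k l (ν i j k l)) →
      ∀ (i j k l m : ι) (V : Opens X)
        (hi : V ≤ U i) (hj : V ≤ U j) (hk : V ≤ U k) (hl : V ≤ U l) (hm : V ≤ U m),
        D.CocycleCube ν i j k l m hi hj hk hl hm ∧
        D.CocycleEquation ν i j k l m hi hj hk hl hm := by
  exact ⟨fun i j k l => D.existsUnique_cubeC i j k l _ _ _ _,
    fun ν hν i j k l m V hi hj hk hl hm =>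
      have hc := D.cocycleCube i j k l m hi hj hk hl hm ν hν
      ⟨hc, D.cocycleEquation_of_cocycleCube i j k l m hi hj hk hl hm hc⟩⟩
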